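/- Let $n\in\mathbb N=\{0,1,2,\dots\}$ and consider the boundary value problem $$\varphi''+\frac{2}{r}\varphi'=\frac{\sin 2\varphi}{r^2}+\frac{(\varphi-\sin\varphi\cos\varphi)(1-\cos 2\varphi)}{r^4}\quad(r>0),\qquad \varphi(0)=0,\quad \lim_{r\to\infty}\varphi(r)=n\pi, \tag{$*$}$$ where a solution is a continuous function $\varphi:[0,\infty)\to\mathbb R$, twice differentiable on $(0,\infty)$, that satisfies $(*)$. Then $(*)$ has exactly one solution $Q_n$. It is smooth on $(0,\infty)$ and has finite static energy, $$\frac12\int_0^\infty\Big[(Q_n')^2+\frac{2\sin^2Q_n}{r^2}+\frac{(Q_n-\sin Q_n\cos Q_n)^2}{r^4}\Big]r^2\,dr<\infty .$$ If moreover $n\ge 1$, then $Q_n$ is differentiable on $[0,\infty)$ (one-sidedly at $r=0$) with $Q_n'(r)>0$ for all $r\ge 0$, and there exist unique $\alpha_n>0$ and $\beta_n>0$ such that $$Q_n(r)=n\pi-\alpha_n r^{-2}+O(r^{-6})\ \text{ as } r\to\infty,\qquad Q_n(r)=\beta_n r+O(r^{3})\ \text{ as } r\to 0^+,$$ where the error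 terms satisfy the natural derivative bounds: for every integer $k\ge 0$, $$\frac{d^k}{dr^k}\big(Q_n(r)-n\pi+\alpha_n r^{-2}\big)=O(r^{-6-k})\ \text{ as } r\to\infty,\qquad \frac{d^k}{dr^k}\big(Q_n(r)-\beta_n r\big)=O(r^{3-k})\ \text{ as } r\to 0^+ .$$ -/

import Mathlib

open Real Set Filter Topology MeasureTheory
open scoped ContDiff

namespace AdkinsNappi

/-- `φ` (only its values on `[0, ∞)` matter) is a classical solution of the stationary
Adkins--Nappi boundary value problem of degree `n`: it is twice differentiable on `(0, ∞)`,
solves the equation there, and has boundary values `φ(0) = 0` (attained continuously) and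
`φ(∞) = nπ`. No energy bound and no monotonicity is required. -/
structure IsStationaryMap (n : ℕ) (φ : ℝ → ℝ) : Prop where
  differentiableAt : ∀ r : ℝ, 0 < r → DifferentiableAt ℝ φ r
  differentiableAt_deriv : ∀ r : ℝ, 0 < r → DifferentiableAt ℝ (deriv φ) r
  equation : ∀ r : ℝ, 0 < r →
    deriv (deriv φ) r + 2 / r * deriv φ r =
      sin (2 * φ r) / r ^ 2
        + (φ r - sin (φ r) * cos (φ r)) * (1 - cos (2 * φ r)) / r ^ 4
  map_zero : φ 0 = 0
  continuousWithinAt_zero : ContinuousWithinAt φ (Ici 0) 0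
  tendsto_atTop : Tendsto φ atTop (𝓝 (n * π))

/-- The static Adkins--Nappi energy density, with the weight `r ^ 2` included. It is nonnegative. -/
noncomputable def energyDensity (φ : ℝ → ℝ) (r : ℝ) : ℝ :=
  1 / 2 * ((deriv φ r) ^ 2 + 2 * sin (φ r) ^ 2 / r ^ 2
    + (φ r - sin (φ r) * cos (φ r)) ^ 2 / r ^ 4) * r ^ 2

/-- The static energy `∫₀^∞ energyDensity φ r dr` is finite. -/
def HasFiniteEnergy (φ : ℝ → ℝ) : Prop :=
  IntegrableOn (energyDensity φ) (Ioi 0)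

/-- `φ(r) = nπ - α r⁻² + O(r⁻⁶)` as `r → ∞`, with the natural derivative bounds:
the `k`-th derivative of the error is `O(r^(-6-k))` for every `k`. -/
def ExpansionAtInfinity (n : ℕ) (φ : ℝ → ℝ) (α : ℝ) : Prop :=
  ∀ k : ℕ, iteratedDeriv k (fun r : ℝ => φ r - (n * π - α * r ^ (-2 : ℤ)))
    =O[atTop] fun r : ℝ => r ^ (-6 - (k : ℤ))

/-- `φ(r) = β r + O(r³)` as `r → 0⁺`, with the natural derivative bounds:
the `k`-th derivative of the error is `O(r^(3-k))` for every `k`. -/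
def ExpansionAtZero (φ : ℝ → ℝ) (β : ℝ) : Prop :=
  ∀ k : ℕ, iteratedDeriv k (fun r : ℝ => φ r - β * r)
    =O[𝓝[>] 0] fun r : ℝ => r ^ (3 - (k : ℤ))

end AdkinsNappi

/-! In the variable `x = log r` the equation becomes `ψ'' + ψ' = sin (2ψ) + force ψ * exp (-2x)`,
with `force` half the derivative of `charge ^ 2`: a particle with friction, in a periodic potential
plus one whose strength decays in time. Multiplying by `exp (2x) ψ'` gives the nonincreasing
function `lyapunov`, which is nonpositive because `ψ → 0` at `-∞`. A zero of `ψ` therefore has zero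
velocity and forces `ψ = 0` identically. At the other end, solutions tending to `nπ` do so fast
enough for `lyapunov` to stay above `-(nπ)² / 2`, which excludes maxima above `nπ`. So `0 < ψ < nπ`
when `n ≥ 1`, and only `ψ = 0` remains when `n = 0`.

Uniqueness is a sliding argument. The factor `exp (-2x)` decreases and `force` is nonnegative on
`[0, ∞)`, so shifting a solution to the left turns it into a supersolution. Near both ends the
nonlinearity increases in `ψ` and the maximum principle propagates the ordering from a compact
interval to the line. A large shift of one solution lies above another; the shift can be lowered to
zero because contact at a positive shift is impossible (`Trajectory.lt_shift_of_le`). Exchanging the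
solutions gives equality (`Trajectory.eq_of_tendsto`); comparing a solution with its own shifts
gives monotonicity.

Existence is shooting in the slope `β` at the origin. With `φ = r w` the equation reads `w'' + (4 /
r) w' = source r w` with a smooth right-hand side, solved by a contraction. Let `β₀` be the infimum
of the `β ≥ 0` whose shot exceeds `nπ`; this set is nonempty by `exists_overshoot`. The shot from
`β₀` stays below `nπ`. If it were away from `nπ` at a large time, slopes just above `β₀` would be
caught by friction and could not overshoot (`exists_trapping`), so it converges to `nπ`.

At infinity the linearisation `u'' + u' = 2u` has modes `e ^ x` and `e ^ (-2x)`; convergence removes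
the first, and two passes through variation of constants give the error `e ^ (-6x)`. Derivative
bounds at both ends follow from a symbol calculus, since the error solves an Euler-type equation. -/

namespace AdkinsNappi

/-! ### Elementary properties of the nonlinearity -/

/-- The topological charge density `y - sin y cos y`. -/
noncomputable def charge (y : ℝ) : ℝ := y - sin y * cos y

/-- The quintic part of the nonlinearity, half the derivative of `charge ^ 2`. -/
noncomputable def force (y : ℝ) : ℝ := charge y * (1 - cos (2 * y))

lemma hasDerivAt_charge (y : ℝ) : HasDerivAt charge (2 * sin y ^ 2) y := by
  have h := (hasDerivAt_id y).sub ((hasDerivAt_sin y).mul (hasDerivAt_cos y))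
  refine h.congr_deriv ?_
  have := sin_sq_add_cos_sq y
  linear_combination -this

/-- The derivative `2 sin² y` vanishes at multiples of `π`, so strictness is read off from `sin b
cos b - sin a cos a = sin (b - a) cos (a + b)` and `|sin t| < t` for `t > 0`. -/
lemma charge_strictMono : StrictMono charge := by
  intro a b hab
  have h1 : sin b * cos b - sin a * cos a = sin (b - a) * cos (a + b) := by
    rw [sin_sub, cos_add]
    linear_combination (sin a * cos a) * sin_sq_add_cos_sq b
      - (sin b * cos b) * sin_sq_add_cos_sq a
  have h2 : |sin (b - a)| < b - a := by
    have := abs_sin_lt_abs (x := b - a) (by linarith)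
    rwa [abs_of_pos (by linarith : 0 < b - a)] at this
  have h3 : sin (b - a) * cos (a + b) ≤ |sin (b - a)| := by
    refine (le_abs_self _).trans ?_
    rw [abs_mul]
    exact mul_le_of_le_one_right (abs_nonneg _) (abs_cos_le_one _)
  simp only [charge]
  linarith

lemma charge_zero : charge 0 = 0 := by simp [charge]

lemma charge_nat_mul_pi (n : ℕ) : charge (n * π) = n * π := by simp [charge]

lemma charge_nonneg {y : ℝ} (hy : 0 ≤ y) : 0 ≤ charge y := by
  simpa [charge_zero] using charge_strictMono.monotone hy

lemma charge_neg (y : ℝ) : charge (-y) = -charge y := by simp [charge]; ring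

lemma one_sub_cos_two_mul (y : ℝ) : 1 - cos (2 * y) = 2 * sin y ^ 2 := by
  have := sin_sq_add_cos_sq y
  rw [cos_two_mul]; linear_combination -2 * this

lemma force_eq (y : ℝ) : force y = charge y * (2 * sin y ^ 2) := by
  rw [force, one_sub_cos_two_mul]

lemma force_nonneg {y : ℝ} (hy : 0 ≤ y) : 0 ≤ force y := by
  rw [force_eq]; have := charge_nonneg hy; positivity

lemma contDiff_charge : ContDiff ℝ ∞ charge := by
  unfold charge; fun_prop

lemma contDiff_force : ContDiff ℝ ∞ force := by
  unfold force charge; fun_prop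

lemma sin_nat_mul_pi_add_sq (n : ℕ) (z : ℝ) : sin (n * π + z) ^ 2 = sin z ^ 2 := by
  rw [add_comm, sin_add_nat_mul_pi, mul_pow, ← pow_mul, mul_comm n 2, pow_mul]; simp

lemma sin_two_mul_nat_mul_pi_add (n : ℕ) (z : ℝ) : sin (2 * (n * π + z)) = sin (2 * z) := by
  rw [show 2 * (n * π + z) = 2 * z + n * (2 * π) by ring, sin_add_nat_mul_two_pi]

lemma sin_sq_le_abs (z : ℝ) : sin z ^ 2 ≤ |z| := by
  have h1 := abs_sin_le_one z
  have h2 : |sin z| ≤ |z| := abs_sin_le_abs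
  rw [← sq_abs]; nlinarith [abs_nonneg (sin z)]

lemma sin_sq_le_sq' (z : ℝ) : sin z ^ 2 ≤ z ^ 2 := by
  have h2 : |sin z| ≤ |z| := abs_sin_le_abs
  exact sq_le_sq.mpr h2

/-! ### Uniqueness and comparison principles for second order equations -/

/-- A function with derivative data whose second derivative is controlled by itself and its
first derivative vanishes identically once its Cauchy data vanish. -/
lemma eq_zero_of_abs_deriv_le {d q q' : ℝ → ℝ} {a b K x₀ : ℝ} (hK : 0 ≤ K)
    (hd : ∀ x ∈ Icc a b, HasDerivAt d (q x) x) (hq : ∀ x ∈ Icc a b, HasDerivAt q (q' x) x)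
    (hb : ∀ x ∈ Icc a b, |q' x| ≤ K * (|d x| + |q x|)) (hx₀ : x₀ ∈ Icc a b)
    (h0 : d x₀ = 0) (h1 : q x₀ = 0) : ∀ x ∈ Icc a b, d x = 0 := by
  -- `S = d² + q²` satisfies `|S'| ≤ C S`: the term `2dq` costs at most `S`, and `2q q'` at most `K
  -- (d² + 3 q²)`. The weights `exp (± C x)` then carry `S = 0` in both directions.
  set C := 1 + 3 * K
  set S : ℝ → ℝ := fun x => d x ^ 2 + q x ^ 2
  set S' : ℝ → ℝ := fun x => 2 * d x * q x + 2 * q x * q' x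
  have hS : ∀ x ∈ Icc a b, HasDerivAt S (S' x) x := fun x hx => by
    refine (((hd x hx).pow 2).add ((hq x hx).pow 2)).congr_deriv ?_
    simp [S']
  have hS' : ∀ x ∈ Icc a b, |S' x| ≤ C * S x := fun x hx => by
    have h := hb x hx
    have e1 : |S' x| ≤ 2 * |d x| * |q x| + 2 * |q x| * |q' x| := by
      refine (abs_add_le _ _).trans ?_
      simp [abs_mul]
    have e2 : S x = |d x| ^ 2 + |q x| ^ 2 := by simp [S]
    have e3 : 2 * |q x| * |q' x| ≤ 2 * |q x| * (K * (|d x| + |q x|)) := by gcongr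
    rw [e2]
    refine e1.trans ?_
    simp only [C]
    nlinarith [sq_nonneg (|d x| - |q x|), mul_nonneg hK (sq_nonneg (|d x| - |q x|)),
      mul_nonneg hK (sq_nonneg (|d x|)), mul_nonneg hK (sq_nonneg (|q x|))]
  have hSx : S x₀ = 0 := by simp [S, h0, h1]
  have hnn : ∀ x, 0 ≤ S x := fun x => by positivity
  have key : ∀ σ : ℝ, ∀ x ∈ Icc a b, HasDerivAt (fun x => S x * exp (σ * x))
      ((S' x + σ * S x) * exp (σ * x)) x := fun σ x hx => by
    have h2 : HasDerivAt (fun x => exp (σ * x)) (exp (σ * x) * σ) x := by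
      simpa using ((hasDerivAt_id x).const_mul σ).exp
    exact ((hS x hx).mul h2).congr_deriv (by ring)
  have hmono : MonotoneOn (fun x => S x * exp (C * x)) (Icc a b) := by
    refine monotoneOn_of_deriv_nonneg (convex_Icc a b)
      (fun x hx => (key C x hx).continuousAt.continuousWithinAt)
      (fun x hx => (key C x (interior_subset hx)).differentiableAt.differentiableWithinAt)
      fun x hx => ?_
    rw [(key C x (interior_subset hx)).deriv]
    have := neg_le_of_abs_le (hS' x (interior_subset hx))
    exact mul_nonneg (by linarith) (exp_pos _).le
  have hanti : AntitoneOn (fun x => S x * exp (-C * x)) (Icc a b) := by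
    refine antitoneOn_of_deriv_nonpos (convex_Icc a b)
      (fun x hx => (key (-C) x hx).continuousAt.continuousWithinAt)
      (fun x hx => (key (-C) x (interior_subset hx)).differentiableAt.differentiableWithinAt)
      fun x hx => ?_
    rw [(key (-C) x (interior_subset hx)).deriv]
    have := le_of_abs_le (hS' x (interior_subset hx))
    exact mul_nonpos_of_nonpos_of_nonneg (by linarith) (exp_pos _).le
  intro x hx
  have hle : S x ≤ 0 := by
    rcases le_total x x₀ with h | h
    · have := hmono hx hx₀ h
      simp only [hSx, zero_mul] at this
      exact nonpos_of_mul_nonpos_left this (exp_pos _)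
    · have := hanti hx₀ hx h
      simp only [hSx, zero_mul] at this
      exact nonpos_of_mul_nonpos_left this (exp_pos _)
  have : d x ^ 2 ≤ 0 := by
    have : S x = d x ^ 2 + q x ^ 2 := rfl
    nlinarith [sq_nonneg (q x)]
  exact pow_eq_zero_iff (two_ne_zero) |>.mp (le_antisymm this (sq_nonneg _))

/-- A nonnegative function with vanishing Cauchy data at `a` satisfying the differential
inequality `d'' + d' ≤ K d` vanishes to the right of `a`. Here `A` stands for `d' + d`. -/
lemma eq_zero_of_nonneg_of_deriv_le {d A A' : ℝ → ℝ} {a K : ℝ} (hK : 0 ≤ K)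
    (hd : ∀ x, a ≤ x → HasDerivAt d (A x - d x) x) (hA : ∀ x, a ≤ x → HasDerivAt A (A' x) x)
    (hle : ∀ x, a ≤ x → A' x ≤ K * d x) (hnn : ∀ x, a ≤ x → 0 ≤ d x)
    (h0 : d a = 0) (h1 : A a = 0) : ∀ x, a ≤ x → d x = 0 := by
  -- With only an upper bound on `A'` a quadratic energy is not available. Instead `B = A + K d`
  -- satisfies `B' ≤ K A ≤ K B`, so `B ≤ 0` to the right of `a`. Hence `A ≤ 0`, `d` decreases from
  -- zero, and `d ≥ 0` leaves only zero.
  have key : ∀ x, a ≤ x → HasDerivAt (fun x => (A x + K * d x) * exp (-K * x))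
      ((A' x + K * (A x - d x) - K * (A x + K * d x)) * exp (-K * x)) x := fun x hx => by
    have h2 : HasDerivAt (fun x => exp (-K * x)) (exp (-K * x) * -K) x := by
      simpa using ((hasDerivAt_id x).const_mul (-K)).exp
    exact (((hA x hx).add ((hd x hx).const_mul K)).mul h2).congr_deriv (by simp; ring)
  have hanti : AntitoneOn (fun x => (A x + K * d x) * exp (-K * x)) (Ici a) := by
    refine antitoneOn_of_deriv_nonpos (convex_Ici a)
      (fun x hx => (key x hx).continuousAt.continuousWithinAt)
      (fun x hx => (key x (interior_subset hx)).differentiableAt.differentiableWithinAt)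
      fun x hx => ?_
    have hx := interior_subset hx
    rw [(key x hx).deriv]
    refine mul_nonpos_of_nonpos_of_nonneg ?_ (exp_pos _).le
    nlinarith [hle x hx, hnn x hx, mul_nonneg (mul_nonneg hK hK) (hnn x hx)]
  have hAle : ∀ x, a ≤ x → A x ≤ 0 := fun x hx => by
    have := hanti (self_mem_Ici) hx hx
    simp only [h0, h1, mul_zero, add_zero, zero_mul] at this
    have := nonpos_of_mul_nonpos_left this (exp_pos _)
    nlinarith [hnn x hx, mul_nonneg hK (hnn x hx)]
  have hdanti : AntitoneOn d (Ici a) := by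
    refine antitoneOn_of_deriv_nonpos (convex_Ici a)
      (fun x hx => (hd x hx).continuousAt.continuousWithinAt)
      (fun x hx => (hd x (interior_subset hx)).differentiableAt.differentiableWithinAt)
      fun x hx => ?_
    have hx := interior_subset hx
    rw [(hd x hx).deriv]
    linarith [hAle x hx, hnn x hx]
  intro x hx
  have := hdanti self_mem_Ici hx hx
  rw [h0] at this
  exact le_antisymm this (hnn x hx)

/-- If the second derivative were positive, the point would also be a local minimum; the function
would be locally constant, with zero second derivative. -/
lemma second_deriv_nonpos_of_isLocalMax {d d₁ : ℝ → ℝ} {d₂ x : ℝ} (hmax : IsLocalMax d x)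
    (hd : ∀ᶠ y in 𝓝 x, HasDerivAt d (d₁ y) y) (hd₁ : HasDerivAt d₁ d₂ x) : d₂ ≤ 0 := by
  by_contra! hpos
  have e : deriv d =ᶠ[𝓝 x] d₁ := hd.mono fun y hy => hy.deriv
  have h2 : deriv (deriv d) x = d₂ := by rw [e.deriv_eq]; exact hd₁.deriv
  have hmin := isLocalMin_of_deriv_deriv_pos (f := d) (x₀ := x) (by rw [h2]; exact hpos)
    hmax.deriv_eq_zero hd.self_of_nhds.continuousAt
  have hc : d =ᶠ[𝓝 x] fun _ => d x := by
    filter_upwards [hmin, hmax] with y h1 h2 using le_antisymm h2 h1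
  have h3 : deriv d =ᶠ[𝓝 x] fun _ => 0 := by
    have := hc.deriv
    simpa using this
  have h4 : deriv (deriv d) x = 0 := by rw [h3.deriv_eq]; simp
  linarith

/-- Maximum principle on a right half-line. -/
lemma nonpos_of_comparison {d d₁ d₂ : ℝ → ℝ} {X : ℝ} (hX : d X ≤ 0)
    (hd : ∀ x, X ≤ x → HasDerivAt d (d₁ x) x) (hd₁ : ∀ x, X ≤ x → HasDerivAt d₁ (d₂ x) x)
    (hlim : Tendsto d atTop (𝓝 0)) (hpos : ∀ x, X < x → 0 < d x → d₁ x = 0 → 0 < d₂ x) :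
    ∀ x, X ≤ x → d x ≤ 0 := by
  by_contra! h
  obtain ⟨x₀, hx₀, h0⟩ := h
  -- The limit zero confines a positive supremum to a compact interval, and `d X ≤ 0` keeps the
  -- maximum off the left end.
  obtain ⟨Y, hY⟩ := (hlim.eventually (gt_mem_nhds h0)).exists_forall_of_atTop
  have hY0 : x₀ < Y := by
    by_contra! h; exact lt_irrefl _ (hY x₀ h)
  obtain ⟨m, hm, hmax⟩ := isCompact_Icc.exists_isMaxOn (s := Icc X Y) (f := d) ⟨x₀, hx₀, hY0.le⟩
    fun x hx => (hd x hx.1).continuousAt.continuousWithinAt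
  have hm0 : d x₀ ≤ d m := hmax ⟨hx₀, hY0.le⟩
  have hXm : X < m := lt_of_le_of_ne hm.1 (by rintro rfl; linarith)
  have hmY : m < Y := lt_of_le_of_ne hm.2 (by rintro rfl; linarith [hY m le_rfl])
  have hloc : IsLocalMax d m := hmax.isLocalMax (Icc_mem_nhds hXm hmY)
  have h1 : d₁ m = 0 := hloc.hasDerivAt_eq_zero (hd m hm.1)
  have h2 := second_deriv_nonpos_of_isLocalMax hloc
    ((lt_mem_nhds hXm).mono fun y hy => hd y (le_of_lt hy)) (hd₁ m hm.1)
  exact absurd (hpos m hXm (by linarith) h1) (not_lt.mpr h2)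

/-- Maximum principle on a left half-line. -/
lemma nonpos_of_comparison_left {d d₁ d₂ : ℝ → ℝ} {X : ℝ} (hX : d X ≤ 0)
    (hd : ∀ x, x ≤ X → HasDerivAt d (d₁ x) x) (hd₁ : ∀ x, x ≤ X → HasDerivAt d₁ (d₂ x) x)
    (hlim : Tendsto d atBot (𝓝 0)) (hpos : ∀ x, x < X → 0 < d x → d₁ x = 0 → 0 < d₂ x) :
    ∀ x, x ≤ X → d x ≤ 0 := by
  have h := nonpos_of_comparison (d := fun x => d (-x)) (d₁ := fun x => -d₁ (-x))
    (d₂ := fun x => d₂ (-x)) (X := -X) (by simpa using hX)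
    (fun x hx => by
      exact ((hd (-x) (by linarith)).comp x (hasDerivAt_neg x)).congr_deriv (by ring))
    (fun x hx => by
      exact ((hd₁ (-x) (by linarith)).comp x (hasDerivAt_neg x)).neg.congr_deriv (by ring))
    (hlim.comp tendsto_neg_atTop_atBot)
    (fun x hx h0 h1 => hpos (-x) (by linarith) h0 (by simpa using h1))
  intro x hx
  simpa using h (-x) (by linarith)

/-! ### Trajectories and the Lyapunov function -/

/-- The differential equation in the logarithmic variable `x = log r`, with the boundary
condition at `r = 0`; `p` is the derivative of `ψ`. -/
structure Trajectory (ψ p : ℝ → ℝ) : Prop where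
  hasDerivAt : ∀ x, HasDerivAt ψ (p x) x
  hasDerivAt_velocity :
    ∀ x, HasDerivAt p (sin (2 * ψ x) + force (ψ x) * exp (-2 * x) - p x) x
  tendsto_atBot : Tendsto ψ atBot (𝓝 0)

/-- A Lyapunov function of the stationary equation. -/
noncomputable def lyapunov (ψ p : ℝ → ℝ) (x : ℝ) : ℝ :=
  exp (2 * x) * (p x ^ 2 / 2 - sin (ψ x) ^ 2) - charge (ψ x) ^ 2 / 2

namespace Trajectory

variable {ψ p : ℝ → ℝ}

lemma continuous (h : Trajectory ψ p) : Continuous ψ :=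
  continuous_iff_continuousAt.mpr fun x => (h.hasDerivAt x).continuousAt

/-- The weight `exp (2x)` is the one for which friction cancels against the derivative of the weight
on `p² / 2`; the force term cancels against `charge² / 2`. What remains is the derivative of the
weight on `sin²`. -/
lemma hasDerivAt_lyapunov (h : Trajectory ψ p) (x : ℝ) :
    HasDerivAt (lyapunov ψ p) (-(2 * exp (2 * x) * sin (ψ x) ^ 2)) x := by
  have h1 : HasDerivAt (fun x => exp (2 * x)) (exp (2 * x) * 2) x := by
    simpa using ((hasDerivAt_id x).const_mul 2).exp
  have h2 := ((h.hasDerivAt_velocity x).pow 2).div_const 2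
  have h3 := ((h.hasDerivAt x).sin).pow 2
  have h4 := (((hasDerivAt_charge (ψ x)).comp x (h.hasDerivAt x)).pow 2).div_const 2
  refine ((h1.mul (h2.sub h3)).sub h4).congr_deriv ?_
  have e : exp (-2 * x) * exp (2 * x) = 1 := by rw [← exp_add]; simp
  simp only [Function.comp, Pi.pow_apply, Pi.sub_apply, force_eq, sin_two_mul]
  push_cast
  linear_combination (charge (ψ x) * 2 * sin (ψ x) ^ 2 * p x) * e

lemma antitone_lyapunov (h : Trajectory ψ p) : Antitone (lyapunov ψ p) := by
  refine antitone_of_deriv_nonpos (fun x => (h.hasDerivAt_lyapunov x).differentiableAt) fun x => ?_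
  rw [(h.hasDerivAt_lyapunov x).deriv]
  have := exp_pos (2 * x)
  simp only [Left.neg_nonpos_iff]; positivity

/-- Nothing is assumed about `p` at `-∞`. The mean value theorem on unit intervals supplies points
arbitrarily far left where `p` is small; there `lyapunov` is at most a small number, and it is
nonincreasing. -/
lemma lyapunov_nonpos (h : Trajectory ψ p) (x : ℝ) : lyapunov ψ p x ≤ 0 := by
  refine le_of_forall_pos_le_add fun ε hε => ?_
  have hlim : Tendsto (fun y => ψ (y + 1) - ψ y) atBot (𝓝 0) := by
    simpa using (h.tendsto_atBot.comp (tendsto_atBot_add_const_right _ 1 tendsto_id)).sub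
      h.tendsto_atBot
  have h1 := hlim.eventually (Metric.ball_mem_nhds 0 (show 0 < min 1 ε by positivity))
  obtain ⟨y, hy, hyx⟩ := (h1.and (eventually_le_atBot (min (-1) (x - 1)))).exists
  obtain ⟨ξ, hξ, hξ'⟩ := exists_hasDerivAt_eq_slope ψ p (show y < y + 1 by linarith)
    h.continuous.continuousOn fun z _ => h.hasDerivAt z
  have hp : |p ξ| < min 1 ε := by
    rw [hξ']; simpa [Real.dist_eq] using hy
  have hξx : ξ ≤ x := by
    have := hyx.trans (min_le_right _ _); linarith [hξ.2]
  have hξ0 : exp (2 * ξ) ≤ 1 := by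
    have := hyx.trans (min_le_left _ _)
    exact exp_le_one_iff.mpr (by linarith [hξ.2])
  refine (h.antitone_lyapunov hξx).trans ?_
  have a1 : p ξ ^ 2 ≤ ε := by
    rw [← sq_abs]
    have := hp.trans_le (min_le_left _ _)
    have := hp.trans_le (min_le_right _ _)
    nlinarith [abs_nonneg (p ξ)]
  have a2 : exp (2 * ξ) * p ξ ^ 2 ≤ 1 * ε := mul_le_mul hξ0 a1 (sq_nonneg _) zero_le_one
  unfold lyapunov
  nlinarith [mul_nonneg (exp_pos (2 * ξ)).le (sq_nonneg (sin (ψ ξ))), sq_nonneg (charge (ψ ξ))]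

/-- The sum `lyapunov + exp (2x)` has derivative `2 exp (2x) (1 - sin²)`, hence is nondecreasing,
and it is bounded below by `-charge² / 2`, which tends to zero at `-∞`. For small radius this makes
`exp x * p` about as large as `charge ψ`. -/
lemma neg_exp_le_lyapunov (h : Trajectory ψ p) (x : ℝ) : -exp (2 * x) ≤ lyapunov ψ p x := by
  have h1 : ∀ x, HasDerivAt (fun x => exp (2 * x)) (exp (2 * x) * 2) x := fun x => by
    simpa using ((hasDerivAt_id x).const_mul 2).exp
  have hm : Monotone fun x => lyapunov ψ p x + exp (2 * x) := by
    refine monotone_of_deriv_nonneg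
      (fun x => ((h.hasDerivAt_lyapunov x).add (h1 x)).differentiableAt) fun x => ?_
    have e := ((h.hasDerivAt_lyapunov x).add (h1 x)).deriv
    change 0 ≤ deriv (lyapunov ψ p + fun x => exp (2 * x)) x
    rw [e]
    have := sin_sq_le_one (ψ x)
    nlinarith [exp_pos (2 * x)]
  have hc : Tendsto (fun y => -(charge (ψ y) ^ 2 / 2)) atBot (𝓝 0) := by
    have := ((contDiff_charge.continuous.tendsto 0).comp h.tendsto_atBot)
    rw [charge_zero] at this
    simpa using ((this.pow 2).div_const 2).neg
  have hle : 0 ≤ lyapunov ψ p x + exp (2 * x) := by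
    refine le_of_tendsto hc ?_
    filter_upwards [eventually_le_atBot x] with y hy
    refine le_trans ?_ (hm hy)
    have := sin_sq_le_one (ψ y)
    simp only [lyapunov]
    nlinarith [exp_pos (2 * y), mul_nonneg (exp_pos (2 * y)).le (sq_nonneg (p y))]
  linarith

/-- The constants `kπ` are the only trajectories passing through `(kπ, 0)`. -/
lemma eq_nat_mul_pi (h : Trajectory ψ p) (k : ℕ) {x₀ : ℝ} (h0 : ψ x₀ = k * π)
    (h1 : p x₀ = 0) (x : ℝ) : ψ x = k * π := by
  set a := min x₀ x
  set b := max x₀ x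
  have hcont : Continuous fun y => charge (ψ y) * exp (-2 * y) :=
    (contDiff_charge.continuous.comp h.continuous).mul (by fun_prop)
  obtain ⟨M, hM⟩ := isCompact_Icc.exists_bound_of_continuousOn (s := Icc a b) hcont.continuousOn
  have hM0 : 0 ≤ M := (norm_nonneg _).trans (hM x₀ ⟨min_le_left _ _, le_max_left _ _⟩)
  have key := eq_zero_of_abs_deriv_le (d := fun y => ψ y - k * π) (q := p) (K := 2 + 2 * M)
    (q' := fun y => sin (2 * ψ y) + force (ψ y) * exp (-2 * y) - p y) (a := a) (b := b) (x₀ := x₀)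
    (by linarith) (fun y _ => by simpa using (h.hasDerivAt y).sub_const (k * π))
    (fun y _ => h.hasDerivAt_velocity y) (fun y hy => ?_)
    ⟨min_le_left _ _, le_max_left _ _⟩ (by simp [h0]) h1 x ⟨min_le_right _ _, le_max_right _ _⟩
  · linarith
  · set z := ψ y - k * π with hz
    have hψ : ψ y = k * π + z := by rw [hz]; ring
    have e1 : |sin (2 * ψ y)| ≤ 2 * |z| := by
      rw [hψ, sin_two_mul_nat_mul_pi_add]
      refine abs_sin_le_abs.trans ?_
      simp [abs_mul]
    -- The factor `sin²` makes the force vanish at `kπ`, so it is controlled by `|z|` even though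
    -- `charge` does not vanish there.
    have e2 : |force (ψ y) * exp (-2 * y)| ≤ M * (2 * |z|) := by
      have : force (ψ y) * exp (-2 * y) = (charge (ψ y) * exp (-2 * y)) * (2 * sin z ^ 2) := by
        rw [force_eq, hψ, sin_nat_mul_pi_add_sq]; ring
      rw [this, abs_mul]
      gcongr
      · exact hM y hy
      · rw [abs_of_nonneg (by positivity)]
        linarith [sin_sq_le_abs z]
    have e3 : |sin (2 * ψ y) + force (ψ y) * exp (-2 * y) - p y|
        ≤ |sin (2 * ψ y)| + |force (ψ y) * exp (-2 * y)| + |p y| :=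
      (abs_sub _ _).trans (by gcongr; exact abs_add_le _ _)
    nlinarith [abs_nonneg z, abs_nonneg (p y), mul_nonneg hM0 (abs_nonneg (p y))]

/-- A trajectory vanishing somewhere vanishes identically. -/
lemma eq_zero_of_eq_zero (h : Trajectory ψ p) {x₀ : ℝ} (h0 : ψ x₀ = 0) (x : ℝ) : ψ x = 0 := by
  have hG : lyapunov ψ p x₀ = exp (2 * x₀) * (p x₀ ^ 2 / 2) := by
    simp [lyapunov, h0, charge_zero]
  -- At a zero of `ψ` only the kinetic term of `lyapunov` survives, and it cannot be positive.
  have hp : p x₀ = 0 := by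
    have h1 := h.lyapunov_nonpos x₀
    rw [hG] at h1
    have h2 := nonpos_of_mul_nonpos_right h1 (exp_pos _)
    have h3 : p x₀ ^ 2 = 0 := le_antisymm (by linarith) (sq_nonneg _)
    exact pow_eq_zero_iff two_ne_zero |>.mp h3
  simpa using h.eq_nat_mul_pi 0 (by simpa using h0) hp x

end Trajectory

/-! ### The nonlinearity near its equilibria -/

/-- Width of the neighbourhood of `nπ` on which the nonlinearity is monotone. -/
noncomputable def monotoneWidth (n : ℕ) : ℝ := 1 / (4 * (n * π + 1))

lemma nat_mul_pi_nonneg (n : ℕ) : 0 ≤ (n : ℝ) * π := by positivity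

lemma monotoneWidth_pos (n : ℕ) : 0 < monotoneWidth n := by
  have := nat_mul_pi_nonneg n
  unfold monotoneWidth; positivity

lemma monotoneWidth_mul (n : ℕ) : monotoneWidth n * (n * π + 1) = 1 / 4 := by
  have := nat_mul_pi_nonneg n
  unfold monotoneWidth; field_simp

lemma monotoneWidth_le (n : ℕ) : monotoneWidth n ≤ 1 / 4 := by
  have := monotoneWidth_mul n
  nlinarith [monotoneWidth_pos n, nat_mul_pi_nonneg n]

lemma two_mul_sub_le_sin_two_mul {z : ℝ} (h0 : 0 < z) :
    2 * z - 2 * z ^ 3 < sin (2 * z) := by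
  have := sin_gt_sub_cube (x := 2 * z) (by linarith)
  linarith [show (2 * z) ^ 3 / 6 = 4 / 3 * z ^ 3 by ring, pow_pos h0 3]

/-- The constant `3 / 4` is what makes `exp (-3x / 2)` a barrier, since `(3/2)² - 3/2 = 3/4`. Above
`nπ` the force has the favourable sign and can be dropped. -/
lemma lt_nonlinearity_of_pos (n : ℕ) {z t : ℝ} (h0 : 0 < z) (h1 : z ≤ monotoneWidth n)
    (ht : 0 ≤ t) : 3 / 4 * z < sin (2 * (n * π + z)) + force (n * π + z) * t := by
  have h2 := h1.trans (monotoneWidth_le n)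
  have h3 := two_mul_sub_le_sin_two_mul h0
  rw [sin_two_mul_nat_mul_pi_add]
  have h4 := mul_nonneg (force_nonneg (add_nonneg (nat_mul_pi_nonneg n) h0.le)) ht
  nlinarith [pow_pos h0 2, mul_nonneg h0.le (mul_nonneg h0.le (sub_nonneg.mpr h2)),
    mul_nonneg h0.le (sub_nonneg.mpr h2)]

/-- Below `nπ` the force opposes the attraction, but it is quadratic: at most `2nπ z² ≤ z / 2` by
the choice of `monotoneWidth`, against a sine term of size almost `2z`. -/
lemma nonlinearity_lt_of_neg (n : ℕ) {z t : ℝ} (h0 : 0 < z) (h1 : z ≤ monotoneWidth n)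
    (ht : 0 ≤ t) (ht1 : t ≤ 1) :
    sin (2 * (n * π + -z)) + force (n * π + -z) * t < 3 / 4 * -z := by
  have h2 := h1.trans (monotoneWidth_le n)
  have h3 := two_mul_sub_le_sin_two_mul h0
  have h4 : force (n * π + -z) * t ≤ n * π * (2 * z ^ 2) := by
    rw [force_eq, sin_nat_mul_pi_add_sq]
    have e1 : charge (n * π + -z) ≤ n * π := by
      exact (charge_strictMono.monotone (by linarith : n * π + -z ≤ n * π)).trans_eq
        (charge_nat_mul_pi n)
    have e2 : sin (-z) ^ 2 ≤ z ^ 2 := by simpa using sin_sq_le_sq' (-z)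
    calc charge (n * π + -z) * (2 * sin (-z) ^ 2) * t
        ≤ n * π * (2 * sin (-z) ^ 2) * t := by gcongr
      _ ≤ n * π * (2 * sin (-z) ^ 2) * 1 := by gcongr
      _ ≤ n * π * (2 * z ^ 2) := by
        rw [mul_one]; gcongr
  have h5 : n * π * (2 * z ^ 2) ≤ 1 / 2 * z := by
    have e := monotoneWidth_mul n
    have : z * (n * π) ≤ 1 / 4 := by
      have := mul_le_mul_of_nonneg_right h1 (nat_mul_pi_nonneg n)
      nlinarith [monotoneWidth_pos n]
    nlinarith
  have h6 : sin (2 * (n * π + -z)) = -sin (2 * z) := by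
    rw [sin_two_mul_nat_mul_pi_add, mul_neg, sin_neg]
  rw [h6]
  nlinarith [mul_nonneg h0.le (mul_nonneg h0.le (sub_nonneg.mpr h2)),
    mul_nonneg h0.le (sub_nonneg.mpr h2)]

lemma sin_sq_sub_sin_sq (a b : ℝ) : sin a ^ 2 - sin b ^ 2 = sin (a + b) * sin (a - b) := by
  rw [sin_add, sin_sub]
  linear_combination sin b ^ 2 * sin_sq_add_cos_sq a - sin a ^ 2 * sin_sq_add_cos_sq b

lemma sin_two_mul_sub_sin_two_mul (a b : ℝ) :
    sin (2 * a) - sin (2 * b) = 2 * (cos (a + b) * sin (a - b)) := by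
  rw [show 2 * a = (a + b) + (a - b) by ring, show 2 * b = (a + b) - (a - b) by ring,
    sin_add (a + b), sin_sub (a + b)]; ring

lemma nonlinearity_strictMono_near_zero {y₁ y₂ t : ℝ} (h0 : 0 ≤ y₁) (h1 : y₁ < y₂)
    (h2 : y₂ ≤ π / 4) (ht : 0 ≤ t) :
    sin (2 * y₁) + force y₁ * t < sin (2 * y₂) + force y₂ * t := by
  have e1 : sin (2 * y₁) < sin (2 * y₂) :=
    strictMonoOn_sin ⟨by linarith [pi_pos], by linarith⟩ ⟨by linarith [pi_pos], by linarith⟩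
      (by linarith)
  have e2 : force y₁ ≤ force y₂ := by
    rw [force_eq, force_eq]
    have a1 := charge_nonneg h0
    have a2 := charge_strictMono h1
    have a2' := a1.trans a2.le
    have a3 : 0 ≤ sin y₁ := sin_nonneg_of_nonneg_of_le_pi h0 (by linarith [pi_pos])
    have a4 : sin y₁ ≤ sin y₂ :=
      (strictMonoOn_sin ⟨by linarith [pi_pos], by linarith [pi_pos]⟩
        ⟨by linarith [pi_pos], by linarith [pi_pos]⟩ h1).le
    gcongr
  nlinarith [mul_le_mul_of_nonneg_right e2 ht]

/-- In terms of the distances `z₁ > z₂` to `nπ`, the sine part gains `2 cos (z₁ + z₂) sin (z₁ -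
z₂)`, at least `(7/4) sin (z₁ - z₂)`. The force part loses at most `sin (z₁ - z₂)`, because `nπ sin
(z₁ + z₂) ≤ 1/2` on this neighbourhood. -/
lemma nonlinearity_strictMono_near_nat_mul_pi (n : ℕ) {y₁ y₂ t : ℝ}
    (h0 : n * π - monotoneWidth n ≤ y₁) (h1 : y₁ < y₂) (h2 : y₂ ≤ n * π) (hy : 0 ≤ y₁)
    (ht : 0 ≤ t) (ht1 : t ≤ 1) :
    sin (2 * y₁) + force y₁ * t < sin (2 * y₂) + force y₂ * t := by
  obtain ⟨z₁, rfl⟩ : ∃ z, y₁ = n * π + -z := ⟨n * π - y₁, by ring⟩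
  obtain ⟨z₂, rfl⟩ : ∃ z, y₂ = n * π + -z := ⟨n * π - y₂, by ring⟩
  have hw := monotoneWidth_le n
  have hwm := monotoneWidth_mul n
  have c1 : charge (n * π + -z₁) ≤ charge (n * π + -z₂) := (charge_strictMono h1).le
  have c2 : charge (n * π + -z₂) ≤ n * π :=
    (charge_strictMono.monotone h2).trans_eq (charge_nat_mul_pi n)
  have c0 := charge_nonneg hy
  rw [force_eq, force_eq, sin_nat_mul_pi_add_sq, sin_nat_mul_pi_add_sq,
    sin_two_mul_nat_mul_pi_add, sin_two_mul_nat_mul_pi_add]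
  simp only [mul_neg, sin_neg, neg_sq]
  have d1 := sin_two_mul_sub_sin_two_mul z₁ z₂
  have d2 := sin_sq_sub_sin_sq z₁ z₂
  set s := z₁ + z₂
  have hs0 : 0 ≤ s := by simp only [s]; linarith
  have hs1 : s ≤ 2 * monotoneWidth n := by simp only [s]; linarith
  have hδ : 0 < sin (z₁ - z₂) :=
    sin_pos_of_pos_of_lt_pi (by linarith) (by linarith [pi_gt_three])
  have hcos : 7 / 8 ≤ cos s := by
    have := one_sub_sq_div_two_le_cos (x := s)
    nlinarith
  have hsin : sin s ≤ s := sin_le hs0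
  have hsin0 : 0 ≤ sin s := sin_nonneg_of_nonneg_of_le_pi hs0 (by linarith [pi_gt_three])
  have hns : n * π * sin s ≤ 1 / 2 := by
    have := mul_le_mul_of_nonneg_left (hsin.trans hs1) (nat_mul_pi_nonneg n)
    nlinarith [monotoneWidth_pos n]
  have e1 : charge (n * π + -z₁) * (2 * sin z₁ ^ 2) - charge (n * π + -z₂) * (2 * sin z₂ ^ 2)
      ≤ 2 * (n * π * sin s) * sin (z₁ - z₂) := by
    have a1 : charge (n * π + -z₁) * (2 * sin z₁ ^ 2)
        ≤ charge (n * π + -z₂) * (2 * sin z₁ ^ 2) := by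
      gcongr
    have a2 : charge (n * π + -z₂) * (sin s * sin (z₁ - z₂)) ≤ n * π * (sin s * sin (z₁ - z₂)) := by
      gcongr
    have a3 : 2 * (n * π * sin s) * sin (z₁ - z₂) = 2 * (n * π * (sin s * sin (z₁ - z₂))) := by ring
    rw [a3]
    rw [← d2] at a2 ⊢
    linarith
  have e2 : (charge (n * π + -z₁) * (2 * sin z₁ ^ 2) - charge (n * π + -z₂) * (2 * sin z₂ ^ 2)) * t
      ≤ 1 * sin (z₁ - z₂) := by
    calc _ ≤ (2 * (n * π * sin s) * sin (z₁ - z₂)) * t := by gcongr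
      _ ≤ (2 * (n * π * sin s) * sin (z₁ - z₂)) * 1 := by
        have := nat_mul_pi_nonneg n
        gcongr
      _ ≤ 1 * sin (z₁ - z₂) := by
        rw [mul_one]; gcongr; linarith
  nlinarith

lemma charge_sub_le {y₁ y₂ : ℝ} (h : y₁ ≤ y₂) : charge y₂ - charge y₁ ≤ 2 * (y₂ - y₁) := by
  have hm : Antitone fun y => charge y - 2 * y := by
    have hd : ∀ y, HasDerivAt (fun y => charge y - 2 * y) (2 * sin y ^ 2 - 2 * 1) y :=
      fun y => (hasDerivAt_charge y).sub ((hasDerivAt_id y).const_mul 2)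
    refine antitone_of_deriv_nonpos (fun y => (hd y).differentiableAt) fun y => ?_
    rw [(hd y).deriv]
    linarith [sin_sq_le_one y]
  have := hm h
  simp only at this
  linarith

/-- The one-sided Lipschitz bound that feeds `eq_zero_of_nonneg_of_deriv_le` when two ordered
solutions touch. -/
lemma nonlinearity_sub_le (n : ℕ) {y₁ y₂ t : ℝ} (h0 : 0 ≤ y₁) (h1 : y₁ ≤ y₂) (h2 : y₂ ≤ n * π)
    (ht : 0 ≤ t) :
    sin (2 * y₂) + force y₂ * t - (sin (2 * y₁) + force y₁ * t)
      ≤ (2 + (4 + 2 * (n * π)) * t) * (y₂ - y₁) := by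
  have hδ : |sin (y₂ - y₁)| ≤ y₂ - y₁ := by
    have := abs_sin_le_abs (x := y₂ - y₁)
    rwa [abs_of_nonneg (by linarith : 0 ≤ y₂ - y₁)] at this
  have e1 : sin (2 * y₂) - sin (2 * y₁) ≤ 2 * (y₂ - y₁) := by
    rw [sin_two_mul_sub_sin_two_mul]
    have : cos (y₂ + y₁) * sin (y₂ - y₁) ≤ |sin (y₂ - y₁)| := by
      refine (le_abs_self _).trans ?_
      rw [abs_mul]; exact mul_le_of_le_one_left (abs_nonneg _) (abs_cos_le_one _)
    linarith
  have e2 : force y₂ - force y₁ ≤ (4 + 2 * (n * π)) * (y₂ - y₁) := by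
    have a1 := charge_sub_le h1
    have a2 := charge_strictMono.monotone h1
    have a3 : charge y₁ ≤ n * π :=
      (charge_strictMono.monotone (h1.trans h2)).trans_eq (charge_nat_mul_pi n)
    have a4 := charge_nonneg h0
    have a5 : sin y₂ ^ 2 - sin y₁ ^ 2 ≤ y₂ - y₁ := by
      rw [sin_sq_sub_sin_sq]
      refine le_trans ((le_abs_self _).trans ?_) hδ
      rw [abs_mul]; exact mul_le_of_le_one_left (abs_nonneg _) (abs_sin_le_one _)
    have a6 : force y₂ - force y₁ = (charge y₂ - charge y₁) * (2 * sin y₂ ^ 2)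
        + charge y₁ * (2 * (sin y₂ ^ 2 - sin y₁ ^ 2)) := by rw [force_eq, force_eq]; ring
    have a7 : (charge y₂ - charge y₁) * (2 * sin y₂ ^ 2) ≤ 2 * (y₂ - y₁) * 2 := by
      have := sin_sq_le_one y₂
      have : 0 ≤ charge y₂ - charge y₁ := by linarith
      gcongr
      linarith
    have a8 : charge y₁ * (2 * (sin y₂ ^ 2 - sin y₁ ^ 2)) ≤ n * π * (2 * (y₂ - y₁)) := by
      calc _ ≤ charge y₁ * (2 * (y₂ - y₁)) := by gcongr
        _ ≤ _ := by
          have : 0 ≤ y₂ - y₁ := by linarith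
          gcongr
    rw [a6]; linarith
  nlinarith [mul_le_mul_of_nonneg_right e2 ht]

/-! ### Bounds on solutions with limit `nπ` -/

namespace Trajectory

variable {ψ p : ℝ → ℝ} {n : ℕ}

lemma neg (h : Trajectory ψ p) : Trajectory (fun x => -ψ x) (fun x => -p x) where
  hasDerivAt x := (h.hasDerivAt x).neg
  hasDerivAt_velocity x := by
    refine (h.hasDerivAt_velocity x).neg.congr_deriv ?_
    rw [mul_neg, sin_neg, force_eq, force_eq, charge_neg, sin_neg]; ring
  tendsto_atBot := by simpa using h.tendsto_atBot.neg

/-- Comparison of `± (ψ - nπ)` with the barrier `C exp (-3x / 2)`. Any rate above `1` would serve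
the next lemma, since it makes `exp (2x) sin² ψ` tend to zero. -/
lemma exists_abs_sub_le (h : Trajectory ψ p) (hlim : Tendsto ψ atTop (𝓝 (n * π))) :
    ∃ C X : ℝ, 0 ≤ C ∧ ∀ x, X ≤ x → |ψ x - n * π| ≤ C * exp (-(3 / 2) * x) := by
  have hw := monotoneWidth_pos n
  obtain ⟨X₀, hX₀⟩ := ((hlim.eventually (Metric.closedBall_mem_nhds _ hw))).exists_forall_of_atTop
  set X := max X₀ 0
  have hX : ∀ x, X ≤ x → |ψ x - n * π| ≤ monotoneWidth n := fun x hx => by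
    simpa [Real.dist_eq] using hX₀ x ((le_max_left _ _).trans hx)
  have hexp : ∀ x, X ≤ x → exp (-2 * x) ≤ 1 := fun x hx =>
    exp_le_one_iff.mpr (by linarith [(le_max_right X₀ 0).trans hx])
  set C := monotoneWidth n * exp (3 / 2 * X)
  have hC : 0 < C := by positivity
  have hCX : C * exp (-(3 / 2) * X) = monotoneWidth n := by
    simp only [C]; rw [mul_assoc, ← exp_add]; simp
  set b : ℝ → ℝ := fun x => C * exp (-(3 / 2) * x)
  have hbpos : ∀ x, 0 < b x := fun x => by positivity
  have hb : ∀ k x : ℝ, HasDerivAt (fun x => k * b x) (-(3 / 2) * k * b x) x := fun k x => by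
    have : HasDerivAt (fun x => exp (-(3 / 2) * x)) (exp (-(3 / 2) * x) * (-(3 / 2) * 1)) x :=
      ((hasDerivAt_id x).const_mul _).exp
    exact ((this.const_mul C).const_mul k).congr_deriv (by simp only [b]; ring)
  have hblim : Tendsto b atTop (𝓝 0) := by
    have : Tendsto (fun x : ℝ => exp (-(3 / 2) * x)) atTop (𝓝 0) :=
      tendsto_exp_atBot.comp (tendsto_id.const_mul_atTop_of_neg (by norm_num))
    simpa only [mul_zero] using this.const_mul C
  have hu : Tendsto (fun x => ψ x - n * π) atTop (𝓝 0) := by simpa using hlim.sub_const (n * π)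
  have up := nonpos_of_comparison (X := X) (d := fun x => (ψ x - n * π) - 1 * b x)
    (d₁ := fun x => p x - (-(3 / 2) * 1 * b x))
    (d₂ := fun x => (sin (2 * ψ x) + force (ψ x) * exp (-2 * x) - p x)
      - (-(3 / 2) * (-(3 / 2) * 1) * b x))
    (by have := le_of_abs_le (hX X le_rfl); simp only [b, hCX]; linarith)
    (fun x _ => ((h.hasDerivAt x).sub_const _).sub (hb 1 x))
    (fun x _ => (h.hasDerivAt_velocity x).sub (hb _ x))
    (by simpa using hu.sub (hblim.const_mul 1))
    (fun x hx h0 h1 => by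
      have := lt_nonlinearity_of_pos n (z := ψ x - n * π) (t := exp (-2 * x))
        (by linarith [hbpos x]) (le_of_abs_le (hX x hx.le)) (exp_pos _).le
      rw [add_sub_cancel] at this
      linarith)
  have down := nonpos_of_comparison (X := X) (d := fun x => -(ψ x - n * π) - 1 * b x)
    (d₁ := fun x => -p x - (-(3 / 2) * 1 * b x))
    (d₂ := fun x => -(sin (2 * ψ x) + force (ψ x) * exp (-2 * x) - p x)
      - (-(3 / 2) * (-(3 / 2) * 1) * b x))
    (by have := neg_le_of_abs_le (hX X le_rfl); simp only [b, hCX]; linarith)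
    (fun x _ => ((h.hasDerivAt x).sub_const _).neg.sub (hb 1 x))
    (fun x _ => (h.hasDerivAt_velocity x).neg.sub (hb _ x))
    (by simpa using hu.neg.sub (hblim.const_mul 1))
    (fun x hx h0 h1 => by
      have := nonlinearity_lt_of_neg n (z := -(ψ x - n * π)) (t := exp (-2 * x))
        (by linarith [hbpos x]) (by linarith [neg_le_of_abs_le (hX x hx.le)]) (exp_pos _).le
        (hexp x hx.le)
      rw [neg_neg, add_sub_cancel] at this
      linarith)
  refine ⟨C, X, hC.le, fun x hx => abs_le.mpr ⟨?_, ?_⟩⟩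
  · have := down x hx; simp only [b] at this ⊢; linarith
  · have := up x hx; simp only [b] at this ⊢; linarith

/-- The potential term `exp (2x) sin² ψ` vanishes at `+∞` and the kinetic term only helps, so the
eventual lower bound tends to `-(nπ)² / 2`; monotonicity transfers it to every `x`. -/
lemma neg_sq_le_lyapunov (h : Trajectory ψ p) (hlim : Tendsto ψ atTop (𝓝 (n * π))) (x : ℝ) :
    -((n * π) ^ 2 / 2) ≤ lyapunov ψ p x := by
  obtain ⟨C, X, hC, hdec⟩ := h.exists_abs_sub_le hlim
  have h1 : Tendsto (fun y => -(C ^ 2 * exp (-y)) - charge (ψ y) ^ 2 / 2) atTop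
      (𝓝 (-(C ^ 2 * 0) - (n * π) ^ 2 / 2)) := by
    have a1 : Tendsto (fun y : ℝ => exp (-y)) atTop (𝓝 0) := tendsto_exp_neg_atTop_nhds_zero
    have a2 := (contDiff_charge.continuous.tendsto _).comp hlim
    rw [charge_nat_mul_pi] at a2
    exact (a1.const_mul _).neg.sub ((a2.pow 2).div_const 2)
  simp only [mul_zero, neg_zero, zero_sub] at h1
  refine le_of_tendsto h1 ?_
  filter_upwards [eventually_ge_atTop x, eventually_ge_atTop X] with y hy hyX
  refine le_trans ?_ (h.antitone_lyapunov hy)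
  have hs : sin (ψ y) ^ 2 ≤ (C * exp (-(3 / 2) * y)) ^ 2 := by
    have e : ψ y = n * π + (ψ y - n * π) := by ring
    rw [e, sin_nat_mul_pi_add_sq]
    refine (sin_sq_le_sq' _).trans ?_
    rw [← sq_abs]
    have := hdec y hyX
    gcongr
  have e2 : exp (2 * y) * (C * exp (-(3 / 2) * y)) ^ 2 = C ^ 2 * exp (-y) := by
    rw [mul_pow, ← exp_nat_mul, mul_left_comm, ← exp_add]; congr 2; push_cast; ring
  have e3 : exp (2 * y) * sin (ψ y) ^ 2 ≤ C ^ 2 * exp (-y) := by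
    rw [← e2]; gcongr
  unfold lyapunov
  nlinarith [mul_nonneg (exp_pos (2 * y)).le (sq_nonneg (p y))]

/-- A value above `nπ` would produce a global maximum, since both limits lie below that value. There
`p = 0` and `charge ψ > nπ`, so `lyapunov` would drop below its bound. -/
lemma le_nat_mul_pi (h : Trajectory ψ p) (hlim : Tendsto ψ atTop (𝓝 (n * π))) (x : ℝ) :
    ψ x ≤ n * π := by
  by_contra! hx
  obtain ⟨m, hm⟩ := h.continuous.exists_forall_ge' x (by
    rw [cocompact_eq_atBot_atTop, eventually_sup]
    exact ⟨(h.tendsto_atBot.eventually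
        (gt_mem_nhds ((nat_mul_pi_nonneg n).trans_lt hx))).mono fun _ h => le_of_lt h,
      (hlim.eventually (gt_mem_nhds hx)).mono fun _ h => le_of_lt h⟩)
  have hp : p m = 0 :=
    IsLocalMax.hasDerivAt_eq_zero (Eventually.of_forall hm) (h.hasDerivAt m)
  have h1 := h.neg_sq_le_lyapunov hlim m
  have h2 : n * π < charge (ψ m) := by
    exact (charge_nat_mul_pi n).symm.trans_lt (charge_strictMono (hx.trans_le (hm x)))
  simp only [lyapunov, hp] at h1
  nlinarith [mul_nonneg (exp_pos (2 * m)).le (sq_nonneg (sin (ψ m))), nat_mul_pi_nonneg n]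

lemma eq_zero_of_tendsto_zero (h : Trajectory ψ p) (hlim : Tendsto ψ atTop (𝓝 0)) (x : ℝ) :
    ψ x = 0 := by
  have h1 := h.le_nat_mul_pi (n := 0) (by simpa using hlim) x
  have h2 := h.neg.le_nat_mul_pi (n := 0) (by simpa using hlim.neg) x
  simp only [CharP.cast_eq_zero, zero_mul] at h1 h2
  linarith

/-- Touching `nπ` is a maximum, hence has zero velocity, and the solution would be constant, against
its limit at `-∞`. The bound is a hypothesis, rather than the limit, so that the critical shot can
be treated before its convergence is known. -/
lemma lt_nat_mul_pi_of_le (h : Trajectory ψ p) (hn : 1 ≤ n) (hle : ∀ x, ψ x ≤ n * π) (x : ℝ) :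
    ψ x < n * π := by
  refine lt_of_le_of_ne (hle x) fun heq => ?_
  have hp : p x = 0 := IsLocalMax.hasDerivAt_eq_zero
    (Eventually.of_forall fun y => (hle y).trans_eq heq.symm) (h.hasDerivAt x)
  have hc := h.eq_nat_mul_pi n heq hp
  have h1 : Tendsto ψ atBot (𝓝 (n * π)) := by
    rw [funext hc]; exact tendsto_const_nhds
  have h2 := tendsto_nhds_unique h1 h.tendsto_atBot
  have : (0 : ℝ) < n * π := by
    have : (0 : ℝ) < n := by exact_mod_cast hn
    positivity
  linarith

lemma lt_nat_mul_pi (h : Trajectory ψ p) (hn : 1 ≤ n) (hlim : Tendsto ψ atTop (𝓝 (n * π)))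
    (x : ℝ) : ψ x < n * π :=
  h.lt_nat_mul_pi_of_le hn (h.le_nat_mul_pi hlim) x

lemma pos (h : Trajectory ψ p) (hn : 1 ≤ n) (hlim : Tendsto ψ atTop (𝓝 (n * π))) (x : ℝ) :
    0 < ψ x := by
  have hnπ : (0 : ℝ) < n * π := by
    have : (0 : ℝ) < n := by exact_mod_cast hn
    positivity
  by_contra! hx
  obtain ⟨y, hy, hxy⟩ := ((hlim.eventually (lt_mem_nhds hnπ)).and (eventually_ge_atTop x)).exists
  obtain ⟨z, -, hz⟩ := intermediate_value_Icc hxy h.continuous.continuousOn ⟨hx, hy.le⟩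
  have := h.eq_zero_of_eq_zero hz y
  linarith

end Trajectory

/-! ### The sliding method: uniqueness and monotonicity -/

namespace Trajectory

variable {ψ p ψ₁ p₁ ψ₂ p₂ : ℝ → ℝ} {n : ℕ}

lemma hasDerivAt_shift (h : Trajectory ψ p) (c x : ℝ) :
    HasDerivAt (fun x => ψ (x + c)) (p (x + c)) x := by
  simpa using (h.hasDerivAt (x + c)).comp_add_const x c

lemma hasDerivAt_velocity_shift (h : Trajectory ψ p) (c x : ℝ) :
    HasDerivAt (fun x => p (x + c))
      (sin (2 * ψ (x + c)) + force (ψ (x + c)) * exp (-2 * (x + c)) - p (x + c)) x := by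
  simpa using (h.hasDerivAt_velocity (x + c)).comp_add_const x c

lemma exp_shift_le {c : ℝ} (hc : 0 ≤ c) (x : ℝ) : exp (-2 * (x + c)) ≤ exp (-2 * x) :=
  exp_le_exp.mpr (by linarith)

/-- Ordering of a shifted solution above another one propagates from a compact interval to the
whole line. -/
lemma le_shift_of_forall_mem_Icc (h₁ : Trajectory ψ₁ p₁) (h₂ : Trajectory ψ₂ p₂) (hn : 1 ≤ n)
    (hl₁ : Tendsto ψ₁ atTop (𝓝 (n * π))) (hl₂ : Tendsto ψ₂ atTop (𝓝 (n * π)))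
    {R c : ℝ} (hR : 0 ≤ R) (hc : 0 ≤ c) (hleft : ∀ x ≤ -R, ψ₂ x ≤ π / 4)
    (hright : ∀ x ≥ R, n * π - monotoneWidth n ≤ ψ₁ x)
    (hmid : ∀ x ∈ Icc (-R) R, ψ₂ x ≤ ψ₁ (x + c)) (x : ℝ) : ψ₂ x ≤ ψ₁ (x + c) := by
  have hshift : Tendsto (fun x => ψ₁ (x + c)) atTop (𝓝 (n * π)) :=
    hl₁.comp (tendsto_atTop_add_const_right _ c tendsto_id)
  have hshift' : Tendsto (fun x => ψ₁ (x + c)) atBot (𝓝 0) :=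
    h₁.tendsto_atBot.comp (tendsto_atBot_add_const_right _ c tendsto_id)
  have hd : ∀ x, HasDerivAt (fun x => ψ₂ x - ψ₁ (x + c)) (p₂ x - p₁ (x + c)) x :=
    fun x => (h₂.hasDerivAt x).sub (h₁.hasDerivAt_shift c x)
  have hd₁ := fun x => (h₂.hasDerivAt_velocity x).sub (h₁.hasDerivAt_velocity_shift c x)
  -- The shift lowers the coefficient of a nonnegative force, so `ψ₁ (x + c)` is a supersolution of
  -- the unshifted equation. At a positive critical value of `ψ₂ - ψ₁ (· + c)`, monotonicity of the
  -- nonlinearity then makes the second derivative positive, as the maximum principle requires.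
  have hforce : ∀ x, force (ψ₁ (x + c)) * exp (-2 * (x + c)) ≤
      force (ψ₁ (x + c)) * exp (-2 * x) := fun x =>
    mul_le_mul_of_nonneg_left (exp_shift_le hc x) (force_nonneg (h₁.pos hn hl₁ _).le)
  rcases le_total x (-R) with hx | hx
  · have := nonpos_of_comparison_left (X := -R)
      (by linarith [hmid (-R) ⟨le_rfl, by linarith⟩]) (fun x _ => hd x) (fun x _ => hd₁ x)
      (by simpa using h₂.tendsto_atBot.sub hshift') (fun y hy h0 h1 => by
        have := nonlinearity_strictMono_near_zero (h₁.pos hn hl₁ (y + c)).le (by linarith)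
          (hleft y hy.le) (exp_pos (-2 * y)).le
        linarith [hforce y]) x hx
    linarith
  rcases le_total x R with hx' | hx'
  · exact hmid x ⟨hx, hx'⟩
  · have := nonpos_of_comparison (X := R)
      (by linarith [hmid R ⟨by linarith, le_rfl⟩]) (fun x _ => hd x) (fun x _ => hd₁ x)
      (by simpa using hl₂.sub hshift) (fun y hy h0 h1 => by
        have := nonlinearity_strictMono_near_nat_mul_pi n (hright (y + c) (by linarith))
          (y₂ := ψ₂ y) (by linarith) (h₂.lt_nat_mul_pi hn hl₂ y).le (h₁.pos hn hl₁ (y + c)).le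
          (exp_pos (-2 * y)).le (exp_le_one_iff.mpr (by linarith))
        linarith [hforce y]) x hx'
    linarith

/-- A solution shifted by a positive amount cannot touch another solution from above. -/
lemma lt_shift_of_le (h₁ : Trajectory ψ₁ p₁) (h₂ : Trajectory ψ₂ p₂) (hn : 1 ≤ n)
    (hl₁ : Tendsto ψ₁ atTop (𝓝 (n * π))) (hl₂ : Tendsto ψ₂ atTop (𝓝 (n * π)))
    {c : ℝ} (hc : 0 < c) (hle : ∀ x, ψ₂ x ≤ ψ₁ (x + c)) (x₀ : ℝ) : ψ₂ x₀ < ψ₁ (x₀ + c) := by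
  refine lt_of_le_of_ne (hle x₀) fun heq => ?_
  set d : ℝ → ℝ := fun x => ψ₁ (x + c) - ψ₂ x
  set d₁ : ℝ → ℝ := fun x => p₁ (x + c) - p₂ x
  have hd : ∀ x, HasDerivAt d (d₁ x) x :=
    fun x => (h₁.hasDerivAt_shift c x).sub (h₂.hasDerivAt x)
  have hd₁ := fun x => (h₁.hasDerivAt_velocity_shift c x).sub (h₂.hasDerivAt_velocity x)
  have hforce : ∀ x, force (ψ₁ (x + c)) * exp (-2 * (x + c)) ≤
      force (ψ₁ (x + c)) * exp (-2 * x) := fun x =>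
    mul_le_mul_of_nonneg_left (exp_shift_le hc.le x) (force_nonneg (h₁.pos hn hl₁ _).le)
  have hd0 : d x₀ = 0 := by simp [d, heq]
  have hmin : d₁ x₀ = 0 := IsLocalMin.hasDerivAt_eq_zero
    (Eventually.of_forall fun y => by rw [hd0]; simpa [d] using hle y) (hd x₀)
  -- Contact is a minimum of `d ≥ 0`, so both Cauchy data vanish; the supersolution inequality gives
  -- `d'' + d' ≤ K d` and hence `d = 0` to the right of `x₀`.
  have hzero := eq_zero_of_nonneg_of_deriv_le (d := d) (A := fun x => d₁ x + d x) (a := x₀)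
    (K := 2 + (4 + 2 * (n * π)) * exp (-2 * x₀)) (by positivity)
    (fun x _ => by simpa using hd x) (fun x _ => (hd₁ x).add (hd x))
    (fun x hx => by
      have h1 := nonlinearity_sub_le n (h₂.pos hn hl₂ x).le (hle x)
        (h₁.lt_nat_mul_pi hn hl₁ _).le (exp_pos (-2 * x)).le
      have h2 : (4 + 2 * (n * π)) * exp (-2 * x) * d x
          ≤ (4 + 2 * (n * π)) * exp (-2 * x₀) * d x := by
        have : 0 ≤ d x := by simpa [d] using hle x
        have := nat_mul_pi_nonneg n
        gcongr ?_ * exp ?_ * ?_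
        linarith
      simp only [d, d₁] at h2 ⊢
      linarith [hforce x])
    (fun x _ => by simpa [d] using hle x) hd0 (by simp [hmin, hd0])
  have hnear : ∀ᶠ x in atTop, n * π - 1 < ψ₂ x := hl₂.eventually (lt_mem_nhds (by linarith))
  obtain ⟨x, hx, hx₀⟩ := (hnear.and (eventually_gt_atTop x₀)).exists
  have hdloc : d =ᶠ[𝓝 x] fun _ => 0 :=
    (lt_mem_nhds hx₀).mono fun y hy => hzero y (le_of_lt hy)
  have hd₁loc : d₁ =ᶠ[𝓝 x] fun _ => 0 := (lt_mem_nhds hx₀).mono fun y hy => by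
    have e : d =ᶠ[𝓝 y] fun _ => 0 := (lt_mem_nhds hy).mono fun z hz => hzero z (le_of_lt hz)
    exact (hd y).unique ((hasDerivAt_const y (0 : ℝ)).congr_of_eventuallyEq e)
  have h0 := (hd₁ x).unique ((hasDerivAt_const x (0 : ℝ)).congr_of_eventuallyEq hd₁loc)
  have hv : p₁ (x + c) - p₂ x = 0 := hd₁loc.self_of_nhds
  have hψ : ψ₁ (x + c) = ψ₂ x := by
    have : d x = 0 := hdloc.self_of_nhds
    simpa [d, sub_eq_zero] using this
  rw [hψ] at h0
  -- Both equations now hold for the same values and velocities and differ only in the exponential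
  -- factor. This forces `force (ψ₂ x) = 0`, impossible strictly between `nπ - 1` and `nπ`.
  have hf : force (ψ₂ x) * (exp (-2 * (x + c)) - exp (-2 * x)) = 0 := by linarith
  have hne : exp (-2 * (x + c)) - exp (-2 * x) ≠ 0 := by
    have : exp (-2 * (x + c)) < exp (-2 * x) := exp_lt_exp.mpr (by linarith)
    linarith
  have hf0 := (mul_eq_zero.mp hf).resolve_right hne
  rw [force_eq] at hf0
  have hcpos : 0 < charge (ψ₂ x) := by
    simpa [charge_zero] using charge_strictMono (h₂.pos hn hl₂ x)
  have hs : sin (ψ₂ x) ^ 2 = 0 := by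
    have := (mul_eq_zero.mp hf0).resolve_left hcpos.ne'
    linarith
  rw [show ψ₂ x = n * π + -(n * π - ψ₂ x) by ring, sin_nat_mul_pi_add_sq, sin_neg, neg_sq] at hs
  have hlt := h₂.lt_nat_mul_pi hn hl₂ x
  have : 0 < sin (n * π - ψ₂ x) := sin_pos_of_pos_of_lt_pi (by linarith) (by linarith [pi_gt_three])
  exact absurd hs (by positivity)

/-- The sliding argument: every solution shifted to the left dominates every other solution. -/
lemma le_shift (h₁ : Trajectory ψ₁ p₁) (h₂ : Trajectory ψ₂ p₂) (hn : 1 ≤ n)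
    (hl₁ : Tendsto ψ₁ atTop (𝓝 (n * π))) (hl₂ : Tendsto ψ₂ atTop (𝓝 (n * π)))
    {c : ℝ} (hc : 0 ≤ c) (x : ℝ) : ψ₂ x ≤ ψ₁ (x + c) := by
  obtain ⟨R₁, hR₁⟩ := (h₂.tendsto_atBot.eventually
    (gt_mem_nhds (show (0 : ℝ) < π / 4 by positivity))).exists_forall_of_atBot
  obtain ⟨R₂, hR₂⟩ := (hl₁.eventually
    (lt_mem_nhds (sub_lt_self _ (monotoneWidth_pos n)))).exists_forall_of_atTop
  set R := max 0 (max (-R₁) R₂)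
  have hR0 : 0 ≤ R := le_max_left _ _
  have hleft : ∀ x ≤ -R, ψ₂ x ≤ π / 4 := fun x hx => (hR₁ x (by
    have : -R₁ ≤ R := (le_max_left _ _).trans (le_max_right _ _)
    linarith)).le
  have hright : ∀ x ≥ R, n * π - monotoneWidth n ≤ ψ₁ x := fun x hx =>
    (hR₂ x (((le_max_right _ _).trans (le_max_right _ _)).trans hx)).le
  obtain ⟨m, -, hm⟩ := isCompact_Icc.exists_isMaxOn (s := Icc (-R) R)
    ⟨0, by simpa using hR0⟩ h₂.continuous.continuousOn
  obtain ⟨Y, hY⟩ := (hl₁.eventually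
    (lt_mem_nhds (h₂.lt_nat_mul_pi hn hl₂ m))).exists_forall_of_atTop
  -- For this shift all of `[-R, R]` is moved beyond `Y`, where `ψ₁` exceeds the maximum of `ψ₂` on
  -- the interval.
  set c₁ := max c (Y + R)
  -- Continuous induction on the amount `t` by which the shift `c₁` has been reduced. The set is
  -- closed, and strictness at positive shifts on a compact interval allows `t` to grow. The shift
  -- zero is reached by closedness alone.
  set s : Set ℝ := {t | ∀ x ∈ Icc (-R) R, ψ₂ x ≤ ψ₁ (x + (c₁ - t))}
  have hs : IsClosed s := by
    simp only [s, ofPred_forall]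
    refine isClosed_iInter fun x => isClosed_iInter fun _ => isClosed_le continuous_const ?_
    exact h₁.continuous.comp (by fun_prop)
  have hsub : Icc 0 c₁ ⊆ s := by
    refine (hs.inter isClosed_Icc).Icc_subset_of_forall_exists_gt ?_ ?_
    · intro x hx
      have hYc : Y + R ≤ c₁ := le_max_right _ _
      refine (hm hx).trans (hY _ ?_).le
      linarith [hx.1]
    · rintro t ⟨hts, ht⟩ y hy
      have hcpos : 0 < c₁ - t := by linarith [ht.2]
      have hlt := h₁.lt_shift_of_le h₂ hn hl₁ hl₂ hcpos
        (h₁.le_shift_of_forall_mem_Icc h₂ hn hl₁ hl₂ hR0 hcpos.le hleft hright hts)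
      have hev : ∀ᶠ t' in 𝓝 t, ∀ x ∈ Icc (-R) R, ψ₂ x < ψ₁ (x + (c₁ - t')) := by
        refine isCompact_Icc.eventually_forall_of_forall_eventually fun x _ => ?_
        have e1 : Continuous fun z : ℝ × ℝ => ψ₂ z.2 := h₂.continuous.comp continuous_snd
        have e2 : Continuous fun z : ℝ × ℝ => ψ₁ (z.2 + (c₁ - z.1)) :=
          h₁.continuous.comp (by fun_prop)
        exact e1.continuousAt.eventually_lt e2.continuousAt (hlt x)
      obtain ⟨t', h1, h2⟩ := ((hev.filter_mono nhdsWithin_le_nhds).and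
        (Ioc_mem_nhdsGT (mem_Ioi.mp hy))).exists
      exact ⟨t', fun x hx => (h1 x hx).le, h2⟩
  have hcc : c ≤ c₁ := le_max_left _ _
  have hmem := hsub (show c₁ - c ∈ Icc 0 c₁ from ⟨by linarith, by linarith⟩)
  refine h₁.le_shift_of_forall_mem_Icc h₂ hn hl₁ hl₂ hR0 hc hleft hright (fun x hx => ?_) x
  simpa using hmem x hx

/-- Two trajectories with the same limit at infinity coincide. -/
lemma eq_of_tendsto (h₁ : Trajectory ψ₁ p₁) (h₂ : Trajectory ψ₂ p₂)
    (hl₁ : Tendsto ψ₁ atTop (𝓝 (n * π))) (hl₂ : Tendsto ψ₂ atTop (𝓝 (n * π))) : ψ₁ = ψ₂ := by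
  funext x
  rcases Nat.eq_zero_or_pos n with rfl | hn
  · rw [h₁.eq_zero_of_tendsto_zero (by simpa using hl₁),
      h₂.eq_zero_of_tendsto_zero (by simpa using hl₂)]
  · have e1 := h₁.le_shift h₂ hn hl₁ hl₂ le_rfl x
    have e2 := h₂.le_shift h₁ hn hl₂ hl₁ le_rfl x
    rw [add_zero] at e1 e2
    exact le_antisymm e2 e1

lemma monotone (h : Trajectory ψ p) (hn : 1 ≤ n) (hl : Tendsto ψ atTop (𝓝 (n * π))) :
    Monotone ψ := fun x y hxy => by
  simpa using h.le_shift h hn hl hl (sub_nonneg.mpr hxy) x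

lemma velocity_pos (h : Trajectory ψ p) (hn : 1 ≤ n) (hl : Tendsto ψ atTop (𝓝 (n * π)))
    (x₀ : ℝ) : 0 < p x₀ := by
  have hnn : ∀ x, 0 ≤ p x := fun x => by
    rw [← (h.hasDerivAt x).deriv]; exact (h.monotone hn hl).deriv_nonneg
  refine lt_of_le_of_ne (hnn x₀) fun heq => ?_
  -- The velocity solves the differentiated equation, in which the derivative of `exp (-2x)`
  -- contributes with a favourable sign. A zero of `p ≥ 0` is a minimum, so `p' = 0` there as well
  -- and `p` vanishes to the right, leaving `ψ` unable to rise to `nπ`.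
  set A : ℝ → ℝ := fun x => sin (2 * ψ x) + force (ψ x) * exp (-2 * x)
  have hA0 : A x₀ = 0 := by
    have := IsLocalMin.hasDerivAt_eq_zero
      (Eventually.of_forall fun y => by rw [← heq]; exact hnn y) (h.hasDerivAt_velocity x₀)
    simp only [A]; linarith
  have hforce' : ∀ y, HasDerivAt force (2 * sin y ^ 2 * (2 * sin y ^ 2)
      + charge y * (2 * sin (2 * y))) y := fun y => by
    have e : HasDerivAt (fun y => 1 - cos (2 * y)) (2 * sin (2 * y)) y := by
      refine (((hasDerivAt_id y).const_mul 2).cos.const_sub 1).congr_deriv ?_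
      simp; ring
    refine ((hasDerivAt_charge y).mul e).congr_deriv ?_
    rw [one_sub_cos_two_mul]
  have hA : ∀ x, HasDerivAt A (cos (2 * ψ x) * (2 * p x)
      + ((2 * sin (ψ x) ^ 2 * (2 * sin (ψ x) ^ 2) + charge (ψ x) * (2 * sin (2 * ψ x))) * p x
        * exp (-2 * x) + force (ψ x) * (exp (-2 * x) * (-2 * 1)))) x := fun x => by
    have e1 := ((h.hasDerivAt x).const_mul 2).sin
    have e2 := (hforce' (ψ x)).comp x (h.hasDerivAt x)
    have e3 := ((hasDerivAt_id x).const_mul (-2)).exp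
    exact e1.add (e2.mul e3)
  have hzero := eq_zero_of_nonneg_of_deriv_le (d := p) (A := A) (a := x₀)
    (K := 2 + (4 + 2 * (n * π)) * exp (-2 * x₀)) (by positivity)
    (fun x _ => h.hasDerivAt_velocity x) (fun x _ => hA x)
    (fun x hx => by
      have c0 := charge_nonneg (h.pos hn hl x).le
      have c1 : charge (ψ x) ≤ n * π :=
        (charge_strictMono.monotone (h.lt_nat_mul_pi hn hl x).le).trans_eq (charge_nat_mul_pi n)
      have f0 := mul_nonneg (force_nonneg (h.pos hn hl x).le) (exp_pos (-2 * x)).le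
      have s0 := sin_sq_le_one (ψ x)
      have s1 : 2 * sin (ψ x) ^ 2 * (2 * sin (ψ x) ^ 2) ≤ 2 * 1 * (2 * 1) := by gcongr
      have s2 : charge (ψ x) * (2 * sin (2 * ψ x)) ≤ n * π * (2 * 1) := by
        calc _ ≤ charge (ψ x) * (2 * 1) := by gcongr; exact sin_le_one _
          _ ≤ _ := by gcongr
      have e1 : (2 * sin (ψ x) ^ 2 * (2 * sin (ψ x) ^ 2) + charge (ψ x) * (2 * sin (2 * ψ x)))
          * p x * exp (-2 * x) ≤ (4 + 2 * (n * π)) * p x * exp (-2 * x₀) := by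
        have := nat_mul_pi_nonneg n
        have := hnn x
        calc _ ≤ (4 + 2 * (n * π)) * p x * exp (-2 * x) := by
              refine mul_le_mul_of_nonneg_right ?_ (exp_pos _).le
              exact mul_le_mul_of_nonneg_right (by linarith) this
          _ ≤ _ := by
              gcongr ?_ * exp ?_
              linarith
      have e2 : cos (2 * ψ x) * (2 * p x) ≤ 1 * (2 * p x) := by
        have := hnn x
        gcongr
        exact cos_le_one _
      linarith)
    (fun x _ => hnn x) heq.symm hA0
  have hanti : AntitoneOn ψ (Ici x₀) := by
    refine antitoneOn_of_deriv_nonpos (convex_Ici x₀) h.continuous.continuousOn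
      (fun x _ => (h.hasDerivAt x).differentiableAt.differentiableWithinAt) fun x hx => ?_
    rw [(h.hasDerivAt x).deriv, hzero x (interior_subset hx)]
  have : n * π ≤ ψ x₀ := le_of_tendsto hl <|
    (eventually_ge_atTop x₀).mono fun x hx => hanti self_mem_Ici hx hx
  linarith [h.lt_nat_mul_pi hn hl x₀]

end Trajectory

/-! ### Removing the singularity at the origin by `φ = r w` -/

lemma analyticOnNhd_dslope_zero {f : ℝ → ℝ} (hf : AnalyticOnNhd ℝ f univ) :
    AnalyticOnNhd ℝ (dslope f 0) univ := by
  intro y _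
  rcases eq_or_ne y 0 with rfl | hy
  · obtain ⟨q, hq⟩ := hf 0 (mem_univ _)
    exact ⟨_, hq.has_fpower_series_dslope_fslope⟩
  · refine AnalyticAt.congr (f := fun z => (z - 0)⁻¹ * (f z - f 0)) ?_ ?_
    · exact ((analyticAt_id.sub analyticAt_const).inv (by simpa using hy)).mul
        ((hf y (mem_univ _)).sub analyticAt_const)
    · filter_upwards [dslope_eventuallyEq_slope_of_ne f hy] with z hz
      rw [hz, slope_def_field]; ring

/-- A real analytic function which is `O(y ^ k)` is divisible by `y ^ k`. -/
lemma exists_eq_pow_mul {k : ℕ} : ∀ {f : ℝ → ℝ} {C : ℝ}, AnalyticOnNhd ℝ f univ →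
    (∀ y, |f y| ≤ C * |y| ^ k) → ∃ g, ContDiff ℝ ∞ g ∧ ∀ y, f y = y ^ k * g y := by
  induction k with
  | zero => exact fun {f} _ hf _ => ⟨f, hf.contDiff, fun y => by simp⟩
  | succ k ih =>
    intro f C hf hb
    have h0 : f 0 = 0 := by simpa using hb 0
    have hd := analyticOnNhd_dslope_zero hf
    have hmul : ∀ y, y * dslope f 0 y = f y := fun y => by
      simpa [h0] using sub_smul_dslope f 0 y
    have hne : ∀ y, y ≠ 0 → |dslope f 0 y| ≤ C * |y| ^ k := fun y hy => by
      have h1 := hb y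
      rw [← hmul y, abs_mul, pow_succ] at h1
      have h2 : 0 < |y| := abs_pos.mpr hy
      nlinarith
    -- Division by `y` gives the bound away from zero; continuity of the divided difference extends
    -- it to zero.
    have hle : ∀ y, |dslope f 0 y| ≤ C * |y| ^ k := by
      intro y
      rcases eq_or_ne y 0 with rfl | hy
      · have c1 : Continuous fun y => |dslope f 0 y| :=
          (continuousOn_univ.mp hd.continuousOn).abs
        have c2 : Continuous fun y : ℝ => C * |y| ^ k := by fun_prop
        exact le_of_tendsto_of_tendsto (c1.continuousAt.tendsto.mono_left nhdsWithin_le_nhds)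
          (c2.continuousAt.tendsto.mono_left (nhdsWithin_le_nhds (s := {0}ᶜ)))
          (eventually_nhdsWithin_of_forall hne)
      · exact hne y hy
    obtain ⟨g, hg, hg'⟩ := ih hd hle
    exact ⟨g, hg, fun y => by rw [← hmul y, hg' y]; ring⟩

lemma abs_sin_two_mul_sub_le (y : ℝ) : |sin (2 * y) - 2 * y| ≤ 2 * |y| ^ 3 := by
  rcases lt_trichotomy y 0 with h | rfl | h
  · have h1 := two_mul_sub_le_sin_two_mul (z := -y) (by linarith)
    have h2 := sin_lt (x := 2 * -y) (by linarith)
    rw [abs_of_neg h]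
    rw [mul_neg, sin_neg] at h1 h2
    rw [abs_of_nonneg (by linarith)]; linarith
  · simp
  · have h1 := two_mul_sub_le_sin_two_mul h
    have h2 := sin_lt (x := 2 * y) (by linarith)
    rw [abs_of_pos h, abs_of_neg (by linarith)]; linarith

/-- Since `charge y = -(sin (2y) - 2y) / 2` and `sin y = y s(y)`, the quintic coefficient is `-a
s²`. These orders of vanishing are exactly what cancels the negative powers of `r` in the equation
for `w = φ / r`. -/
lemma exists_coeffs : ∃ a b : ℝ → ℝ, ContDiff ℝ ∞ a ∧ ContDiff ℝ ∞ b ∧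
    (∀ y, sin (2 * y) - 2 * y = y ^ 3 * a y) ∧ ∀ y, force y = y ^ 5 * b y := by
  have hsin : AnalyticOnNhd ℝ (fun y : ℝ => sin (2 * y) - 2 * y) univ := fun y _ => by fun_prop
  have hsin1 : AnalyticOnNhd ℝ sin univ := fun y _ => by fun_prop
  obtain ⟨a, ha, ha'⟩ := exists_eq_pow_mul (k := 3) hsin abs_sin_two_mul_sub_le
  obtain ⟨s, hs, hs'⟩ := exists_eq_pow_mul (k := 1) (C := 1) hsin1
    (fun y => by simpa using abs_sin_le_abs)
  refine ⟨a, fun y => -(a y * s y ^ 2), ha, by fun_prop, ha', fun y => ?_⟩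
  have h1 := ha' y
  have h2 := hs' y
  rw [force_eq, charge, h2]
  rw [sin_two_mul, h2] at h1
  linear_combination (-(y ^ 2 * s y ^ 2)) * h1

/-- The coefficient of `y ^ 3` in `sin (2 y) - 2 y`. -/
noncomputable def cubicCoeff : ℝ → ℝ := exists_coeffs.choose

/-- The coefficient of `y ^ 5` in `force y`. -/
noncomputable def quinticCoeff : ℝ → ℝ := exists_coeffs.choose_spec.choose

lemma contDiff_cubicCoeff : ContDiff ℝ ∞ cubicCoeff := exists_coeffs.choose_spec.choose_spec.1

lemma contDiff_quinticCoeff : ContDiff ℝ ∞ quinticCoeff :=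
  exists_coeffs.choose_spec.choose_spec.2.1

lemma sin_two_mul_sub_eq (y : ℝ) : sin (2 * y) - 2 * y = y ^ 3 * cubicCoeff y :=
  exists_coeffs.choose_spec.choose_spec.2.2.1 y

lemma force_eq_pow_mul (y : ℝ) : force y = y ^ 5 * quinticCoeff y :=
  exists_coeffs.choose_spec.choose_spec.2.2.2 y

/-- The right-hand side of the equation `w'' + (4 / r) w' = source r w` satisfied by
`w = φ / r`. -/
noncomputable def source (s w : ℝ) : ℝ :=
  w ^ 3 * cubicCoeff (s * w) + w ^ 5 * quinticCoeff (s * w)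

lemma contDiff_source : ContDiff ℝ ∞ fun z : ℝ × ℝ => source z.1 z.2 := by
  have h1 := contDiff_cubicCoeff
  have h2 := contDiff_quinticCoeff
  unfold source
  fun_prop

lemma pow_three_mul_source {s : ℝ} (hs : s ≠ 0) (w : ℝ) :
    s ^ 3 * source s w = sin (2 * (s * w)) - 2 * (s * w) + force (s * w) / s ^ 2 := by
  rw [sin_two_mul_sub_eq, force_eq_pow_mul, source]
  field_simp

lemma source_zero (s : ℝ) : source s 0 = 0 := by simp [source]

/-! ### The radial integral operator -/

/-- The solution operator of the singular equation `u'' + (4 / r) u' = f`, `u(0) = u'(0) = 0`. -/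
noncomputable def radialInt (f : ℝ → ℝ) (r : ℝ) : ℝ :=
  ∫ ρ in (0 : ℝ)..r, ρ * ∫ t in (0 : ℝ)..1, t ^ 4 * f (ρ * t)

section radialInt

variable {f g : ℝ → ℝ}

/-- Rescaling the inner integral to `[0, 1]` replaces the singular form `ρ⁻⁴ ∫₀^ρ s⁴ f(s) ds`, so
continuity at the origin needs no separate argument. -/
lemma continuous_radialInt_inner (hf : Continuous f) :
    Continuous fun ρ : ℝ => ρ * ∫ t in (0 : ℝ)..1, t ^ 4 * f (ρ * t) := by
  refine continuous_id.mul ?_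
  refine intervalIntegral.continuous_parametric_intervalIntegral_of_continuous' ?_ 0 1
  simp only [Function.uncurry_def]
  fun_prop

lemma hasDerivAt_radialInt (hf : Continuous f) (r : ℝ) :
    HasDerivAt (radialInt f) (r * ∫ t in (0 : ℝ)..1, t ^ 4 * f (r * t)) r :=
  (continuous_radialInt_inner hf).integral_hasStrictDerivAt 0 r |>.hasDerivAt

lemma continuous_radialInt (hf : Continuous f) : Continuous (radialInt f) :=
  continuous_iff_continuousAt.mpr fun r => (hasDerivAt_radialInt hf r).continuousAt

lemma radialInt_sub (hf : Continuous f) (hg : Continuous g) (r : ℝ) :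
    radialInt f r - radialInt g r = radialInt (fun s => f s - g s) r := by
  unfold radialInt
  rw [← intervalIntegral.integral_sub ((continuous_radialInt_inner hf).intervalIntegrable _ _)
    ((continuous_radialInt_inner hg).intervalIntegrable _ _)]
  congr 1; ext ρ
  rw [← mul_sub, ← intervalIntegral.integral_sub
    (Continuous.intervalIntegrable (by fun_prop) _ _)
    (Continuous.intervalIntegrable (by fun_prop) _ _)]
  congr 2; ext t; ring

lemma radialInt_const_mul (c : ℝ) (r : ℝ) :
    radialInt (fun s => c * f s) r = c * radialInt f r := by
  unfold radialInt
  rw [← intervalIntegral.integral_const_mul]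
  congr 1; ext ρ
  simp only [mul_left_comm _ c, intervalIntegral.integral_const_mul]

lemma radialInt_mono (hf : Continuous f) (hg : Continuous g) {r : ℝ} (hr : 0 ≤ r)
    (h : ∀ s ∈ Icc 0 r, f s ≤ g s) : radialInt f r ≤ radialInt g r := by
  refine intervalIntegral.integral_mono_on hr
    ((continuous_radialInt_inner hf).intervalIntegrable _ _)
    ((continuous_radialInt_inner hg).intervalIntegrable _ _) fun ρ hρ => ?_
  refine mul_le_mul_of_nonneg_left ?_ hρ.1
  refine intervalIntegral.integral_mono_on zero_le_one
    (Continuous.intervalIntegrable (by fun_prop) _ _)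
    (Continuous.intervalIntegrable (by fun_prop) _ _) fun t ht => ?_
  refine mul_le_mul_of_nonneg_left (h _ ⟨mul_nonneg hρ.1 ht.1, ?_⟩) (by positivity)
  exact (mul_le_of_le_one_right hρ.1 ht.2).trans hρ.2

lemma radialInt_const (c r : ℝ) : radialInt (fun _ => c) r = c * (r ^ 2 / 10) := by
  unfold radialInt
  simp only [intervalIntegral.integral_mul_const, integral_pow, integral_id]
  norm_num; ring

lemma abs_radialInt_le (hf : Continuous f) (hg : Continuous g) {r : ℝ} (hr : 0 ≤ r)
    (h : ∀ s ∈ Icc 0 r, |f s| ≤ g s) : |radialInt f r| ≤ radialInt g r := by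
  refine abs_le.mpr ⟨?_, radialInt_mono hf hg hr fun s hs => le_of_abs_le (h s hs)⟩
  have := radialInt_mono (f := fun s => (-1) * g s) (by fun_prop) hf hr
    fun s hs => by linarith [neg_le_of_abs_le (h s hs)]
  rw [radialInt_const_mul] at this
  linarith

/-- The factor `1 / K` makes the operator small in an exponentially weighted norm, for Grönwall's
inequality and for the contraction alike. -/
lemma radialInt_exp_le {K R r : ℝ} (hK : 0 < K) (hr : 0 ≤ r) (hrR : r ≤ R) :
    radialInt (fun s => exp (K * s)) r ≤ R / K * exp (K * r) := by
  have hexp : Continuous fun s : ℝ => exp (K * s) := by fun_prop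
  have h1 : radialInt (fun s => exp (K * s)) r ≤ ∫ ρ in (0 : ℝ)..r, R * exp (K * ρ) := by
    refine intervalIntegral.integral_mono_on hr
      ((continuous_radialInt_inner hexp).intervalIntegrable _ _)
      (Continuous.intervalIntegrable (by fun_prop) _ _) fun ρ hρ => ?_
    refine mul_le_mul (hρ.2.trans hrR) ?_ ?_ (hr.trans hrR)
    · have : ∫ t in (0 : ℝ)..1, t ^ 4 * exp (K * (ρ * t)) ≤ ∫ t in (0 : ℝ)..1, exp (K * ρ) := by
        refine intervalIntegral.integral_mono_on zero_le_one
          (Continuous.intervalIntegrable (by fun_prop) _ _)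
          (Continuous.intervalIntegrable (by fun_prop) _ _) fun t ht => ?_
        have e1 : t ^ 4 ≤ 1 := pow_le_one₀ ht.1 ht.2
        have e2 : exp (K * (ρ * t)) ≤ exp (K * ρ) :=
          exp_le_exp.mpr (mul_le_mul_of_nonneg_left (mul_le_of_le_one_right hρ.1 ht.2) hK.le)
        nlinarith [exp_pos (K * (ρ * t))]
      simpa using this
    · exact intervalIntegral.integral_nonneg zero_le_one fun t ht => by
        have := ht.1; positivity
  refine h1.trans ?_
  have h2 : ∀ ρ ∈ uIcc 0 r, HasDerivAt (fun ρ => R / K * exp (K * ρ)) (R * exp (K * ρ)) ρ := by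
    intro ρ _
    refine (((hasDerivAt_id ρ).const_mul K).exp.const_mul (R / K)).congr_deriv ?_
    simp only [id]; field_simp
  rw [intervalIntegral.integral_eq_sub_of_hasDerivAt h2
    (Continuous.intervalIntegrable (by fun_prop) _ _)]
  have : 0 ≤ R / K * exp (K * 0) := by
    have := hr.trans hrR; positivity
  linarith

/-- Grönwall's inequality for the radial integral. -/
lemma le_of_le_add_radialInt (hf : Continuous f) {A L R : ℝ} (hL : 0 ≤ L)
    (hR : 0 ≤ R) (hA : 0 ≤ A) (h : ∀ r ∈ Icc 0 R, f r ≤ A + L * radialInt f r) :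
    ∀ r ∈ Icc 0 R, f r ≤ 2 * A * exp ((2 * L * R + 1) * r) := by
  -- Chosen so that `L R / K ≤ 1/2`: at the maximum `μ` of the weighted function the integral then
  -- absorbs only half of `μ`, which bounds `μ` by `2A`.
  set K := 2 * L * R + 1
  have hK : 0 < K := by positivity
  obtain ⟨m, hm, hmax⟩ := isCompact_Icc.exists_isMaxOn (s := Icc 0 R)
    (f := fun r => f r * exp (-(K * r))) ⟨0, le_rfl, hR⟩ (by fun_prop)
  set μ := f m * exp (-(K * m))
  have hexp : ∀ r, exp (-(K * r)) * exp (K * r) = 1 := fun r => by rw [← exp_add]; simp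
  have hle : ∀ r ∈ Icc 0 R, f r ≤ μ * exp (K * r) := fun r hr => by
    have h1 := mul_le_mul_of_nonneg_right (hmax hr) (exp_pos (K * r)).le
    simp only [mul_assoc, hexp, mul_one] at h1
    simpa [μ, mul_assoc] using h1
  have hμ : μ ≤ 2 * A := by
    by_contra! hμ
    have hμ0 : 0 < μ := by linarith
    have h1 : radialInt f m ≤ μ * (R / K * exp (K * m)) := by
      refine (radialInt_mono hf (g := fun s => μ * exp (K * s)) (by fun_prop) hm.1
        fun s hs => hle s ⟨hs.1, hs.2.trans hm.2⟩).trans ?_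
      rw [radialInt_const_mul]
      gcongr
      exact radialInt_exp_le hK hm.1 hm.2
    have h2 : L * (R / K) ≤ 1 / 2 := by
      rw [mul_div_assoc', div_le_iff₀ hK]; simp only [K]; linarith
    have h3 : f m ≤ A + μ / 2 * exp (K * m) := by
      have e : L * (μ * (R / K * exp (K * m))) = (L * (R / K)) * (μ * exp (K * m)) := by ring
      have := mul_le_mul_of_nonneg_left h1 hL
      rw [e] at this
      have := mul_le_mul_of_nonneg_right h2 (mul_pos hμ0 (exp_pos (K * m))).le
      linarith [h m hm]
    have h4 : f m = μ * exp (K * m) := by simp only [μ, mul_assoc, hexp, mul_one]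
    have h5 : 1 ≤ exp (K * m) := one_le_exp (mul_nonneg hK.le hm.1)
    nlinarith
  intro r hr
  exact (hle r hr).trans (by gcongr)

/-- For `r > 0` the substitution `s = r t` restores the form `r⁻⁴ ∫₀^r s⁴ f(s) ds`, to which the
product rule applies. -/
lemma hasDerivAt_radialInt_deriv (hf : Continuous f) {r : ℝ} (hr : 0 < r) :
    HasDerivAt (fun r => r * ∫ t in (0 : ℝ)..1, t ^ 4 * f (r * t))
      (f r - 4 / r * (r * ∫ t in (0 : ℝ)..1, t ^ 4 * f (r * t))) r := by
  have key : ∀ ρ, 0 < ρ → ρ * ∫ t in (0 : ℝ)..1, t ^ 4 * f (ρ * t)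
      = (ρ ^ 4)⁻¹ * ∫ s in (0 : ℝ)..ρ, s ^ 4 * f s := fun ρ hρ => by
    have := intervalIntegral.mul_integral_comp_mul_left (f := fun s => s ^ 4 * f s) (a := 0)
      (b := 1) (c := ρ)
    rw [mul_zero, mul_one] at this
    rw [← this]
    simp only [mul_pow, mul_assoc, intervalIntegral.integral_const_mul]
    field_simp
  have hprim : HasDerivAt (fun ρ => ∫ s in (0 : ℝ)..ρ, s ^ 4 * f s) (r ^ 4 * f r) r :=
    ((by fun_prop : Continuous fun s => s ^ 4 * f s).integral_hasStrictDerivAt 0 r).hasDerivAt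
  have hinv : HasDerivAt (fun ρ : ℝ => (ρ ^ 4)⁻¹) (-(4 * r ^ 3) / (r ^ 4) ^ 2) r := by
    simpa using (hasDerivAt_pow 4 r).fun_inv (by positivity)
  have hmul := hinv.mul hprim
  refine (hmul.congr_of_eventuallyEq ?_).congr_deriv ?_
  · filter_upwards [lt_mem_nhds hr] with ρ hρ using key ρ hρ
  · rw [key r hr]; field_simp; ring

end radialInt

/-! ### The singular initial value problem -/

/-- `w` solves `w'' + (4 / r) w' = H r w`, `w(0) = β`, `w'(0) = 0` on `[0, R]`, in integrated
form. -/
structure IsRadialSolution (H : ℝ → ℝ → ℝ) (β R : ℝ) (w : ℝ → ℝ) : Prop where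
  continuous : Continuous w
  eq : ∀ r ∈ Icc 0 R, w r = β + radialInt (fun s => H s (w s)) r

namespace IsRadialSolution

variable {H : ℝ → ℝ → ℝ} {β β' R L : ℝ} {w w' : ℝ → ℝ}

lemma mono (h : IsRadialSolution H β R w) {R' : ℝ} (hR : R' ≤ R) : IsRadialSolution H β R' w :=
  ⟨h.continuous, fun r hr => h.eq r ⟨hr.1, hr.2.trans hR⟩⟩

lemma continuous_source (hH : Continuous fun z : ℝ × ℝ => H z.1 z.2) (hw : Continuous w) :
    Continuous fun s => H s (w s) :=
  hH.comp (continuous_id.prodMk hw)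

/-- Continuous dependence on the initial value. -/
lemma abs_sub_le (hH : Continuous fun z : ℝ × ℝ => H z.1 z.2) (hL : 0 ≤ L) (hR : 0 ≤ R)
    (h : IsRadialSolution H β R w) (h' : IsRadialSolution H β' R w')
    (hlip : ∀ s ∈ Icc 0 R, |H s (w s) - H s (w' s)| ≤ L * |w s - w' s|) :
    ∀ r ∈ Icc 0 R, |w r - w' r| ≤ 2 * |β - β'| * exp ((2 * L * R + 1) * r) := by
  have c := continuous_source hH h.continuous
  have c' := continuous_source hH h'.continuous
  have cd : Continuous fun s => |w s - w' s| := (h.continuous.sub h'.continuous).abs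
  refine le_of_le_add_radialInt cd hL hR (abs_nonneg _) fun r hr => ?_
  rw [h.eq r hr, h'.eq r hr, add_sub_add_comm, radialInt_sub c c']
  refine (abs_add_le _ _).trans ?_
  gcongr
  rw [← radialInt_const_mul]
  exact abs_radialInt_le (c.sub c') (by fun_prop) hr.1
    fun s hs => hlip s ⟨hs.1, hs.2.trans hr.2⟩

lemma eqOn (hH : Continuous fun z : ℝ × ℝ => H z.1 z.2) (hL : 0 ≤ L) (hR : 0 ≤ R)
    (h : IsRadialSolution H β R w) (h' : IsRadialSolution H β R w')
    (hlip : ∀ s ∈ Icc 0 R, |H s (w s) - H s (w' s)| ≤ L * |w s - w' s|) :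
    EqOn w w' (Icc 0 R) := fun r hr => by
  have := abs_sub_le hH hL hR h h' hlip r hr
  simpa [sub_eq_zero] using this

/-- Global solvability for a globally Lipschitz right-hand side. -/
lemma exists_of_lipschitz (hH : Continuous fun z : ℝ × ℝ => H z.1 z.2) (hL : 0 ≤ L) (hR : 0 ≤ R)
    (hlip : ∀ s ∈ Icc 0 R, ∀ x y, |H s x - H s y| ≤ L * |x - y|) (β : ℝ) :
    ∃ w, IsRadialSolution H β R w := by
  set K := 2 * L * R + 1
  have hK : 0 < K := by positivity
  have hLK : L * (R / K) ≤ 1 / 2 := by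
    rw [mul_div_assoc', div_le_iff₀ hK]; simp only [K]; linarith
  -- The unknown is `g = exp (-K s) w`, so the plain sup distance on `g` is the weighted distance on
  -- `w` in which the map contracts by `1/2`. Projection onto `[0, R]` extends `g` to the line.
  obtain ⟨ext, hext_eq⟩ : ∃ ext : C(Icc (0 : ℝ) R, ℝ) → ℝ → ℝ,
      ∀ g s, ext g s = exp (K * s) * g (projIcc 0 R hR s) := ⟨_, fun _ _ => rfl⟩
  have hext : ∀ g, Continuous (ext g) := fun g => by
    rw [funext (hext_eq g)]
    exact (by fun_prop : Continuous fun s : ℝ => exp (K * s)).mul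
      (g.continuous.comp continuous_projIcc)
  have hsrc : ∀ g, Continuous fun s => H s (ext g s) := fun g => continuous_source hH (hext g)
  obtain ⟨T, hT_eq⟩ : ∃ T : C(Icc (0 : ℝ) R, ℝ) → C(Icc (0 : ℝ) R, ℝ), ∀ g r,
      T g r = exp (-(K * r)) * (β + radialInt (fun s => H s (ext g s)) r) :=
    ⟨fun g => ⟨fun r => exp (-(K * r)) * (β + radialInt (fun s => H s (ext g s)) r), by
      have := continuous_radialInt (hsrc g)
      fun_prop⟩, fun _ _ => rfl⟩
  have hT : ContractingWith (1 / 2) T := by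
    refine ⟨by rw [← NNReal.coe_lt_coe]; norm_num, LipschitzWith.of_dist_le_mul fun g g' => ?_⟩
    refine (ContinuousMap.dist_le (by positivity)).mpr fun r => ?_
    have h1 : |radialInt (fun s => H s (ext g s)) r - radialInt (fun s => H s (ext g' s)) r|
        ≤ 1 / 2 * dist g g' * exp (K * r) := by
      rw [radialInt_sub (hsrc g) (hsrc g')]
      have hcont : Continuous fun s : ℝ => (L * dist g g') * exp (K * s) := by fun_prop
      refine (abs_radialInt_le ((hsrc g).sub (hsrc g')) hcont r.2.1 fun s hs => ?_).trans ?_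
      · have hs' : s ∈ Icc 0 R := ⟨hs.1, hs.2.trans r.2.2⟩
        refine (hlip s hs' _ _).trans ?_
        have e : |ext g s - ext g' s| ≤ exp (K * s) * dist g g' := by
          rw [hext_eq, hext_eq, ← mul_sub, abs_mul, abs_of_pos (exp_pos _), ← Real.dist_eq]
          gcongr
          exact ContinuousMap.dist_apply_le_dist _
        calc L * |ext g s - ext g' s| ≤ L * (exp (K * s) * dist g g') := by gcongr
          _ = _ := by ring
      · rw [radialInt_const_mul]
        have := radialInt_exp_le hK r.2.1 r.2.2
        calc L * dist g g' * radialInt (fun s => exp (K * s)) r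
            ≤ L * dist g g' * (R / K * exp (K * r)) := by gcongr
          _ = (L * (R / K)) * (dist g g' * exp (K * r)) := by ring
          _ ≤ 1 / 2 * (dist g g' * exp (K * r)) := by gcongr
          _ = _ := by ring
    have h2 : dist (T g r) (T g' r) = exp (-(K * r)) *
        |radialInt (fun s => H s (ext g s)) r - radialInt (fun s => H s (ext g' s)) r| := by
      rw [hT_eq, hT_eq, Real.dist_eq, ← mul_sub, abs_mul, abs_of_pos (exp_pos _),
        add_sub_add_left_eq_sub]
    rw [h2]
    refine (mul_le_mul_of_nonneg_left h1 (exp_pos _).le).trans_eq ?_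
    rw [mul_left_comm, ← exp_add]; simp
  have : Nonempty (C(Icc (0 : ℝ) R, ℝ)) := ⟨0⟩
  obtain ⟨g, hg⟩ : ∃ g, T g = g := ⟨_, ContractingWith.fixedPoint_isFixedPt hT⟩
  refine ⟨ext g, hext _, fun r hr => ?_⟩
  rw [hext_eq, ← hg, hT_eq, projIcc_of_mem hR hr, hg, ← mul_assoc, ← exp_add]
  simp

end IsRadialSolution

/-- Truncation of a real number to `[-V, V]`. -/
noncomputable def clip (V x : ℝ) : ℝ := max (-V) (min x V)

lemma continuous_clip (V : ℝ) : Continuous (clip V) := by unfold clip; fun_prop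

lemma abs_clip_le {V : ℝ} (hV : 0 ≤ V) (x : ℝ) : |clip V x| ≤ V :=
  abs_le.mpr ⟨le_max_left _ _, max_le (by linarith) (min_le_right _ _)⟩

lemma clip_of_abs_le {V x : ℝ} (h : |x| ≤ V) : clip V x = x := by
  rw [clip, min_eq_left (le_of_abs_le h), max_eq_right (neg_le_of_abs_le h)]

lemma abs_clip_sub_le (V x y : ℝ) : |clip V x - clip V y| ≤ |x - y| := by
  have h1 := abs_max_sub_max_le_abs (min x V) (min y V) (-V)
  have h2 := abs_min_sub_min_le_max x V y V
  simp only [sub_self, abs_zero] at h2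
  rw [max_eq_left (abs_nonneg _)] at h2
  unfold clip
  rw [max_comm (-V), max_comm (-V)]
  exact h1.trans h2

lemma abs_clip_le_abs {V : ℝ} (hV : 0 ≤ V) (x : ℝ) : |clip V x| ≤ |x| := by
  have := abs_clip_sub_le V x 0
  have h0 : clip V 0 = 0 := clip_of_abs_le (by simpa using hV)
  rwa [h0, sub_zero, sub_zero] at this

lemma continuous_source' : Continuous fun z : ℝ × ℝ => source z.1 z.2 :=
  contDiff_source.continuous

lemma continuous_source_clip (V : ℝ) : Continuous fun z : ℝ × ℝ => source z.1 (clip V z.2) :=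
  continuous_source'.comp (continuous_fst.prodMk ((continuous_clip V).comp continuous_snd))

lemma exists_lipschitz_source (R V : ℝ) : ∃ L, 0 ≤ L ∧ ∀ s ∈ Icc 0 R, ∀ x y,
    |x| ≤ V → |y| ≤ V → |source s x - source s y| ≤ L * |x - y| := by
  obtain ⟨K, hK⟩ := (contDiff_source.contDiffOn (s := Icc 0 R ×ˢ Icc (-V) V)).exists_lipschitzOnWith
    (by simp) ((convex_Icc _ _).prod (convex_Icc _ _)) (isCompact_Icc.prod isCompact_Icc)
  refine ⟨K, K.2, fun s hs x y hx hy => ?_⟩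
  have := hK.dist_le_mul (s, x) ⟨hs, abs_le.mp hx⟩ (s, y) ⟨hs, abs_le.mp hy⟩
  simpa [Prod.dist_eq, Real.dist_eq] using this

lemma abs_force_le (y : ℝ) : |force y| ≤ 2 * (|y| + 1) := by
  have h1 : |charge y| ≤ |y| + 1 := by
    refine (abs_sub _ _).trans ?_
    gcongr
    rw [abs_mul]
    exact mul_le_one₀ (abs_sin_le_one _) (abs_nonneg _) (abs_cos_le_one _)
  rw [force_eq, abs_mul, abs_of_nonneg (by positivity : 0 ≤ 2 * sin y ^ 2)]
  have := sin_sq_le_one y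
  nlinarith [abs_nonneg (charge y), sq_nonneg (sin y)]

/-- Away from the singular point the source grows at most linearly. -/
lemma abs_source_le {δ R : ℝ} (hδ : 0 < δ) :
    ∃ C, 0 ≤ C ∧ ∀ s ∈ Icc δ R, ∀ x, |source s x| ≤ C * (1 + |x|) := by
  refine ⟨((1 + 2 * |R|) + 2 * (1 + |R|) / δ ^ 2) / δ ^ 3, by positivity, fun s hs x => ?_⟩
  have hs0 : 0 < s := hδ.trans_le hs.1
  have h := pow_three_mul_source hs0.ne' x
  have hsx : |s * x| ≤ |R| * |x| := by
    rw [abs_mul, abs_of_pos hs0]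
    gcongr
    exact hs.2.trans (le_abs_self R)
  have e1 : |sin (2 * (s * x)) - 2 * (s * x)| ≤ (1 + 2 * |R|) * (1 + |x|) := by
    refine (abs_sub _ _).trans ?_
    have := abs_sin_le_one (2 * (s * x))
    rw [abs_mul 2, abs_two]
    nlinarith [abs_nonneg R, abs_nonneg x]
  have e2 : |force (s * x) / s ^ 2| ≤ 2 * (1 + |R|) / δ ^ 2 * (1 + |x|) := by
    rw [abs_div, abs_of_pos (pow_pos hs0 2), div_mul_eq_mul_div]
    have := abs_force_le (s * x)
    refine div_le_div₀ (by positivity) ?_ (by positivity) (by gcongr; exact hs.1)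
    nlinarith [abs_nonneg R, abs_nonneg x]
  have e3 : s ^ 3 * |source s x|
      ≤ ((1 + 2 * |R|) + 2 * (1 + |R|) / δ ^ 2) * (1 + |x|) := by
    rw [← abs_of_pos (pow_pos hs0 3), ← abs_mul, h, add_mul]
    exact (abs_add_le _ _).trans (add_le_add e1 e2)
  rw [div_mul_eq_mul_div, le_div_iff₀ (by positivity), mul_comm]
  refine le_trans ?_ e3
  gcongr
  exact hs.1

/-- The singular initial value problem is solvable on every interval, with a bound that is
uniform for bounded initial values. -/
lemma exists_isRadialSolution_bounded (B R : ℝ) (hB : 0 ≤ B) (hR : 1 ≤ R) :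
    ∃ V, 0 ≤ V ∧ ∀ β, |β| ≤ B → ∃ w, IsRadialSolution source β R w ∧ ∀ r ∈ Icc 0 R, |w r| ≤ V := by
  obtain ⟨M, hM⟩ := (isCompact_Icc.prod isCompact_Icc).exists_bound_of_continuousOn
    (s := Icc (0 : ℝ) 1 ×ˢ Icc (-(B + 1)) (B + 1)) continuous_source'.continuousOn
  have hM0 : 0 ≤ M := (norm_nonneg _).trans
    (hM (0, 0) ⟨⟨le_rfl, zero_le_one⟩, by simp; linarith, by simp; linarith⟩)
  -- On `[0, δ]` the source is at most `M` as long as `|w| ≤ B + 1`, so `w` moves by at most `M δ² /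
  -- 10 ≤ 1` and stays in that range. Beyond `δ` the source grows at most linearly, and Grönwall's
  -- inequality gives `V`.
  set δ := 1 / (M + 1)
  have hδ0 : 0 < δ := by positivity
  have hδ1 : δ ≤ 1 := by
    rw [div_le_one (by positivity)]; linarith
  have hδM : M * δ ≤ 1 := by
    rw [mul_one_div, div_le_one (by positivity)]; linarith
  obtain ⟨C, hC0, hC⟩ := abs_source_le (R := R) hδ0
  set K := 2 * (M + C) * R + 1
  set V := 2 * (1 + B) * exp (K * R)
  have hBV : B + 1 ≤ V := by
    have : 1 ≤ exp (K * R) := one_le_exp (by positivity)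
    simp only [V]; nlinarith
  have hV0 : 0 ≤ V := by positivity
  refine ⟨V, hV0, fun β hβ => ?_⟩
  obtain ⟨L₁, hL₁, hlip₁⟩ := exists_lipschitz_source R V
  have hlipV : ∀ s ∈ Icc 0 R, ∀ x y,
      |source s (clip V x) - source s (clip V y)| ≤ L₁ * |x - y| := fun s hs x y =>
    (hlip₁ s hs _ _ (abs_clip_le hV0 _) (abs_clip_le hV0 _)).trans
      (mul_le_mul_of_nonneg_left (abs_clip_sub_le V x y) hL₁)
  have hlipB : ∀ s ∈ Icc 0 δ, ∀ x y,
      |source s (clip (B + 1) x) - source s (clip (B + 1) y)| ≤ L₁ * |x - y| := fun s hs x y =>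
    (hlip₁ s ⟨hs.1, hs.2.trans (hδ1.trans hR)⟩ _ _ ((abs_clip_le (by linarith) _).trans hBV)
      ((abs_clip_le (by linarith) _).trans hBV)).trans
      (mul_le_mul_of_nonneg_left (abs_clip_sub_le (B + 1) x y) hL₁)
  obtain ⟨w, hw⟩ := IsRadialSolution.exists_of_lipschitz (continuous_source_clip V) hL₁
    (by linarith) hlipV β
  -- The tighter truncation is used near the origin only. Its solution never reaches the truncation
  -- level, so it also solves the problem truncated at `V` and agrees with `w` on `[0, δ]`.
  obtain ⟨u, hu⟩ := IsRadialSolution.exists_of_lipschitz (continuous_source_clip (B + 1)) hL₁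
    hδ0.le hlipB β
  have hMclip : ∀ s ∈ Icc 0 δ, ∀ x, |source s (clip (B + 1) x)| ≤ M := fun s hs x =>
    hM (s, clip (B + 1) x) ⟨⟨hs.1, hs.2.trans hδ1⟩, abs_le.mp (abs_clip_le (by linarith) _)⟩
  have hub : ∀ r ∈ Icc 0 δ, |u r| ≤ B + 1 := fun r hr => by
    have h1 : |radialInt (fun s => source s (clip (B + 1) (u s))) r| ≤ M * (r ^ 2 / 10) := by
      rw [← radialInt_const]
      exact abs_radialInt_le
        (IsRadialSolution.continuous_source
      (H := fun s x => source s (clip (B + 1) x)) (continuous_source_clip (B + 1)) hu.continuous)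
        continuous_const hr.1 fun s hs => hMclip s ⟨hs.1, hs.2.trans hr.2⟩ _
    have h2 : M * (r ^ 2 / 10) ≤ 1 := by
      have : r ^ 2 ≤ δ := by nlinarith [hr.1, hr.2]
      nlinarith
    rw [hu.eq r hr]
    exact (abs_add_le _ _).trans (by linarith)
  have huV : IsRadialSolution (fun s x => source s (clip V x)) β δ u := by
    refine ⟨hu.continuous, fun r hr => ?_⟩
    rw [hu.eq r hr]
    congr 1
    have e : ∀ s ∈ Icc 0 r,
        source s (clip (B + 1) (u s)) = source s (clip V (u s)) := fun s hs => by
      have := hub s ⟨hs.1, hs.2.trans hr.2⟩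
      rw [clip_of_abs_le this, clip_of_abs_le (this.trans hBV)]
    have c1 := IsRadialSolution.continuous_source
      (H := fun s x => source s (clip (B + 1) x)) (continuous_source_clip (B + 1)) hu.continuous
    have c2 := IsRadialSolution.continuous_source
      (H := fun s x => source s (clip V x)) (continuous_source_clip V) hu.continuous
    exact le_antisymm (radialInt_mono c1 c2 hr.1 fun s hs => (e s hs).le)
      (radialInt_mono c2 c1 hr.1 fun s hs => (e s hs).ge)
  have hwu : EqOn w u (Icc 0 δ) := IsRadialSolution.eqOn (continuous_source_clip V) hL₁ hδ0.le
    (hw.mono (hδ1.trans hR)) huV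
    fun s hs => hlipV s ⟨hs.1, hs.2.trans (hδ1.trans hR)⟩ _ _
  have hgrowth : ∀ s ∈ Icc 0 R, |source s (clip V (w s))| ≤ (M + C) * (1 + |w s|) := by
    intro s hs
    rcases le_total s δ with h | h
    · have hb : |w s| ≤ B + 1 := by rw [hwu ⟨hs.1, h⟩]; exact hub s ⟨hs.1, h⟩
      have := hMclip s ⟨hs.1, h⟩ (w s)
      rw [clip_of_abs_le hb] at this
      rw [clip_of_abs_le (hb.trans hBV)]
      nlinarith [abs_nonneg (w s), mul_nonneg hM0 (abs_nonneg (w s)),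
        mul_nonneg hC0 (abs_nonneg (w s))]
    · have h1 := hC s ⟨h, hs.2⟩ (clip V (w s))
      have h2 := abs_clip_le_abs hV0 (w s)
      nlinarith [mul_le_mul_of_nonneg_left h2 hC0, mul_nonneg hM0 (abs_nonneg (w s))]
  have hwc := hw.continuous
  have hbound := le_of_le_add_radialInt (f := fun r => 1 + |w r|) (by fun_prop) (A := 1 + |β|)
    (L := M + C) (R := R) (by positivity) (by linarith) (by positivity) fun r hr => by
      rw [hw.eq r hr, add_assoc, ← radialInt_const_mul]
      gcongr
      refine (abs_add_le _ _).trans ?_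
      gcongr
      exact abs_radialInt_le
        (IsRadialSolution.continuous_source
      (H := fun s x => source s (clip V x)) (continuous_source_clip V) hwc) (by fun_prop) hr.1
        fun s hs => hgrowth s ⟨hs.1, hs.2.trans hr.2⟩
  have hwV : ∀ r ∈ Icc 0 R, |w r| ≤ V := fun r hr => by
    have h1 := hbound r hr
    have h2 : 2 * (1 + |β|) * exp (K * r) ≤ V := by
      simp only [V]
      gcongr
      exact hr.2
    linarith
  refine ⟨w, ⟨hwc, fun r hr => ?_⟩, hwV⟩
  rw [hw.eq r hr]
  congr 1
  have e : ∀ s ∈ Icc 0 r, source s (clip V (w s)) = source s (w s) := fun s hs => by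
    rw [clip_of_abs_le (hwV s ⟨hs.1, hs.2.trans hr.2⟩)]
  have c1 := IsRadialSolution.continuous_source
      (H := fun s x => source s (clip V x)) (continuous_source_clip V) hwc
  have c2 := IsRadialSolution.continuous_source continuous_source' hwc
  exact le_antisymm (radialInt_mono c1 c2 hr.1 fun s hs => (e s hs).le)
    (radialInt_mono c2 c1 hr.1 fun s hs => (e s hs).ge)

lemma eqOn_of_isRadialSolution {β R : ℝ} {w w' : ℝ → ℝ} (hR : 0 ≤ R)
    (h : IsRadialSolution source β R w) (h' : IsRadialSolution source β R w') :
    EqOn w w' (Icc 0 R) := by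
  obtain ⟨V₁, hV₁⟩ := isCompact_Icc.exists_bound_of_continuousOn (s := Icc 0 R)
    h.continuous.continuousOn
  obtain ⟨V₂, hV₂⟩ := isCompact_Icc.exists_bound_of_continuousOn (s := Icc 0 R)
    h'.continuous.continuousOn
  obtain ⟨L, hL, hlip⟩ := exists_lipschitz_source R (max V₁ V₂)
  exact IsRadialSolution.eqOn continuous_source' hL hR h h' fun s hs =>
    hlip s hs _ _ ((hV₁ s hs).trans (le_max_left _ _)) ((hV₂ s hs).trans (le_max_right _ _))

/-- The global solutions of the singular initial value problem. -/
lemma exists_forall_isRadialSolution (β : ℝ) : ∃ w, ∀ R, IsRadialSolution source β R w := by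
  have hex : ∀ m : ℕ, ∃ w, IsRadialSolution source β (m + 1) w := fun m => by
    obtain ⟨V, -, hV⟩ := exists_isRadialSolution_bounded |β| (m + 1) (abs_nonneg _) (by simp)
    obtain ⟨w, hw, -⟩ := hV β le_rfl
    exact ⟨w, hw⟩
  choose w hw using hex
  have hagree : ∀ m k : ℕ, ∀ r : ℝ, 0 ≤ r → r ≤ m + 1 → r ≤ k + 1 → w m r = w k r := by
    intro m k r h0 hm hk
    have hmin : r ≤ min (m + 1 : ℝ) (k + 1) := le_min hm hk
    exact eqOn_of_isRadialSolution (h0.trans hmin) ((hw m).mono (min_le_left _ _))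
      ((hw k).mono (min_le_right _ _)) ⟨h0, hmin⟩
  -- The index `m = ⌊|r|⌋` leaves room: `w m` is a solution up to `m + 1 > |r|`, so the same index
  -- serves for a neighbourhood of `r`, which gives continuity.
  set W : ℝ → ℝ := fun r => w ⌊|r|⌋₊ |r|
  have hW : ∀ m : ℕ, ∀ r : ℝ, |r| ≤ m + 1 → W r = w m |r| := fun m r hr =>
    hagree _ _ _ (abs_nonneg r) (Nat.lt_floor_add_one _).le hr
  have hWc : Continuous W := by
    refine continuous_iff_continuousAt.mpr fun r => ?_
    have hc : Continuous fun s : ℝ => w ⌊|r|⌋₊ |s| := (hw _).continuous.comp continuous_abs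
    refine hc.continuousAt.congr ?_
    have : ∀ᶠ s : ℝ in 𝓝 r, |s| < ⌊|r|⌋₊ + 1 :=
      continuous_abs.continuousAt.eventually_lt continuousAt_const (Nat.lt_floor_add_one _)
    filter_upwards [this] with s hs using (hW _ s hs.le).symm
  refine ⟨W, fun R => ⟨hWc, fun r hr => ?_⟩⟩
  set m := ⌊|r|⌋₊
  have hrm : |r| ≤ m + 1 := (Nat.lt_floor_add_one _).le
  rw [abs_of_nonneg hr.1] at hrm
  have e1 : W r = w m r := by
    rw [hW m r (by rwa [abs_of_nonneg hr.1]), abs_of_nonneg hr.1]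
  rw [e1, (hw m).eq r ⟨hr.1, hrm⟩]
  congr 1
  have e : ∀ s ∈ Icc 0 r, source s (w m s) = source s (W s) := fun s hs => by
    rw [hW m s (by rw [abs_of_nonneg hs.1]; exact hs.2.trans hrm), abs_of_nonneg hs.1]
  have c1 := IsRadialSolution.continuous_source continuous_source' (hw m).continuous
  have c2 := IsRadialSolution.continuous_source continuous_source' hWc
  exact le_antisymm (radialInt_mono c1 c2 hr.1 fun s hs => (e s hs).le)
    (radialInt_mono c2 c1 hr.1 fun s hs => (e s hs).ge)

/-- The solution `w` of `w'' + (4 / r) w' = source r w` with `w(0) = β`. -/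
noncomputable def reducedProfile (β : ℝ) : ℝ → ℝ := (exists_forall_isRadialSolution β).choose

lemma isRadialSolution_reducedProfile (β R : ℝ) :
    IsRadialSolution source β R (reducedProfile β) :=
  (exists_forall_isRadialSolution β).choose_spec R

lemma continuous_reducedProfile (β : ℝ) : Continuous (reducedProfile β) :=
  (isRadialSolution_reducedProfile β 0).continuous

lemma reducedProfile_zero {r : ℝ} (hr : 0 ≤ r) : reducedProfile 0 r = 0 := by
  have h0 : IsRadialSolution source 0 r (fun _ => 0) :=
    ⟨continuous_const, fun s _ => by simp [source_zero, radialInt_const]⟩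
  exact eqOn_of_isRadialSolution hr (isRadialSolution_reducedProfile 0 r) h0 ⟨hr, le_rfl⟩

/-- The solutions depend continuously on `β`, uniformly on compact intervals. -/
lemma exists_abs_reducedProfile_sub_le (β₀ R : ℝ) (hR : 1 ≤ R) : ∃ C, 0 ≤ C ∧
    ∀ β, |β - β₀| ≤ 1 → ∀ r ∈ Icc 0 R,
      |reducedProfile β r - reducedProfile β₀ r| ≤ C * |β - β₀| := by
  have hR0 : 0 ≤ R := by linarith
  obtain ⟨V, hV, h⟩ := exists_isRadialSolution_bounded (|β₀| + 1) R (by positivity) hR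
  have hbound : ∀ β, |β| ≤ |β₀| + 1 → ∀ r ∈ Icc 0 R, |reducedProfile β r| ≤ V := by
    intro β hβ r hr
    obtain ⟨w, hw, hw'⟩ := h β hβ
    rw [eqOn_of_isRadialSolution hR0 (isRadialSolution_reducedProfile β R) hw hr]
    exact hw' r hr
  obtain ⟨L, hL, hlip⟩ := exists_lipschitz_source R V
  refine ⟨2 * exp ((2 * L * R + 1) * R), by positivity, fun β hβ r hr => ?_⟩
  have hβ' : |β| ≤ |β₀| + 1 := by
    have := abs_add_le (β - β₀) β₀
    rw [sub_add_cancel] at this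
    linarith
  have := IsRadialSolution.abs_sub_le continuous_source' hL hR0
    (isRadialSolution_reducedProfile β R) (isRadialSolution_reducedProfile β₀ R)
    (fun s hs => hlip s hs _ _ (hbound β hβ' s hs) (hbound β₀ (by linarith) s hs)) r hr
  refine this.trans ?_
  rw [mul_right_comm]
  gcongr
  exact hr.2

/-- The derivative of `reducedProfile β`. -/
noncomputable def reducedSlope (β r : ℝ) : ℝ :=
  r * ∫ t in (0 : ℝ)..1, t ^ 4 * source (r * t) (reducedProfile β (r * t))

lemma continuous_source_reducedProfile (β : ℝ) :
    Continuous fun s => source s (reducedProfile β s) :=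
  continuous_source'.comp (continuous_id.prodMk (continuous_reducedProfile β))

lemma reducedProfile_eq (β : ℝ) {r : ℝ} (hr : 0 ≤ r) :
    reducedProfile β r = β + radialInt (fun s => source s (reducedProfile β s)) r :=
  (isRadialSolution_reducedProfile β r).eq r ⟨hr, le_rfl⟩

lemma hasDerivAt_reducedProfile (β : ℝ) {r : ℝ} (hr : 0 < r) :
    HasDerivAt (reducedProfile β) (reducedSlope β r) r := by
  refine ((hasDerivAt_radialInt (continuous_source_reducedProfile β) r).const_add
    β).congr_of_eventuallyEq ?_
  filter_upwards [lt_mem_nhds hr] with s hs using reducedProfile_eq β (le_of_lt hs)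

lemma hasDerivAt_reducedSlope (β : ℝ) {r : ℝ} (hr : 0 < r) :
    HasDerivAt (reducedSlope β)
      (source r (reducedProfile β r) - 4 / r * reducedSlope β r) r :=
  hasDerivAt_radialInt_deriv (continuous_source_reducedProfile β) hr

/-! ### Shots as trajectories -/

/-- The solution with slope `β` at the origin, in the logarithmic variable. -/
noncomputable def shot (β x : ℝ) : ℝ := exp x * reducedProfile β (exp x)

/-- The derivative of `shot β`. -/
noncomputable def shotVelocity (β x : ℝ) : ℝ :=
  exp x * reducedProfile β (exp x) + exp x ^ 2 * reducedSlope β (exp x)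

lemma trajectory_shot (β : ℝ) : Trajectory (shot β) (shotVelocity β) where
  hasDerivAt x := by
    have h := (hasDerivAt_reducedProfile β (exp_pos x)).comp x (Real.hasDerivAt_exp x)
    refine ((Real.hasDerivAt_exp x).mul h).congr_deriv ?_
    simp only [shotVelocity, Function.comp]; ring
  hasDerivAt_velocity x := by
    have e := Real.hasDerivAt_exp x
    have h := (hasDerivAt_reducedProfile β (exp_pos x)).comp x e
    have h' := (hasDerivAt_reducedSlope β (exp_pos x)).comp x e
    refine ((e.mul h).add ((e.pow 2).mul h')).congr_deriv ?_
    have hs := pow_three_mul_source (exp_pos x).ne' (reducedProfile β (exp x))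
    have hx : exp (-2 * x) = 1 / exp x ^ 2 := by
      rw [← exp_nat_mul, one_div, ← exp_neg]; congr 1; push_cast; ring
    simp only [shotVelocity, shot, Function.comp, hx, Pi.pow_apply]
    have hx0 := (exp_pos x).ne'
    have e1 : exp x ^ 2 * (4 / exp x * reducedSlope β (exp x) * exp x)
        = 4 * exp x ^ 2 * reducedSlope β (exp x) := by field_simp
    push_cast
    linear_combination hs - e1
  tendsto_atBot := by
    have h1 : Tendsto (fun x => reducedProfile β (exp x)) atBot (𝓝 (reducedProfile β 0)) :=
      ((continuous_reducedProfile β).tendsto 0).comp tendsto_exp_atBot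
    have h2 := tendsto_exp_atBot.mul h1
    rw [zero_mul] at h2
    exact h2

lemma reducedProfile_apply_zero (β : ℝ) : reducedProfile β 0 = β := by
  simp [reducedProfile_eq β le_rfl, radialInt]

lemma shot_zero (x : ℝ) : shot 0 x = 0 := by
  simp [shot, reducedProfile_zero (exp_pos x).le]

lemma shot_pos {β : ℝ} (hβ : 0 < β) (x : ℝ) : 0 < shot β x := by
  by_contra! hx
  have h1 : Tendsto (fun x => reducedProfile β (exp x)) atBot (𝓝 β) := by
    have := ((continuous_reducedProfile β).tendsto 0).comp tendsto_exp_atBot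
    rwa [reducedProfile_apply_zero] at this
  obtain ⟨y, hy, hyx⟩ := ((h1.eventually (lt_mem_nhds hβ)).and (eventually_le_atBot x)).exists
  have hy' : 0 < shot β y := mul_pos (exp_pos y) hy
  obtain ⟨z, -, hz⟩ := intermediate_value_Icc' hyx (trajectory_shot β).continuous.continuousOn
    ⟨hx, hy'.le⟩
  have := (trajectory_shot β).eq_zero_of_eq_zero hz y
  linarith

lemma shot_nonneg {β : ℝ} (hβ : 0 ≤ β) (x : ℝ) : 0 ≤ shot β x := by
  rcases hβ.eq_or_lt with rfl | h
  · rw [shot_zero]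
  · exact (shot_pos h x).le

/-! ### Trapping, overshooting and the critical slope -/

/-- For large `x` the friction is too strong for a trajectory to climb over the next well. -/
lemma exists_trapping (n : ℕ) {η : ℝ} (hη : 0 < η) : ∃ X : ℝ, ∀ ψ p : ℝ → ℝ, Trajectory ψ p →
    (∀ x, 0 ≤ ψ x) → ∀ x, X ≤ x → ψ x ≤ n * π - η → ∀ y, x ≤ y → ψ y < n * π := by
  have hnπ := nat_mul_pi_nonneg n
  have hgap : 0 < n * π - charge (n * π - η) := by
    have := charge_strictMono (sub_lt_self (n * π) hη)
    rw [charge_nat_mul_pi] at this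
    linarith
  set gap := n * π - charge (n * π - η)
  set C := 2 + n * π
  have hC : 0 < C := by positivity
  have hlim : Tendsto (fun X : ℝ => exp (2 * X) / C * gap) atTop atTop :=
    ((tendsto_exp_atTop.comp (tendsto_id.const_mul_atTop two_pos)).atTop_div_const
      hC).atTop_mul_const hgap
  obtain ⟨X, hX, hX0⟩ := ((hlim.eventually_gt_atTop ((n * π) ^ 2 / 2)).and
    (eventually_ge_atTop 0)).exists
  refine ⟨X, fun ψ p h hnn x hx hle y hxy => ?_⟩
  by_contra! hy
  have hψc := h.continuous
  obtain ⟨z₀, hz₀, hz₀'⟩ := intermediate_value_Icc hxy hψc.continuousOn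
    (show (n * π : ℝ) ∈ Icc (ψ x) (ψ y) from ⟨by linarith, hy⟩)
  -- The first arrival at `nπ`, so that `ψ ≤ nπ` on `[x, z]` and the velocity bound below is
  -- available.
  obtain ⟨z, ⟨hz, hzn⟩, hzmin⟩ := (isCompact_Icc.inter_right
    (isClosed_eq hψc continuous_const)).exists_isLeast (s := Icc x y ∩ {z | ψ z = n * π})
    ⟨z₀, hz₀, hz₀'⟩
  have hzn : ψ z = n * π := hzn
  have hbelow : ∀ u ∈ Icc x z, ψ u ≤ n * π := by
    intro u hu
    by_contra! hlt
    obtain ⟨v, hv, hv'⟩ := intermediate_value_Icc hu.1 hψc.continuousOn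
      (show (n * π : ℝ) ∈ Icc (ψ x) (ψ u) from ⟨by linarith, hlt.le⟩)
    have : z ≤ v := hzmin ⟨⟨hv.1, hv.2.trans (hu.2.trans hz.2)⟩, hv'⟩
    have : u = z := le_antisymm hu.2 (this.trans hv.2)
    rw [this] at hlt
    linarith
  set E := exp (2 * X) / C
  have hE : 0 < E := by positivity
  have hd : ∀ u, HasDerivAt (fun u => lyapunov ψ p u + E * charge (ψ u))
      (-(2 * exp (2 * u) * sin (ψ u) ^ 2) + E * (2 * sin (ψ u) ^ 2 * p u)) u := fun u =>
    (h.hasDerivAt_lyapunov u).add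
      (((hasDerivAt_charge (ψ u)).comp u (h.hasDerivAt u)).const_mul E)
  -- The derivative is `2 sin² ψ (E p - exp (2u))`. From `lyapunov ≤ 0` one gets `p² ≤ 2 + (nπ)² ≤
  -- C²`, and `E = exp (2X) / C` makes this nonpositive. Comparing the endpoints gives `E * gap ≤
  -- (nπ)² / 2`, contrary to the choice of `X`.
  have hanti : AntitoneOn (fun u => lyapunov ψ p u + E * charge (ψ u)) (Icc x z) := by
    refine antitoneOn_of_deriv_nonpos (convex_Icc x z)
      (fun u _ => (hd u).continuousAt.continuousWithinAt)
      (fun u _ => (hd u).differentiableAt.differentiableWithinAt) fun u hu => ?_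
    have hu := interior_subset hu
    rw [(hd u).deriv]
    have hXu : exp (2 * X) ≤ exp (2 * u) := exp_le_exp.mpr (by linarith [hu.1])
    have h1u : 1 ≤ exp (2 * u) := one_le_exp (by linarith [hu.1])
    have hp : p u ≤ C := by
      have hG := h.lyapunov_nonpos u
      unfold lyapunov at hG
      have c0 := charge_nonneg (hnn u)
      have c1 : charge (ψ u) ≤ n * π :=
        (charge_strictMono.monotone (hbelow u hu)).trans_eq (charge_nat_mul_pi n)
      have c2 : charge (ψ u) ^ 2 ≤ (n * π) ^ 2 := by gcongr
      have s1 := sin_sq_le_one (ψ u)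
      have : p u ^ 2 ≤ C ^ 2 := by
        by_contra! hlt
        have h4 : C ^ 2 / 2 - 1 ≤ p u ^ 2 / 2 - sin (ψ u) ^ 2 := by linarith
        have h6 : (n * π) ^ 2 / 2 < C ^ 2 / 2 - 1 := by simp only [C]; nlinarith
        have h7 : 0 < C ^ 2 / 2 - 1 := by nlinarith [sq_nonneg (n * π)]
        have h5 : 1 * (C ^ 2 / 2 - 1) ≤ exp (2 * u) * (p u ^ 2 / 2 - sin (ψ u) ^ 2) :=
          mul_le_mul h1u h4 h7.le (exp_pos _).le
        linarith
      exact le_of_sq_le_sq this hC.le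
    have hEp : E * p u ≤ exp (2 * u) := by
      calc E * p u ≤ E * C := by gcongr
        _ = exp (2 * X) := by simp only [E]; field_simp
        _ ≤ _ := hXu
    nlinarith [mul_le_mul_of_nonneg_left hEp (sq_nonneg (sin (ψ u)))]
  have hfin := hanti ⟨le_rfl, hz.1⟩ ⟨hz.1, le_rfl⟩ hz.1
  have hGx := h.lyapunov_nonpos x
  have hcx : charge (ψ x) ≤ charge (n * π - η) := charge_strictMono.monotone hle
  have hGz : -((n * π) ^ 2 / 2) ≤ lyapunov ψ p z := by
    have hs : sin (n * π) = 0 := sin_nat_mul_pi n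
    rw [lyapunov, hzn, charge_nat_mul_pi, hs]
    nlinarith [mul_nonneg (exp_pos (2 * z)).le (sq_nonneg (p z))]
  simp only [hzn, charge_nat_mul_pi] at hfin
  have : E * charge (ψ x) ≤ E * charge (n * π - η) := by gcongr
  have e : E * gap = E * (n * π) - E * charge (n * π - η) := by simp only [gap]; ring
  linarith

lemma pow_three_div_three_le_charge {y : ℝ} (h0 : 0 < y) (h1 : y ≤ 1 / 2) :
    y ^ 3 / 3 ≤ charge y := by
  have h := sin_bound (x := 2 * y) (by rw [abs_of_pos (by linarith)]; linarith)
  rw [abs_of_pos (by linarith : 0 < 2 * y)] at h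
  have h2 := le_of_abs_le h
  have h3 : charge y = (2 * y - sin (2 * y)) / 2 := by rw [charge, sin_two_mul]; ring
  have h4 : y ^ 4 ≤ y ^ 3 * (1 / 2) := by
    rw [pow_succ]; gcongr
  rw [h3]
  nlinarith [pow_pos h0 3]

/-- The bound must not depend on `w`, which is large for large slopes. The quintic part contributes
at least `w⁵ / 6` and the cubic part at least `-2w³`; the former wins for `w ≥ 4`, and otherwise `-2
· 4³ = -128`. -/
lemma neg_const_le_source {s w : ℝ} (hs : 0 < s) (h0 : 0 < s * w) (h1 : s * w ≤ 1 / 2) :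
    -128 ≤ source s w := by
  have hw : 0 < w := pos_of_mul_pos_right h0 hs.le
  set y := s * w
  have e := pow_three_mul_source hs.ne' w
  have f1 : y ^ 5 / 6 ≤ force y := by
    have a1 := pow_three_div_three_le_charge h0 h1
    have a2 : y / 2 ≤ sin y := by
      have := sin_gt_sub_cube h0
      nlinarith [mul_le_mul_of_nonneg_left h1 h0.le]
    have a3 : (y / 2) ^ 2 ≤ sin y ^ 2 := by gcongr
    have a4 := charge_nonneg h0.le
    rw [force_eq]
    calc y ^ 5 / 6 = y ^ 3 / 3 * (2 * (y / 2) ^ 2) := by ring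
      _ ≤ _ := by gcongr
  have f2 := two_mul_sub_le_sin_two_mul h0
  have f3 : y ^ 5 / 6 / s ^ 2 ≤ force y / s ^ 2 := by gcongr
  have f4 : y ^ 5 / 6 / s ^ 2 = s ^ 3 * (w ^ 5 / 6) := by
    simp only [y]; field_simp
  have f5 : y ^ 3 = s ^ 3 * w ^ 3 := by simp only [y]; ring
  have f6 : s ^ 3 * (w ^ 5 / 6 - 2 * w ^ 3) ≤ s ^ 3 * source s w := by
    rw [e]; linarith
  have f7 := le_of_mul_le_mul_left f6 (pow_pos hs 3)
  refine le_trans ?_ f7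
  rcases le_total w 4 with h | h
  · have : w ^ 3 ≤ 4 ^ 3 := by gcongr
    have : 0 ≤ w ^ 5 / 6 := by positivity
    linarith
  · have : 0 ≤ w ^ 3 * (w ^ 2 / 6 - 2) := mul_nonneg (by positivity) (by nlinarith)
    nlinarith

/-- A trajectory which is not small at a very small radius climbs as high as desired. -/
lemma exists_nat_mul_pi_lt (n : ℕ) : ∃ r₀ : ℝ, 0 < r₀ ∧ ∀ ψ p : ℝ → ℝ, Trajectory ψ p →
    ∀ x, exp x ≤ r₀ → 1 / 2 ≤ ψ x → ∃ y, n * π < ψ y := by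
  set ν := charge (1 / 2)
  have hν : 0 < ν := by
    have := charge_strictMono (show (0 : ℝ) < 1 / 2 by norm_num)
    rwa [charge_zero] at this
  set ρ := ν / 2
  have hρ : 0 < ρ := by positivity
  have hnπ := nat_mul_pi_nonneg n
  -- Below the radius `ρ` the slope satisfies `r² φ' ≥ ν / 2`, so the climb from `r₁` to `ρ` is at
  -- least `(ν / 2)(1 / r₁ - 1 / ρ)`. With `1 / r₁ ≥ D` this exceeds `nπ`.
  set D := 2 * (n * π) / ν + 1 / ρ + 1
  have hD : 0 < D := by positivity
  refine ⟨1 / D, by positivity, fun ψ p h x₁ hx₁ hψ₁ => ?_⟩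
  set x₂ := log ρ
  have hx₂ : exp x₂ = ρ := exp_log hρ
  have hx₁₂ : x₁ ≤ x₂ := by
    rw [← exp_le_exp, hx₂]
    refine hx₁.trans ?_
    rw [one_div_le hD hρ]
    have : 0 ≤ 2 * (n * π) / ν := by positivity
    simp only [D]; linarith
  have hsq : ∀ x, x ≤ x₂ → 1 / 2 ≤ ψ x → (ν / 2) ^ 2 ≤ (exp x * p x) ^ 2 ∧ p x ≠ 0 := by
    intro x hx hψx
    have hG := h.neg_exp_le_lyapunov x
    have hexp : exp (2 * x) = exp x ^ 2 := by rw [← exp_nat_mul]; push_cast; rfl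
    have hexρ : exp x ≤ ρ := by rw [← hx₂]; exact exp_le_exp.mpr hx
    have hexρ2 : exp x ^ 2 ≤ ρ ^ 2 := by gcongr
    have hc : ν ^ 2 ≤ charge (ψ x) ^ 2 := by
      have := charge_strictMono.monotone hψx
      gcongr
    have key : (ν / 2) ^ 2 ≤ (exp x * p x) ^ 2 := by
      rw [lyapunov, hexp] at hG
      simp only [ρ] at hexρ2
      nlinarith [mul_nonneg (sq_nonneg (exp x)) (sq_nonneg (sin (ψ x))), sq_nonneg ν]
    refine ⟨key, fun h0 => ?_⟩
    rw [h0] at key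
    nlinarith
  obtain ⟨Y, hY, hYx⟩ := ((h.tendsto_atBot.eventually
    (gt_mem_nhds (show (0 : ℝ) < 1 / 2 by norm_num))).and (eventually_le_atBot x₁)).exists
  -- The bound on `p²` leaves its sign open. A maximum before `y` would be a critical point with `ψ
  -- ≥ 1/2`, which is excluded, so `ψ` increases.
  have hmax : ∀ y ∈ Icc x₁ x₂, ∀ z ∈ Icc Y y, ψ z ≤ ψ y := by
    intro y hy z hz
    obtain ⟨m, hm, hmm⟩ := isCompact_Icc.exists_isMaxOn (s := Icc Y y)
      ⟨y, hYx.trans hy.1, le_rfl⟩ h.continuous.continuousOn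
    have hm2 : 1 / 2 ≤ ψ m := hψ₁.trans (hmm ⟨hYx, hy.1⟩)
    have hYm : Y < m := lt_of_le_of_ne hm.1 (by rintro rfl; linarith)
    rcases hm.2.eq_or_lt with rfl | hlt
    · exact hmm hz
    · have hp : p m = 0 := (hmm.isLocalMax (Icc_mem_nhds hYm hlt)).hasDerivAt_eq_zero
        (h.hasDerivAt m)
      exact absurd hp (hsq m (hm.2.trans hy.2) hm2).2
  have hmono : MonotoneOn ψ (Icc x₁ x₂) := fun y hy z hz hyz =>
    hmax z hz y ⟨hYx.trans hy.1, hyz⟩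
  have hd : ∀ x, HasDerivAt (fun x => ψ x + ν / 2 * exp (-x)) (p x + ν / 2 * (exp (-x) * -1)) x :=
    fun x => (h.hasDerivAt x).add ((hasDerivAt_neg x).exp.const_mul _)
  have hmono' : MonotoneOn (fun x => ψ x + ν / 2 * exp (-x)) (Icc x₁ x₂) := by
    refine monotoneOn_of_deriv_nonneg (convex_Icc _ _)
      (fun x _ => (hd x).continuousAt.continuousWithinAt)
      (fun x _ => (hd x).differentiableAt.differentiableWithinAt) fun x hx => ?_
    have hx' := interior_subset hx
    rw [(hd x).deriv]
    have hp0 : 0 ≤ p x := by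
      have := hmono.derivWithin_nonneg (x := x)
      rwa [derivWithin_of_mem_nhds (mem_interior_iff_mem_nhds.mp hx),
        (h.hasDerivAt x).deriv] at this
    have h1 := (hsq x hx'.2 (hψ₁.trans (hmono ⟨le_rfl, hx₁₂⟩ hx' hx'.1))).1
    have h2 : ν / 2 ≤ exp x * p x := le_of_sq_le_sq h1 (by positivity)
    have h3 : ν / 2 * exp (-x) ≤ exp x * p x * exp (-x) := by gcongr
    have h4 : exp x * p x * exp (-x) = p x := by
      rw [mul_right_comm, ← exp_add]; simp
    linarith
  have hfin := hmono' ⟨le_rfl, hx₁₂⟩ ⟨hx₁₂, le_rfl⟩ hx₁₂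
  simp only at hfin
  refine ⟨x₂, ?_⟩
  have e1 : D ≤ exp (-x₁) := by
    rw [exp_neg, le_inv_comm₀ hD (exp_pos _), ← one_div]; exact hx₁
  have e2 : exp (-x₂) = 1 / ρ := by rw [exp_neg, hx₂, one_div]
  have e3 : ν / 2 * D = n * π + ν / 2 * (1 / ρ) + ν / 2 := by
    simp only [D]; field_simp
  have e4 : ν / 2 * D ≤ ν / 2 * exp (-x₁) := by gcongr
  rw [e2] at hfin
  linarith

/-- Large initial slopes overshoot. -/
lemma exists_overshoot (n : ℕ) : ∃ β : ℝ, 0 ≤ β ∧ ∃ x, n * π < shot β x := by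
  obtain ⟨r₀, hr₀, h⟩ := exists_nat_mul_pi_lt n
  -- Without overshooting, `r w < 1/2` on `(0, r₀]`, so `source ≥ -128` and `w` drops by at most
  -- `12.8 r₀²`. Then `w(r₀) ≥ 1 / r₀`, a contradiction.
  set β := 1 / r₀ + 13 * r₀ ^ 2
  have hβ : 0 < β := by positivity
  refine ⟨β, hβ.le, ?_⟩
  by_contra! hcon
  have hsmall : ∀ s ∈ Ioc 0 r₀, s * reducedProfile β s < 1 / 2 := by
    intro s hs
    by_contra! hge
    have hlog : exp (log s) = s := exp_log hs.1
    obtain ⟨y, hy⟩ := h _ _ (trajectory_shot β) (log s) (by rw [hlog]; exact hs.2)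
      (by rw [shot, hlog]; exact hge)
    exact absurd hy (not_lt.mpr (hcon y))
  have hpos : ∀ s, 0 < s → 0 < s * reducedProfile β s := fun s hs => by
    have := shot_pos hβ (log s)
    rwa [shot, exp_log hs] at this
  have hsrc : ∀ s ∈ Ioc 0 r₀, -128 ≤ source s (reducedProfile β s) := fun s hs =>
    neg_const_le_source hs.1 (hpos s hs.1) (hsmall s hs).le
  have hsrc' : ∀ s ∈ Icc 0 r₀, -128 ≤ source s (reducedProfile β s) := by
    intro s hs
    rcases hs.1.eq_or_lt with rfl | hs0
    · refine ge_of_tendsto ((continuous_source_reducedProfile β).continuousAt.tendsto.mono_left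
        (nhdsWithin_le_nhds (s := Ioi 0))) ?_
      filter_upwards [Ioc_mem_nhdsGT hr₀] with s hs using hsrc s hs
    · exact hsrc s ⟨hs0, hs.2⟩
  have h1 := radialInt_mono continuous_const (continuous_source_reducedProfile β) hr₀.le hsrc'
  rw [radialInt_const] at h1
  have h2 := reducedProfile_eq β hr₀.le
  have h3 := hsmall r₀ ⟨hr₀, le_rfl⟩
  have h4 : 1 / r₀ ≤ reducedProfile β r₀ := by
    rw [h2]; simp only [β]; nlinarith [sq_nonneg r₀]
  have h5 : r₀ * (1 / r₀) ≤ r₀ * reducedProfile β r₀ := by gcongr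
  rw [mul_one_div_cancel hr₀.ne'] at h5
  linarith

/-- Shots with nearby slopes are uniformly close on left half-lines. -/
lemma exists_abs_shot_sub_lt (β₀ X : ℝ) {ε : ℝ} (hε : 0 < ε) : ∃ δ, 0 < δ ∧
    ∀ β, |β - β₀| < δ → ∀ x, x ≤ X → |shot β x - shot β₀ x| < ε := by
  set R := exp X + 1
  have hR : 1 ≤ R := by simp only [R]; linarith [exp_pos X]
  obtain ⟨C, hC, h⟩ := exists_abs_reducedProfile_sub_le β₀ R hR
  refine ⟨min 1 (ε / (R * (C + 1))), by positivity, fun β hβ x hx => ?_⟩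
  have h1 := hβ.trans_le (min_le_left _ _)
  have h2 := hβ.trans_le (min_le_right _ _)
  have hxR : exp x ≤ R := (exp_le_exp.mpr hx).trans (by simp only [R]; linarith)
  have h3 := h β h1.le (exp x) ⟨(exp_pos x).le, hxR⟩
  rw [shot, shot, ← mul_sub, abs_mul, abs_of_pos (exp_pos x)]
  rw [lt_div_iff₀ (by positivity)] at h2
  calc exp x * |reducedProfile β (exp x) - reducedProfile β₀ (exp x)|
      ≤ R * (C * |β - β₀|) := by gcongr
    _ ≤ |β - β₀| * (R * (C + 1)) := by nlinarith [abs_nonneg (β - β₀)]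
    _ < ε := h2

/-- Existence of a slope for which the shot connects `0` to `nπ`. -/
theorem exists_shot_tendsto {n : ℕ} (hn : 1 ≤ n) :
    ∃ β : ℝ, 0 < β ∧ Tendsto (shot β) atTop (𝓝 (n * π)) := by
  have hnπ : (0 : ℝ) < n * π := by
    have : (0 : ℝ) < n := by exact_mod_cast hn
    positivity
  set A : Set ℝ := {β | 0 ≤ β ∧ ∃ x, n * π < shot β x}
  have hAne : A.Nonempty := exists_overshoot n
  have hAbdd : BddBelow A := ⟨0, fun β hβ => hβ.1⟩
  set β₀ := sInf A
  have hβ₀ : 0 ≤ β₀ := le_csInf hAne fun β hβ => hβ.1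
  -- Overshooting is an open condition on `β`, so the infimum itself does not overshoot.
  have hle : ∀ x, shot β₀ x ≤ n * π := by
    intro x
    by_contra! hx
    rcases hβ₀.eq_or_lt with h0 | h0
    · rw [← h0, shot_zero] at hx; linarith
    · obtain ⟨δ, hδ, h⟩ := exists_abs_shot_sub_lt β₀ x (sub_pos.mpr hx)
      set β := max 0 (β₀ - δ / 2)
      have hββ₀ : β < β₀ := max_lt h0 (by linarith)
      have hβδ : |β - β₀| < δ := by
        rw [abs_of_neg (by linarith)]
        have := le_max_right 0 (β₀ - δ / 2)
        simp only [β]; linarith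
      have h1 := neg_lt_of_abs_lt (h β hβδ x le_rfl)
      have : β ∈ A := ⟨le_max_left _ _, x, by linarith⟩
      exact absurd (csInf_le hAbdd this) (not_le.mpr hββ₀)
  have hlt := (trajectory_shot β₀).lt_nat_mul_pi_of_le hn hle
  -- Suppose the critical shot is `η` below `nπ` at a late time `x`. A slope in `A` close to `β₀`
  -- gives a shot `η / 2` below at `x`, which trapping keeps under `nπ` afterwards. Before `x` it is
  -- uniformly close to a shot whose maximum is under `nπ`. So it never overshoots.
  have hclose : ∀ η, 0 < η → ∀ᶠ x in atTop, n * π - η < shot β₀ x := by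
    intro η hη
    obtain ⟨X, hX⟩ := exists_trapping n (half_pos hη)
    filter_upwards [eventually_ge_atTop X] with x hx
    by_contra! hxη
    have hcont : Continuous fun r => r * reducedProfile β₀ r :=
      continuous_id.mul (continuous_reducedProfile β₀)
    -- Passing to the radius compactifies the half-line `(-∞, x]`; the added point `r = 0` has value
    -- zero.
    obtain ⟨m, hm, hmax⟩ := isCompact_Icc.exists_isMaxOn (s := Icc 0 (exp x))
      ⟨0, le_rfl, (exp_pos x).le⟩ hcont.continuousOn
    have hmlt : m * reducedProfile β₀ m < n * π := by
      rcases hm.1.eq_or_lt with h0 | h0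
      · rw [← h0]; simpa using hnπ
      · have := hlt (log m)
        rwa [shot, exp_log h0] at this
    obtain ⟨δ, hδ, h⟩ := exists_abs_shot_sub_lt β₀ x
      (lt_min (half_pos hη) (sub_pos.mpr hmlt))
    obtain ⟨β, hβA, hβ⟩ := exists_lt_of_csInf_lt hAne
      (show sInf A < β₀ + δ by simp only [β₀]; linarith)
    have hβδ : |β - β₀| < δ := by
      have := csInf_le hAbdd hβA
      rw [abs_of_nonneg (by linarith)]; linarith
    obtain ⟨y, hy⟩ := hβA.2
    rcases le_total y x with hyx | hxy
    · have h1 := (lt_of_abs_lt (h β hβδ y hyx)).trans_le (min_le_right _ _)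
      have h2 : shot β₀ y ≤ m * reducedProfile β₀ m :=
        hmax ⟨(exp_pos y).le, exp_le_exp.mpr hyx⟩
      linarith
    · have h1 := (lt_of_abs_lt (h β hβδ x le_rfl)).trans_le (min_le_left _ _)
      have := hX _ _ (trajectory_shot β) (shot_nonneg hβA.1) x hx (by linarith) y hxy
      linarith
  have hlim : Tendsto (shot β₀) atTop (𝓝 (n * π)) := by
    refine tendsto_order.mpr ⟨fun a ha => ?_, fun a ha => Eventually.of_forall fun x =>
      (hlt x).trans ha⟩
    simpa using hclose (n * π - a) (sub_pos.mpr ha)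
  refine ⟨β₀, lt_of_le_of_ne hβ₀ fun h0 => ?_, hlim⟩
  rw [← h0, show shot 0 = fun _ => 0 from funext shot_zero] at hlim
  have := tendsto_nhds_unique hlim tendsto_const_nhds
  linarith

/-! ### Symbol bounds for derivatives -/

/-- Functions on `(0, ∞)` whose derivatives up to order `k` satisfy the symbol bounds
`f⁽ʲ⁾(r) = O(r ^ (p - j))` along the filter `l`. -/
def IsSymbol (l : Filter ℝ) : ℕ → ℤ → (ℝ → ℝ) → Prop
  | 0, p, f => f =O[l] fun r => r ^ p
  | k + 1, p, f => (f =O[l] fun r => r ^ p) ∧ DifferentiableOn ℝ f (Ioi 0) ∧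
      IsSymbol l k (p - 1) (deriv f)

namespace IsSymbol

variable {l : Filter ℝ} {k : ℕ} {p q : ℤ} {f g u : ℝ → ℝ}

lemma isBigO (h : IsSymbol l k p f) : f =O[l] fun r => r ^ p := by
  cases k with
  | zero => exact h
  | succ k => exact h.1

lemma congr (hl : Ioi 0 ∈ l) (h : IsSymbol l k p f) (hfg : EqOn f g (Ioi 0)) :
    IsSymbol l k p g := by
  induction k generalizing p f g with
  | zero =>
    exact Asymptotics.IsBigO.congr' h (hfg.eventuallyEq_of_mem hl) EventuallyEq.rfl
  | succ k ih =>
    obtain ⟨h1, h2, h3⟩ := h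
    exact ⟨h1.congr' (hfg.eventuallyEq_of_mem hl) EventuallyEq.rfl,
      h2.congr fun x hx => (hfg hx).symm, ih h3 fun x hx =>
        (hfg.eventuallyEq_of_mem (isOpen_Ioi.mem_nhds hx)).deriv_eq⟩

lemma of_succ (h : IsSymbol l (k + 1) p f) : IsSymbol l k p f := by
  induction k generalizing p f with
  | zero => exact h.1
  | succ k ih => exact ⟨h.1, h.2.1, ih h.2.2⟩

lemma add (hl : Ioi 0 ∈ l) (hf : IsSymbol l k p f) (hg : IsSymbol l k p g) :
    IsSymbol l k p (fun r => f r + g r) := by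
  induction k generalizing p f g with
  | zero => exact Asymptotics.IsBigO.add hf hg
  | succ k ih =>
    refine ⟨hf.1.add hg.1, hf.2.1.add hg.2.1, (ih hf.2.2 hg.2.2).congr hl fun x hx => ?_⟩
    have h1 := hf.2.1.differentiableAt (isOpen_Ioi.mem_nhds hx)
    have h2 := hg.2.1.differentiableAt (isOpen_Ioi.mem_nhds hx)
    exact (deriv_fun_add h1 h2).symm

lemma mul (hl : Ioi 0 ∈ l) (hf : IsSymbol l k p f) (hg : IsSymbol l k q g) :
    IsSymbol l k (p + q) (fun r => f r * g r) := by
  have hO : ∀ {f g : ℝ → ℝ} {p q : ℤ}, (f =O[l] fun r => r ^ p) → (g =O[l] fun r => r ^ q) →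
      (fun r => f r * g r) =O[l] fun r => r ^ (p + q) := by
    intro f g p q hf hg
    refine (hf.mul hg).congr' EventuallyEq.rfl ?_
    filter_upwards [hl] with r hr using (zpow_add₀ (ne_of_gt hr) p q).symm
  induction k generalizing p q f g with
  | zero => exact hO hf hg
  | succ k ih =>
    refine ⟨hO hf.1 hg.1, hf.2.1.mul hg.2.1, ?_⟩
    have h1 := ih hf.2.2 hg.of_succ
    have h2 := ih hf.of_succ hg.2.2
    rw [show p - 1 + q = p + q - 1 by ring] at h1
    rw [show p + (q - 1) = p + q - 1 by ring] at h2
    refine (h1.add hl h2).congr hl fun x hx => ?_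
    have h1 := hf.2.1.differentiableAt (isOpen_Ioi.mem_nhds hx)
    have h2 := hg.2.1.differentiableAt (isOpen_Ioi.mem_nhds hx)
    exact (deriv_fun_mul h1 h2).symm

lemma const_mul_zpow (hl : Ioi 0 ∈ l) (c : ℝ) : IsSymbol l k p (fun r => c * r ^ p) := by
  induction k generalizing p c with
  | zero => exact Asymptotics.isBigO_const_mul_self c _ _
  | succ k ih =>
    have hd : ∀ x ∈ Ioi (0 : ℝ), HasDerivAt (fun r : ℝ => c * r ^ p) (c * p * x ^ (p - 1)) x :=
      fun x hx => ((hasDerivAt_zpow p x (Or.inl (ne_of_gt hx))).const_mul c).congr_deriv (by ring)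
    exact ⟨Asymptotics.isBigO_const_mul_self c _ _,
      fun x hx => (hd x hx).differentiableAt.differentiableWithinAt,
      (ih (c * p)).congr hl fun x hx => (hd x hx).deriv.symm⟩

lemma const_mul (hl : Ioi 0 ∈ l) (c : ℝ) (hf : IsSymbol l k p f) :
    IsSymbol l k p (fun r => c * f r) := by
  have := (const_mul_zpow (k := k) (p := 0) hl c).mul hl hf
  simpa using this

lemma pow (hl : Ioi 0 ∈ l) (hf : IsSymbol l k p f) (m : ℕ) :
    IsSymbol l k (m * p) (fun r => f r ^ m) := by
  induction m with
  | zero => simpa using const_mul_zpow (k := k) (p := 0) hl 1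
  | succ m ih =>
    have := ih.mul hl hf
    rw [show (m : ℤ) * p + p = ((m + 1 : ℕ) : ℤ) * p by push_cast; ring] at this
    simpa only [pow_succ] using this

/-- The condition `r ^ (p - q) = O(1)` covers both ends: it means `p ≤ q` at infinity and `p ≥ q` at
zero. -/
lemma mono_exponent (hl : Ioi 0 ∈ l) (hpq : (fun r : ℝ => r ^ (p - q)) =O[l] fun _ => (1 : ℝ))
    (hf : IsSymbol l k p f) : IsSymbol l k q f := by
  have hO : ∀ {p q : ℤ} {f : ℝ → ℝ}, (fun r : ℝ => r ^ (p - q)) =O[l] (fun _ => (1 : ℝ)) →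
      (f =O[l] fun r => r ^ p) → f =O[l] fun r => r ^ q := by
    intro p q f hpq hf
    refine hf.trans ?_
    have := hpq.mul (Asymptotics.isBigO_refl (fun r : ℝ => r ^ q) l)
    refine this.congr' ?_ (Eventually.of_forall fun r => one_mul _)
    filter_upwards [hl] with r hr
    rw [← zpow_add₀ (ne_of_gt hr)]; congr 1; ring
  induction k generalizing p q f with
  | zero => exact hO hpq hf
  | succ k ih => exact ⟨hO hpq hf.1, hf.2.1, ih (by simpa using hpq) hf.2.2⟩

/-- Composition of a bounded symbol with a smooth function. -/
lemma comp (hl : Ioi 0 ∈ l) (hg : ContDiff ℝ ∞ g) (hu : IsSymbol l k 0 u) :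
    IsSymbol l k 0 (fun r => g (u r)) := by
  have hO : ∀ {g : ℝ → ℝ}, Continuous g → (u =O[l] fun r => r ^ (0 : ℤ)) →
      (fun r => g (u r)) =O[l] fun r => r ^ (0 : ℤ) := by
    intro g hg hu
    obtain ⟨C, hC⟩ := hu.bound
    simp only [zpow_zero, norm_one, mul_one] at hC
    obtain ⟨M, hM⟩ := isCompact_Icc.exists_bound_of_continuousOn (s := Icc (-C) C) hg.continuousOn
    refine Asymptotics.IsBigO.of_bound M ?_
    filter_upwards [hC] with r hr
    simpa using hM (u r) (abs_le.mp hr)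
  induction k generalizing g with
  | zero => exact hO hg.continuous hu
  | succ k ih =>
    have hgd : Differentiable ℝ g := hg.differentiable (by simp)
    refine ⟨hO hg.continuous hu.1, hgd.comp_differentiableOn hu.2.1, ?_⟩
    have hg' : ContDiff ℝ ∞ (deriv g) := (contDiff_infty_iff_deriv.mp hg).2
    have h1 := (ih hg' hu.of_succ).mul hl hu.2.2
    rw [zero_add] at h1
    refine h1.congr hl fun x hx => ?_
    have h2 := (hu.2.1.differentiableAt (isOpen_Ioi.mem_nhds hx)).hasDerivAt
    exact (((hgd (u x)).hasDerivAt.comp x h2).deriv).symm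

lemma iteratedDeriv_isBigO (hf : IsSymbol l k p f) :
    iteratedDeriv k f =O[l] fun r => r ^ (p - (k : ℤ)) := by
  induction k generalizing p f with
  | zero => simpa using hf.isBigO
  | succ k ih =>
    rw [iteratedDeriv_succ']
    have := ih hf.2.2
    rwa [show p - 1 - (k : ℤ) = p - ((k + 1 : ℕ) : ℤ) by push_cast; ring] at this

/-- Symbol bounds for all derivatives of a solution of the Euler-type equation
`r² e'' + 2 r e' - 2 e = g` follow from the bounds on `e` and `e'`. -/
lemma of_euler_equation (hl : Ioi 0 ∈ l) {e e' : ℝ → ℝ}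
    (he : ∀ r, 0 < r → HasDerivAt e (e' r) r)
    (he' : ∀ r, 0 < r → HasDerivAt e' ((2 * e r - 2 * r * e' r + g r) / r ^ 2) r)
    (hg : ∀ k, IsSymbol l k p e → IsSymbol l k p g)
    (hO : e =O[l] fun r => r ^ p) (hO' : e' =O[l] fun r => r ^ (p - 1)) (k : ℕ) :
    IsSymbol l k p e := by
  have hde : EqOn e' (deriv e) (Ioi 0) := fun r hr => (he r hr).deriv.symm
  -- Both functions are carried through the induction: the equation expresses the derivative of `e'`
  -- by `e`, `e'` and `g`, all controlled to the previous order.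
  suffices h : IsSymbol l k p e ∧ IsSymbol l k (p - 1) e' from h.1
  induction k with
  | zero => exact ⟨hO, hO'⟩
  | succ k ih =>
    refine ⟨⟨hO, fun r hr => (he r hr).differentiableAt.differentiableWithinAt,
      ih.2.congr hl hde⟩, ⟨hO', fun r hr => (he' r hr).differentiableAt.differentiableWithinAt, ?_⟩⟩
    have h1 := ih.1.const_mul hl 2
    have h2 := (const_mul_zpow (k := k) (p := 1) hl (-2)).mul hl ih.2
    rw [add_sub_cancel] at h2
    have h3 := (const_mul_zpow (k := k) (p := -2) hl 1).mul hl ((h1.add hl h2).add hl (hg k ih.1))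
    rw [show -2 + p = p - 1 - 1 by ring] at h3
    refine h3.congr hl fun r hr => ?_
    rw [(he' r hr).deriv]
    have : r ^ (-2 : ℤ) = (r ^ 2)⁻¹ := by rw [zpow_neg]; rfl
    simp only [this, zpow_one]
    field_simp
    ring

end IsSymbol

/-! ### Asymptotics at infinity -/

/-- Exponential decay of the derivative gives exponential convergence. -/
lemma exists_abs_sub_le_of_abs_deriv_le {h h' : ℝ → ℝ} {D c X : ℝ} (hc : 0 < c)
    (hh : ∀ x, X ≤ x → HasDerivAt h (h' x) x) (hb : ∀ x, X ≤ x → |h' x| ≤ D * exp (-c * x)) :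
    ∃ ℓ, ∀ x, X ≤ x → |h x - ℓ| ≤ D / c * exp (-c * x) := by
  have he : ∀ k x : ℝ, HasDerivAt (fun x => k * exp (-c * x)) (k * (exp (-c * x) * (-c * 1))) x :=
    fun k x => ((hasDerivAt_id x).const_mul (-c)).exp.const_mul k
  have hanti : AntitoneOn (fun x => h x + D / c * exp (-c * x)) (Ici X) := by
    refine antitoneOn_of_deriv_nonpos (convex_Ici X)
      (fun x hx => ((hh x hx).add (he _ x)).continuousAt.continuousWithinAt)
      (fun x hx => ((hh x (interior_subset hx)).add
        (he _ x)).differentiableAt.differentiableWithinAt) fun x hx => ?_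
    have hx := interior_subset hx
    have e := ((hh x hx).add (he (D / c) x)).deriv
    have e2 : D / c * (exp (-c * x) * (-c * 1)) = -(D * exp (-c * x)) := by field_simp
    rw [e2] at e
    change deriv (h + fun x => D / c * exp (-c * x)) x ≤ 0
    rw [e]
    linarith [le_of_abs_le (hb x hx)]
  have hmono : MonotoneOn (fun x => h x - D / c * exp (-c * x)) (Ici X) := by
    refine monotoneOn_of_deriv_nonneg (convex_Ici X)
      (fun x hx => ((hh x hx).sub (he _ x)).continuousAt.continuousWithinAt)
      (fun x hx => ((hh x (interior_subset hx)).sub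
        (he _ x)).differentiableAt.differentiableWithinAt) fun x hx => ?_
    have hx := interior_subset hx
    have e := ((hh x hx).sub (he (D / c) x)).deriv
    have e2 : D / c * (exp (-c * x) * (-c * 1)) = -(D * exp (-c * x)) := by field_simp
    rw [e2] at e
    change 0 ≤ deriv (h - fun x => D / c * exp (-c * x)) x
    rw [e]
    linarith [neg_le_of_abs_le (hb x hx)]
  have hD : ∀ x, X ≤ x → 0 ≤ D / c * exp (-c * x) := fun x hx => by
    have := (abs_nonneg _).trans (hb x hx)
    rw [div_mul_eq_mul_div]; positivity
  have hle : ∀ x, X ≤ x → ∀ y, X ≤ y →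
      h x - D / c * exp (-c * x) ≤ h y + D / c * exp (-c * y) := by
    intro x hx y hy
    rcases le_total x y with hxy | hxy
    · have := hmono hx hy hxy
      simp only at this
      linarith [hD y hy]
    · have := hanti hy hx hxy
      simp only at this
      linarith [hD x hx]
  set S := (fun x => h x - D / c * exp (-c * x)) '' Ici X
  refine ⟨sSup S, fun x hx => ?_⟩
  have h1 : h x - D / c * exp (-c * x) ≤ sSup S :=
    le_csSup ⟨h X + D / c * exp (-c * X), by
      rintro _ ⟨y, hy, rfl⟩; exact hle y hy X le_rfl⟩ ⟨x, hx, rfl⟩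
  have h2 : sSup S ≤ h x + D / c * exp (-c * x) :=
    csSup_le ⟨_, X, self_mem_Ici, rfl⟩ (by rintro _ ⟨y, hy, rfl⟩; exact hle y hy x hx)
  exact abs_le.mpr ⟨by linarith, by linarith⟩

/-- Decaying solutions of `u'' + u' = 2 u + g` with `g = O(e ^ (-q x))`, `q > 2`, are asymptotic
to a multiple of `e ^ (-2 x)`. -/
lemma exists_asymptotics {u v g : ℝ → ℝ} {D q X : ℝ} (hq : 2 < q)
    (hu : ∀ x, X ≤ x → HasDerivAt u (v x) x)
    (hv : ∀ x, X ≤ x → HasDerivAt v (2 * u x + g x - v x) x)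
    (hlim : Tendsto u atTop (𝓝 0)) (hg : ∀ x, X ≤ x → |g x| ≤ D * exp (-q * x)) :
    ∃ α D', ∀ x, X ≤ x → |u x + α * exp (-2 * x)| ≤ D' * exp (-q * x) ∧
      |v x - 2 * α * exp (-2 * x)| ≤ D' * exp (-q * x) := by
  have he : ∀ k x : ℝ, HasDerivAt (fun x => exp (k * x)) (exp (k * x) * (k * 1)) x :=
    fun k x => ((hasDerivAt_id x).const_mul k).exp
  have hexp : ∀ a b x : ℝ, exp (a * x) * exp (b * x) = exp ((a + b) * x) := fun a b x => by
    rw [← exp_add]; ring_nf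
  -- The factorisation `λ² + λ - 2 = (λ + 2)(λ - 1)`: the combination `v - u` satisfies a first
  -- order equation with rate `-2`, so `exp (2x) (v - u)` has derivative `exp (2x) g` and converges.
  obtain ⟨ℓ, hℓ⟩ := exists_abs_sub_le_of_abs_deriv_le (h := fun x => exp (2 * x) * (v x - u x))
    (h' := fun x => exp (2 * x) * g x) (D := D) (c := q - 2) (X := X) (by linarith)
    (fun x hx => ((he 2 x).mul ((hv x hx).sub (hu x hx))).congr_deriv (by
      simp only [Pi.sub_apply]; ring))
    (fun x hx => by
      rw [abs_mul, abs_of_pos (exp_pos _)]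
      calc exp (2 * x) * |g x| ≤ exp (2 * x) * (D * exp (-q * x)) := by
            gcongr; exact hg x hx
        _ = D * (exp (2 * x) * exp (-q * x)) := by ring
        _ = D * exp (-(q - 2) * x) := by rw [hexp]; ring_nf)
  set D₁ := D / (q - 2)
  have hy : ∀ x, X ≤ x → |v x - u x - ℓ * exp (-2 * x)| ≤ D₁ * exp (-q * x) := fun x hx => by
    have e1 : v x - u x - ℓ * exp (-2 * x) = (exp (2 * x) * (v x - u x) - ℓ) * exp (-2 * x) := by
      have : exp (2 * x) * exp (-2 * x) = 1 := by rw [hexp]; simp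
      linear_combination (-(v x - u x)) * this
    rw [e1, abs_mul, abs_of_pos (exp_pos (-2 * x))]
    calc _ ≤ D₁ * exp (-(q - 2) * x) * exp (-2 * x) := by gcongr; exact hℓ x hx
      _ = D₁ * exp (-q * x) := by rw [mul_assoc, hexp]; ring_nf
  -- The remaining equation `u' - u = ℓ exp (-2x) + …` has particular solution `-(ℓ / 3) exp (-2x)`,
  -- whence `α = ℓ / 3`. The limit `ℓ₂` is the amplitude of the growing mode, and it vanishes
  -- because `u → 0`.
  obtain ⟨ℓ₂, hℓ₂⟩ := exists_abs_sub_le_of_abs_deriv_le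
    (h := fun x => exp (-1 * x) * u x + ℓ / 3 * exp (-3 * x))
    (h' := fun x => exp (-1 * x) * (v x - u x - ℓ * exp (-2 * x))) (D := D₁) (c := q + 1) (X := X)
    (by linarith)
    (fun x hx => (((he (-1) x).mul (hu x hx)).add ((he (-3) x).const_mul (ℓ / 3))).congr_deriv (by
      have : exp (-3 * x) = exp (-1 * x) * exp (-2 * x) := by rw [hexp]; norm_num
      rw [this]; ring))
    (fun x hx => by
      rw [abs_mul, abs_of_pos (exp_pos _)]
      calc _ ≤ exp (-1 * x) * (D₁ * exp (-q * x)) := by gcongr; exact hy x hx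
        _ = D₁ * (exp (-1 * x) * exp (-q * x)) := by ring
        _ = D₁ * exp (-(q + 1) * x) := by rw [hexp]; ring_nf)
  have hzero : ∀ k : ℝ, k < 0 → Tendsto (fun x => exp (k * x)) atTop (𝓝 0) := fun k hk =>
    tendsto_exp_atBot.comp (tendsto_id.const_mul_atTop_of_neg hk)
  have hℓ₂0 : ℓ₂ = 0 := by
    have h1 : Tendsto (fun x => exp (-1 * x) * u x + ℓ / 3 * exp (-3 * x)) atTop (𝓝 0) := by
      simpa using ((hzero (-1) (by norm_num)).mul hlim).add
        ((hzero (-3) (by norm_num)).const_mul (ℓ / 3))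
    have h2 : Tendsto (fun x => D₁ / (q + 1) * exp (-(q + 1) * x)) atTop (𝓝 0) := by
      simpa only [mul_zero] using (hzero (-(q + 1)) (by linarith)).const_mul (D₁ / (q + 1))
    have h3 := (h1.sub_const ℓ₂).abs
    have h4 := le_of_tendsto_of_tendsto h3 h2 ((eventually_ge_atTop X).mono hℓ₂)
    simpa using h4
  set D₂ := D₁ / (q + 1)
  have hfirst : ∀ x, X ≤ x → |u x + ℓ / 3 * exp (-2 * x)| ≤ D₂ * exp (-q * x) := fun x hx => by
    have h1 := hℓ₂ x hx
    rw [hℓ₂0, sub_zero] at h1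
    have e1 : u x + ℓ / 3 * exp (-2 * x)
        = (exp (-1 * x) * u x + ℓ / 3 * exp (-3 * x)) * exp (1 * x) := by
      have e2 : exp (-1 * x) * exp (1 * x) = 1 := by rw [hexp]; simp
      have e3 : exp (-3 * x) * exp (1 * x) = exp (-2 * x) := by rw [hexp]; norm_num
      linear_combination (-u x) * e2 - ℓ / 3 * e3
    rw [e1, abs_mul, abs_of_pos (exp_pos (1 * x))]
    calc _ ≤ D₂ * exp (-(q + 1) * x) * exp (1 * x) := by gcongr
      _ = D₂ * exp (-q * x) := by rw [mul_assoc, hexp]; ring_nf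
  refine ⟨ℓ / 3, |D₁| + |D₂|, fun x hx => ⟨?_, ?_⟩⟩
  · refine (hfirst x hx).trans ?_
    gcongr
    linarith [le_abs_self D₂, abs_nonneg D₁]
  · have e : v x - 2 * (ℓ / 3) * exp (-2 * x)
        = (v x - u x - ℓ * exp (-2 * x)) + (u x + ℓ / 3 * exp (-2 * x)) := by ring
    rw [e]
    refine (abs_add_le _ _).trans ((add_le_add (hy x hx) (hfirst x hx)).trans ?_)
    rw [← add_mul]
    gcongr
    · exact le_abs_self _
    · exact le_abs_self _

namespace Trajectory

variable {ψ p : ℝ → ℝ} {n : ℕ}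

/-- For `u = O(exp (-q x))` the remainder is `O(exp (-3q x) + exp (-(2q + 2) x))`. The rate `q =
3/2` gives `9/2 > 2`, which improves the decay to `q = 2`; then both exponents equal `6`. -/
lemma exists_expansion (h : Trajectory ψ p) (hlim : Tendsto ψ atTop (𝓝 (n * π))) :
    ∃ α D X, ∀ x, X ≤ x → |ψ x - n * π + α * exp (-2 * x)| ≤ D * exp (-6 * x) ∧
      |p x - 2 * α * exp (-2 * x)| ≤ D * exp (-6 * x) := by
  have hnπ := nat_mul_pi_nonneg n
  set u : ℝ → ℝ := fun x => ψ x - n * π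
  set g : ℝ → ℝ := fun x => sin (2 * u x) - 2 * u x + force (ψ x) * exp (-2 * x)
  have hψ : ∀ x, ψ x = n * π + u x := fun x => by simp only [u]; ring
  have hu : ∀ x, HasDerivAt u (p x) x := fun x => (h.hasDerivAt x).sub_const _
  have hp : ∀ x, HasDerivAt p (2 * u x + g x - p x) x := fun x => by
    refine (h.hasDerivAt_velocity x).congr_deriv ?_
    have := sin_two_mul_nat_mul_pi_add n (u x)
    rw [← hψ] at this
    rw [this]; simp only [g]; ring
  have hu0 : Tendsto u atTop (𝓝 0) := by simpa using hlim.sub_const (n * π)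
  have hexp : ∀ a b x : ℝ, exp (a * x) * exp (b * x) = exp ((a + b) * x) := fun a b x => by
    rw [← exp_add]; ring_nf
  obtain ⟨X₁, hX₁⟩ := (hu0.eventually
    (Metric.closedBall_mem_nhds 0 one_pos)).exists_forall_of_atTop
  have hg : ∀ C q X : ℝ, 0 ≤ C → 0 ≤ X → X₁ ≤ X → 0 ≤ q →
      (∀ x, X ≤ x → |u x| ≤ C * exp (-q * x)) → ∀ x, X ≤ x → |g x| ≤
        2 * C ^ 3 * exp (-(3 * q) * x) + 2 * (n * π + 2) * C ^ 2 * exp (-(2 * q + 2) * x) := by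
    intro C q X hC hX hXX₁ hq hb x hx
    have h1 := abs_sin_two_mul_sub_le (u x)
    have h2 : |u x| ^ 3 ≤ C ^ 3 * exp (-(3 * q) * x) := by
      have : (C * exp (-q * x)) ^ 3 = C ^ 3 * exp (-(3 * q) * x) := by
        rw [mul_pow, ← exp_nat_mul]; push_cast; ring_nf
      rw [← this]
      gcongr
      exact hb x hx
    have h3 : |u x| ^ 2 ≤ C ^ 2 * exp (-(2 * q) * x) := by
      have : (C * exp (-q * x)) ^ 2 = C ^ 2 * exp (-(2 * q) * x) := by
        rw [mul_pow, ← exp_nat_mul]; push_cast; ring_nf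
      rw [← this]
      gcongr
      exact hb x hx
    have h4 : |force (ψ x)| ≤ (n * π + 2) * (2 * |u x| ^ 2) := by
      rw [force_eq, abs_mul, hψ, sin_nat_mul_pi_add_sq, abs_of_nonneg (by positivity :
        0 ≤ 2 * sin (u x) ^ 2), sq_abs]
      have e1 : |u x| ≤ 1 := by simpa using hX₁ x (hXX₁.trans hx)
      have e2 : |charge (n * π + u x)| ≤ n * π + 2 := by
        unfold charge
        refine (abs_sub _ _).trans ?_
        have e3 : |sin (n * π + u x) * cos (n * π + u x)| ≤ 1 := by
          rw [abs_mul]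
          exact mul_le_one₀ (abs_sin_le_one _) (abs_nonneg _) (abs_cos_le_one _)
        have e4 := abs_add_le (n * π) (u x)
        rw [abs_of_nonneg hnπ] at e4
        linarith
      have e5 := sin_sq_le_sq' (u x)
      gcongr
    have h5 : |force (ψ x) * exp (-2 * x)|
        ≤ 2 * (n * π + 2) * C ^ 2 * exp (-(2 * q + 2) * x) := by
      rw [abs_mul, abs_of_pos (exp_pos (-2 * x))]
      calc _ ≤ (n * π + 2) * (2 * (C ^ 2 * exp (-(2 * q) * x))) * exp (-2 * x) := by
            gcongr
            refine h4.trans ?_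
            gcongr
        _ = 2 * (n * π + 2) * C ^ 2 * (exp (-(2 * q) * x) * exp (-2 * x)) := by ring
        _ = _ := by rw [hexp]; ring_nf
    refine (abs_add_le _ _).trans (add_le_add ?_ h5)
    linarith
  obtain ⟨C, X₂, hC, hdec⟩ := h.exists_abs_sub_le hlim
  set X := max 0 (max X₁ X₂)
  have hX0 : 0 ≤ X := le_max_left _ _
  have hXX₁ : X₁ ≤ X := (le_max_left _ _).trans (le_max_right _ _)
  have hXX₂ : X₂ ≤ X := (le_max_right _ _).trans (le_max_right _ _)
  have hmono : ∀ a b x : ℝ, a ≤ b → X ≤ x → exp (a * x) ≤ exp (b * x) := fun a b x hab hx =>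
    exp_le_exp.mpr (mul_le_mul_of_nonneg_right hab (hX0.trans hx))
  have hg1 : ∀ x, X ≤ x → |g x| ≤ (2 * C ^ 3 + 2 * (n * π + 2) * C ^ 2) * exp (-(9 / 2) * x) := by
    intro x hx
    refine (hg C (3 / 2) X hC hX0 hXX₁ (by norm_num)
      (fun y hy => hdec y (hXX₂.trans hy)) x hx).trans ?_
    rw [add_mul]
    gcongr ?_ * ?_ + ?_ * ?_
    · exact hmono _ _ _ (by norm_num) hx
    · exact hmono _ _ _ (by norm_num) hx
  obtain ⟨α₁, D₁, h1⟩ :=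
    exists_asymptotics (by norm_num) (fun x _ => hu x) (fun x _ => hp x) hu0 hg1
  have hu2 : ∀ x, X ≤ x → |u x| ≤ (|D₁| + |α₁|) * exp (-2 * x) := by
    intro x hx
    have e1 := (h1 x hx).1
    have e2 : |u x| ≤ |u x + α₁ * exp (-2 * x)| + |α₁ * exp (-2 * x)| := by
      simpa using abs_sub (u x + α₁ * exp (-2 * x)) (α₁ * exp (-2 * x))
    rw [abs_mul α₁, abs_of_pos (exp_pos (-2 * x))] at e2
    have e3 : D₁ * exp (-(9 / 2) * x) ≤ |D₁| * exp (-2 * x) := by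
      gcongr ?_ * ?_
      · exact le_abs_self _
      · exact hmono _ _ _ (by norm_num) hx
    linarith
  set C₂ := |D₁| + |α₁|
  have hg2 : ∀ x, X ≤ x → |g x| ≤ (2 * C₂ ^ 3 + 2 * (n * π + 2) * C₂ ^ 2) * exp (-6 * x) := by
    intro x hx
    refine (hg C₂ 2 X (by positivity) hX0 hXX₁ (by norm_num) hu2 x hx).trans_eq ?_
    norm_num
    ring
  obtain ⟨α, D, h2⟩ := exists_asymptotics (by norm_num) (fun x _ => hu x) (fun x _ => hp x) hu0 hg2
  exact ⟨α, D, X, h2⟩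

/-- The leading coefficient of the approach to `nπ` is positive. -/
lemma expansion_coeff_pos (h : Trajectory ψ p) (hn : 1 ≤ n)
    (hlim : Tendsto ψ atTop (𝓝 (n * π))) {α D X : ℝ}
    (hα : ∀ x, X ≤ x → |ψ x - n * π + α * exp (-2 * x)| ≤ D * exp (-6 * x)) : 0 < α := by
  set c := n * π - ψ 0
  have hc : 0 < c := sub_pos.mpr (h.lt_nat_mul_pi hn hlim 0)
  have he : ∀ k x : ℝ, HasDerivAt (fun x => k * exp (-2 * x)) (-2 * k * exp (-2 * x)) x :=
    fun k x => (((hasDerivAt_id x).const_mul (-2)).exp.const_mul k).congr_deriv (by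
      simp only [id]; ring)
  have hexp0 : Tendsto (fun x : ℝ => exp (-2 * x)) atTop (𝓝 0) :=
    tendsto_exp_atBot.comp (tendsto_id.const_mul_atTop_of_neg (by norm_num))
  -- The distance `z = nπ - ψ` satisfies `z'' + z' ≤ 2z`, and `exp (-2x)` solves the equality, so
  -- `z` stays above `c exp (-2x)`. With `α ≤ 0` the expansion would give `z = O(exp (-6x))`.
  have hlow := nonpos_of_comparison (X := 0) (d := fun x => c * exp (-2 * x) - (n * π - ψ x))
    (by simp [c]) (fun x _ => (he c x).sub ((h.hasDerivAt x).const_sub _))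
    (fun x _ => (he _ x).sub (h.hasDerivAt_velocity x).neg)
    (by simpa using (hexp0.const_mul c).sub (hlim.const_sub (n * π)))
    (fun x hx h0 h1 => by
      have hf := mul_nonneg (force_nonneg (h.pos hn hlim x).le) (exp_pos (-2 * x)).le
      have hz := h.lt_nat_mul_pi hn hlim x
      have hs : -sin (2 * ψ x) ≤ 2 * (n * π - ψ x) := by
        have e : ψ x = n * π + -(n * π - ψ x) := by ring
        rw [e, sin_two_mul_nat_mul_pi_add, mul_neg, sin_neg, neg_neg]
        refine (sin_le (by linarith)).trans_eq ?_
        ring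
      linarith)
  by_contra! hα0
  have hexp4 : Tendsto (fun x : ℝ => c * exp (4 * x)) atTop atTop :=
    (tendsto_exp_atTop.comp (tendsto_id.const_mul_atTop (by norm_num))).const_mul_atTop hc
  obtain ⟨x, hxD, hx0, hxX⟩ := ((hexp4.eventually_gt_atTop D).and
    ((eventually_ge_atTop 0).and (eventually_ge_atTop X))).exists
  have h1 := neg_le_of_abs_le (hα x hxX)
  have h2 := hlow x hx0
  have h3 : α * exp (-2 * x) ≤ 0 := mul_nonpos_of_nonpos_of_nonneg hα0 (exp_pos _).le
  have h4 : D * exp (-6 * x) < c * exp (4 * x) * exp (-6 * x) := by gcongr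
  have h5 : exp (4 * x) * exp (-6 * x) = exp (-2 * x) := by rw [← exp_add]; ring_nf
  rw [mul_assoc, h5] at h4
  linarith

end Trajectory

/-! ### Return to the radial variable -/

/-- A stationary map is a trajectory in the logarithmic variable. -/
lemma IsStationaryMap.trajectory {n : ℕ} {φ : ℝ → ℝ} (h : IsStationaryMap n φ) :
    Trajectory (fun x => φ (exp x)) (fun x => exp x * deriv φ (exp x)) where
  hasDerivAt x := ((h.differentiableAt _ (exp_pos x)).hasDerivAt.comp x
    (Real.hasDerivAt_exp x)).congr_deriv (mul_comm _ _)
  hasDerivAt_velocity x := by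
    have e := Real.hasDerivAt_exp x
    have h' := (h.differentiableAt_deriv _ (exp_pos x)).hasDerivAt.comp x e
    refine (e.mul h').congr_deriv ?_
    have hr := (exp_pos x).ne'
    have hx : exp (-2 * x) = 1 / exp x ^ 2 := by
      rw [← exp_nat_mul, one_div, ← exp_neg]; congr 1; push_cast; ring
    have := eq_sub_of_add_eq (h.equation _ (exp_pos x))
    simp only [Function.comp, hx, force, charge]
    rw [this]
    field_simp
    ring
  tendsto_atBot := by
    have h1 : Tendsto φ (𝓝[Ici 0] 0) (𝓝 (φ 0)) := h.continuousWithinAt_zero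
    rw [h.map_zero] at h1
    refine h1.comp (tendsto_nhdsWithin_iff.mpr ⟨tendsto_exp_atBot, ?_⟩)
    exact Eventually.of_forall fun x => (exp_pos x).le

/-- The solution with slope `β` at the origin. -/
noncomputable def profile (β r : ℝ) : ℝ := r * reducedProfile β r

/-- The derivative of `profile β`. -/
noncomputable def profileSlope (β r : ℝ) : ℝ := reducedProfile β r + r * reducedSlope β r

section profile

variable {n : ℕ} {β : ℝ}

lemma profile_exp (β x : ℝ) : profile β (exp x) = shot β x := rfl

lemma profile_eq_shot (β : ℝ) {r : ℝ} (hr : 0 < r) : profile β r = shot β (log r) := by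
  rw [← profile_exp, exp_log hr]

lemma mul_profileSlope_eq (β : ℝ) {r : ℝ} (hr : 0 < r) :
    r * profileSlope β r = shotVelocity β (log r) := by
  rw [shotVelocity, exp_log hr, profileSlope]; ring

lemma hasDerivAt_profile (β : ℝ) {r : ℝ} (hr : 0 < r) :
    HasDerivAt (profile β) (profileSlope β r) r :=
  ((hasDerivAt_id r).mul (hasDerivAt_reducedProfile β hr)).congr_deriv (by
    simp [profileSlope])

lemma hasDerivAt_profileSlope (β : ℝ) {r : ℝ} (hr : 0 < r) :
    HasDerivAt (profileSlope β) (sin (2 * profile β r) / r ^ 2 + force (profile β r) / r ^ 4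
      - 2 / r * profileSlope β r) r := by
  refine ((hasDerivAt_reducedProfile β hr).add
    ((hasDerivAt_id r).mul (hasDerivAt_reducedSlope β hr))).congr_deriv ?_
  have hs := pow_three_mul_source hr.ne' (reducedProfile β r)
  have e : source r (reducedProfile β r) = (sin (2 * profile β r) - 2 * profile β r
      + force (profile β r) / r ^ 2) / r ^ 3 := by
    rw [eq_div_iff (by positivity), mul_comm, hs]; rfl
  simp only [id, e, profileSlope]
  simp only [profile]
  field_simp
  ring

lemma deriv_profile (β : ℝ) : EqOn (deriv (profile β)) (profileSlope β) (Ioi 0) :=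
  fun _ hr => (hasDerivAt_profile β hr).deriv

lemma continuous_profile (β : ℝ) : Continuous (profile β) :=
  continuous_id.mul (continuous_reducedProfile β)

lemma continuous_reducedSlope (β : ℝ) : Continuous (reducedSlope β) :=
  continuous_radialInt_inner (continuous_source_reducedProfile β)

lemma continuous_profileSlope (β : ℝ) : Continuous (profileSlope β) :=
  (continuous_reducedProfile β).add (continuous_id.mul (continuous_reducedSlope β))

lemma profile_zero (β : ℝ) : profile β 0 = 0 := by simp [profile]

lemma tendsto_profile (hlim : Tendsto (shot β) atTop (𝓝 (n * π))) :
    Tendsto (profile β) atTop (𝓝 (n * π)) :=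
  (hlim.comp tendsto_log_atTop).congr' <| (eventually_gt_atTop 0).mono fun _ hr =>
    (profile_eq_shot β hr).symm

lemma isStationaryMap_profile (hlim : Tendsto (shot β) atTop (𝓝 (n * π))) :
    IsStationaryMap n (profile β) := by
  have hd : ∀ r, 0 < r → HasDerivAt (deriv (profile β)) (sin (2 * profile β r) / r ^ 2
      + force (profile β r) / r ^ 4 - 2 / r * profileSlope β r) r := fun r hr =>
    (hasDerivAt_profileSlope β hr).congr_of_eventuallyEq
      ((deriv_profile β).eventuallyEq_of_mem (isOpen_Ioi.mem_nhds hr))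
  refine ⟨fun r hr => (hasDerivAt_profile β hr).differentiableAt,
    fun r hr => (hd r hr).differentiableAt, fun r hr => ?_, profile_zero β,
    (continuous_profile β).continuousWithinAt, tendsto_profile hlim⟩
  rw [(hd r hr).deriv, deriv_profile β hr, sub_add_cancel]
  rfl

/-- A bootstrap on the pair of profile and slope: each equation expresses a derivative through the
pair, so smoothness of order `m` gives order `m + 1`. -/
lemma contDiffOn_profile (β : ℝ) : ContDiffOn ℝ ∞ (profile β) (Ioi 0) := by
  suffices h : ∀ m : ℕ, ContDiffOn ℝ m (profile β) (Ioi 0) ∧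
      ContDiffOn ℝ m (profileSlope β) (Ioi 0) from contDiffOn_infty.mpr fun m => (h m).1
  intro m
  induction m with
  | zero =>
    simp only [CharP.cast_eq_zero, contDiffOn_zero]
    exact ⟨(continuous_profile β).continuousOn, (continuous_profileSlope β).continuousOn⟩
  | succ m ih =>
    obtain ⟨h1, h2⟩ := ih
    have hf : ContDiff ℝ m force := contDiff_force.of_le (by exact_mod_cast le_top)
    simp only [Nat.cast_add, Nat.cast_one]
    rw [contDiffOn_succ_iff_deriv_of_isOpen isOpen_Ioi,
      contDiffOn_succ_iff_deriv_of_isOpen isOpen_Ioi]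
    refine ⟨⟨fun r hr => (hasDerivAt_profile β hr).differentiableAt.differentiableWithinAt,
      by simp, h2.congr (deriv_profile β)⟩,
      ⟨fun r hr => (hasDerivAt_profileSlope β hr).differentiableAt.differentiableWithinAt,
      by simp, ?_⟩⟩
    refine ContDiffOn.congr (f := fun r => sin (2 * profile β r) / r ^ 2
      + force (profile β r) / r ^ 4 - 2 / r * profileSlope β r) ?_
      fun r hr => (hasDerivAt_profileSlope β hr).deriv
    have hid : ContDiffOn ℝ m (fun r : ℝ => r) (Ioi 0) := contDiffOn_id
    have hne : ∀ r ∈ Ioi (0 : ℝ), r ≠ 0 := fun r hr => ne_of_gt hr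
    refine ((((contDiffOn_const.mul h1).sin).div (hid.pow 2)
      fun r hr => pow_ne_zero 2 (hne r hr)).add
      ((hf.comp_contDiffOn h1).div (hid.pow 4) fun r hr => pow_ne_zero 4 (hne r hr))).sub
      ((contDiffOn_const.div hid hne).mul h2)

lemma hasDerivAt_profile_zero (β : ℝ) : HasDerivAt (profile β) β 0 := by
  rw [hasDerivAt_iff_tendsto_slope]
  have h1 : Tendsto (reducedProfile β) (𝓝[≠] 0) (𝓝 β) := by
    have := (continuous_reducedProfile β).tendsto 0
    rw [reducedProfile_apply_zero] at this
    exact this.mono_left nhdsWithin_le_nhds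
  refine h1.congr' ?_
  filter_upwards [self_mem_nhdsWithin] with r hr
  rw [slope_def_field, profile_zero, profile]
  have : r ≠ 0 := hr
  field_simp
  simp

lemma isBigO_zpow_atTop {m : ℤ} (hm : m ≤ 0) :
    (fun r : ℝ => r ^ m) =O[atTop] fun _ => (1 : ℝ) := by
  refine Asymptotics.IsBigO.of_bound 1 ?_
  filter_upwards [eventually_ge_atTop 1] with r hr
  rw [norm_of_nonneg (by positivity), norm_one, mul_one]
  exact zpow_le_one_of_nonpos₀ hr hm

lemma isBigO_pow_nhdsGT (m : ℕ) :
    (fun r : ℝ => r ^ (m : ℤ)) =O[𝓝[>] 0] fun _ => (1 : ℝ) := by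
  refine Asymptotics.IsBigO.of_bound 1 ?_
  filter_upwards [Ioc_mem_nhdsGT one_pos] with r hr
  have := hr.1
  rw [norm_of_nonneg (by positivity), norm_one, mul_one, zpow_natCast]
  exact pow_le_one₀ hr.1.le hr.2

/-- The integral equation gives `w - β = O(r²)` and `w' = O(r)`, hence the bounds for the error and
its first derivative. The linear function `β r` solves the homogeneous Euler equation, so the error
inherits a right-hand side of cubic order. -/
lemma expansionAtZero_profile (β : ℝ) : ExpansionAtZero (profile β) β := by
  intro k
  have hl : Ioi (0 : ℝ) ∈ 𝓝[>] (0 : ℝ) := self_mem_nhdsWithin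
  obtain ⟨M, hM⟩ := isCompact_Icc.exists_bound_of_continuousOn (s := Icc (0 : ℝ) 1)
    (continuous_source_reducedProfile β).continuousOn
  have hM0 : 0 ≤ M := (norm_nonneg _).trans (hM 0 ⟨le_rfl, zero_le_one⟩)
  have hw : ∀ r ∈ Ioc (0 : ℝ) 1, |reducedProfile β r - β| ≤ M * r ^ 2 := fun r hr => by
    rw [reducedProfile_eq β hr.1.le, add_sub_cancel_left]
    refine (abs_radialInt_le (continuous_source_reducedProfile β) continuous_const hr.1.le
      fun s hs => hM s ⟨hs.1, hs.2.trans hr.2⟩).trans ?_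
    rw [radialInt_const]
    nlinarith [mul_nonneg hM0 (sq_nonneg r)]
  have hq : ∀ r ∈ Ioc (0 : ℝ) 1, |reducedSlope β r| ≤ M * r := fun r hr => by
    rw [reducedSlope, abs_mul, abs_of_pos hr.1, mul_comm]
    refine mul_le_mul_of_nonneg_right ?_ hr.1.le
    have := intervalIntegral.norm_integral_le_of_norm_le_const (a := 0) (b := 1) (C := M)
      (f := fun t => t ^ 4 * source (r * t) (reducedProfile β (r * t))) fun t ht => by
        rw [uIoc_of_le zero_le_one] at ht
        rw [norm_mul, norm_of_nonneg (pow_nonneg ht.1.le 4)]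
        have e1 : t ^ 4 ≤ 1 := pow_le_one₀ ht.1.le ht.2
        have e2 := hM (r * t) ⟨mul_nonneg hr.1.le ht.1.le, mul_le_one₀ hr.2 ht.1.le ht.2⟩
        nlinarith [norm_nonneg (source (r * t) (reducedProfile β (r * t)))]
    simpa using this
  have hsym := IsSymbol.of_euler_equation (p := 3) hl (e := fun r => profile β r - β * r)
    (e' := fun r => profileSlope β r - β * 1)
    (g := fun r => profile β r ^ 3 * cubicCoeff (profile β r)
      + profile β r ^ 5 * quinticCoeff (profile β r) * (1 * r ^ (-2 : ℤ)))
    (fun r hr => (hasDerivAt_profile β hr).sub ((hasDerivAt_id r).const_mul β))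
    (fun r hr => by
      refine ((hasDerivAt_profileSlope β hr).sub_const _).congr_deriv ?_
      rw [← force_eq_pow_mul, ← sin_two_mul_sub_eq]
      have : r ^ (-2 : ℤ) = (r ^ 2)⁻¹ := by rw [zpow_neg]; rfl
      rw [this]
      field_simp
      ring)
    (fun k hk => by
      have hφ : IsSymbol (𝓝[>] 0) k 1 (profile β) := by
        have h1 := hk.mono_exponent (q := 1) hl (by
          simpa using isBigO_pow_nhdsGT 2)
        refine (h1.add hl (IsSymbol.const_mul_zpow (p := 1) hl β)).congr hl fun r _ => ?_
        simp
      have hφ0 : IsSymbol (𝓝[>] 0) k 0 (profile β) := hφ.mono_exponent hl (by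
        simpa using isBigO_pow_nhdsGT 1)
      have h3 := (hφ.pow hl 3).mul hl (hφ0.comp hl contDiff_cubicCoeff)
      have h5 := ((hφ.pow hl 5).mul hl (hφ0.comp hl contDiff_quinticCoeff)).mul hl
        (IsSymbol.const_mul_zpow (p := -2) hl 1)
      norm_num at h3 h5
      simpa using h3.add hl h5)
    (by
      refine Asymptotics.IsBigO.of_bound M ?_
      filter_upwards [Ioc_mem_nhdsGT one_pos] with r hr
      have e : profile β r - β * r = r * (reducedProfile β r - β) := by rw [profile]; ring
      have hr0 := hr.1
      rw [e, norm_mul, norm_of_nonneg hr.1.le, norm_of_nonneg (by positivity : 0 ≤ r ^ (3 : ℤ))]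
      have := hw r hr
      calc r * ‖reducedProfile β r - β‖ ≤ r * (M * r ^ 2) := by gcongr; exact this
        _ = M * r ^ (3 : ℤ) := by norm_cast; ring)
    (by
      refine Asymptotics.IsBigO.of_bound (2 * M) ?_
      filter_upwards [Ioc_mem_nhdsGT one_pos] with r hr
      have e : profileSlope β r - β * 1 = (reducedProfile β r - β) + r * reducedSlope β r := by
        rw [profileSlope]; ring
      have hr0 := hr.1
      rw [e, show (3 - 1 : ℤ) = 2 by norm_num, norm_of_nonneg (by positivity : 0 ≤ r ^ (2 : ℤ))]
      have h1 := hw r hr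
      have h2 := hq r hr
      refine (norm_add_le _ _).trans ?_
      rw [norm_mul, norm_of_nonneg hr.1.le]
      calc ‖reducedProfile β r - β‖ + r * ‖reducedSlope β r‖ ≤ M * r ^ 2 + r * (M * r) := by
            gcongr
            · exact h1
            · exact h2
        _ = 2 * M * r ^ (2 : ℤ) := by norm_cast; ring) k
  exact hsym.iteratedDeriv_isBigO

lemma expansionAtInfinity_profile {α D X : ℝ}
    (h : ∀ x, X ≤ x → |shot β x - n * π + α * exp (-2 * x)| ≤ D * exp (-6 * x) ∧
      |shotVelocity β x - 2 * α * exp (-2 * x)| ≤ D * exp (-6 * x)) :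
    ExpansionAtInfinity n (profile β) α := by
  intro k
  have hl : Ioi (0 : ℝ) ∈ (atTop : Filter ℝ) := Ioi_mem_atTop 0
  have hsin1 : AnalyticOnNhd ℝ sin univ := fun y _ => by fun_prop
  -- Writing `sin y = y s(y)` with `s` smooth exhibits the factor `u²` in the force near `nπ`. With
  -- `u = O(r⁻²)`, both `u³` and `u² r⁻²` have order `-6`.
  obtain ⟨s, hs, hs'⟩ := exists_eq_pow_mul (k := 1) (C := 1) hsin1
    (fun y => by simpa using abs_sin_le_abs)
  set u : ℝ → ℝ := fun r => profile β r - n * π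
  have hφ : ∀ r, profile β r = n * π + u r := fun r => by simp only [u]; ring
  have hz : ∀ r : ℝ, r ^ (-2 : ℤ) = (r ^ 2)⁻¹ := fun r => by rw [zpow_neg]; rfl
  have hz3 : ∀ r : ℝ, r ^ (-3 : ℤ) = (r ^ 3)⁻¹ := fun r => by rw [zpow_neg]; rfl
  have hz4 : ∀ r : ℝ, r ^ (-4 : ℤ) = (r ^ 4)⁻¹ := fun r => by rw [zpow_neg]; rfl
  have hexp : ∀ m : ℤ, ∀ r : ℝ, 0 < r → exp (m * log r) = r ^ m := fun m r hr => by
    rw [mul_comm, ← rpow_def_of_pos hr, rpow_intCast]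
  have hc : ContDiff ℝ ∞ fun y => charge (n * π + y) * (2 * s y ^ 2) := by
    have := contDiff_charge
    fun_prop
  have hev : ∀ᶠ r : ℝ in atTop, 0 < r ∧ X ≤ log r :=
    (eventually_gt_atTop 0).and (tendsto_log_atTop.eventually_ge_atTop X)
  have hsym := IsSymbol.of_euler_equation (p := -6) hl
    (e := fun r => profile β r - (n * π - α * r ^ (-2 : ℤ)))
    (e' := fun r => profileSlope β r - 2 * α * r ^ (-3 : ℤ))
    (g := fun r => u r ^ 3 * cubicCoeff (u r)
      + u r ^ 2 * (charge (n * π + u r) * (2 * s (u r) ^ 2)) * (1 * r ^ (-2 : ℤ)))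
    (fun r hr => by
      have e := hasDerivAt_zpow (-2) r (Or.inl hr.ne')
      refine ((hasDerivAt_profile β hr).sub ((e.const_mul α).const_sub _)).congr_deriv ?_
      norm_num
      ring)
    (fun r hr => by
      have e := hasDerivAt_zpow (-3) r (Or.inl hr.ne')
      refine ((hasDerivAt_profileSlope β hr).sub (e.const_mul (2 * α))).congr_deriv ?_
      have e1 : sin (2 * profile β r) = 2 * u r + u r ^ 3 * cubicCoeff (u r) := by
        rw [hφ, sin_two_mul_nat_mul_pi_add, ← sin_two_mul_sub_eq]; ring
      have e2 : force (profile β r) = u r ^ 2 * (charge (n * π + u r) * (2 * s (u r) ^ 2)) := by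
        rw [force_eq, hφ, sin_nat_mul_pi_add_sq, hs' (u r)]; ring
      have e3 : profile β r - (n * π - α * r ^ (-2 : ℤ)) = u r + α * r ^ (-2 : ℤ) := by
        simp only [u]; ring
      rw [e1, e2, e3, show (-3 - 1 : ℤ) = -4 by norm_num, hz, hz3, hz4]
      push_cast
      field_simp
      ring)
    (fun k hk => by
      have hu : IsSymbol atTop k (-2) u := by
        have h1 := hk.mono_exponent (q := -2) hl (isBigO_zpow_atTop (by norm_num))
        refine (h1.add hl (IsSymbol.const_mul_zpow (p := -2) hl (-α))).congr hl fun r _ => ?_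
        simp only [u]; ring
      have hu0 : IsSymbol atTop k 0 u := hu.mono_exponent hl (isBigO_zpow_atTop (by norm_num))
      have h3 := (hu.pow hl 3).mul hl (hu0.comp hl contDiff_cubicCoeff)
      have h5 := ((hu.pow hl 2).mul hl (hu0.comp hl hc)).mul hl
        (IsSymbol.const_mul_zpow (p := -2) hl 1)
      norm_num at h3 h5
      simpa using h3.add hl h5)
    (by
      refine Asymptotics.IsBigO.of_bound D ?_
      filter_upwards [hev] with r hr
      have h1 := (h (log r) hr.2).1
      have e2 := hexp (-2) r hr.1
      have e6 := hexp (-6) r hr.1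
      push_cast at e2 e6
      rw [e2, e6, ← profile_eq_shot β hr.1] at h1
      have hr0 := hr.1
      rw [norm_of_nonneg (by positivity : 0 ≤ r ^ (-6 : ℤ)), Real.norm_eq_abs]
      rwa [sub_add] at h1)
    (by
      refine Asymptotics.IsBigO.of_bound D ?_
      filter_upwards [hev] with r hr
      have h1 := (h (log r) hr.2).2
      have e2 := hexp (-2) r hr.1
      have e6 := hexp (-6) r hr.1
      push_cast at e2 e6
      rw [e2, e6, ← mul_profileSlope_eq β hr.1] at h1
      have hr0 := hr.1
      rw [norm_of_nonneg (by positivity : 0 ≤ r ^ (-6 - 1 : ℤ)), Real.norm_eq_abs]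
      have e : r * profileSlope β r - 2 * α * r ^ (-2 : ℤ)
          = r * (profileSlope β r - 2 * α * r ^ (-3 : ℤ)) := by
        rw [hz, hz3]; field_simp
      have e' : r ^ (-6 : ℤ) = r * r ^ (-6 - 1 : ℤ) := by
        rw [zpow_sub_one₀ hr0.ne']; field_simp
      rw [e, abs_mul, abs_of_pos hr0, e', mul_left_comm] at h1
      exact le_of_mul_le_mul_left h1 hr0) k
  exact hsym.iteratedDeriv_isBigO

end profile

/-! ### Uniqueness of the coefficients and finiteness of the energy -/

lemma ExpansionAtInfinity.unique {n : ℕ} {φ : ℝ → ℝ} {α α' : ℝ} (h : ExpansionAtInfinity n φ α)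
    (h' : ExpansionAtInfinity n φ α') : α = α' := by
  have h0 := (h 0).sub (h' 0)
  simp only [iteratedDeriv_zero] at h0
  obtain ⟨C, hC⟩ := h0.bound
  have hlim : Tendsto (fun r : ℝ => C * r ^ (-4 : ℤ)) atTop (𝓝 0) := by
    simpa using (tendsto_zpow_atTop_zero (𝕜 := ℝ) (n := -4) (by norm_num)).const_mul C
  have hle : |α - α'| ≤ 0 := by
    refine ge_of_tendsto hlim ?_
    filter_upwards [hC, eventually_gt_atTop 0] with r hr hr0
    have e : φ r - (n * π - α * r ^ (-2 : ℤ)) - (φ r - (n * π - α' * r ^ (-2 : ℤ)))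
        = (α - α') * r ^ (-2 : ℤ) := by ring
    rw [e, norm_mul, norm_of_nonneg (by positivity : 0 ≤ r ^ (-2 : ℤ)),
      norm_of_nonneg (by positivity : 0 ≤ r ^ (-6 - ((0 : ℕ) : ℤ))), Real.norm_eq_abs] at hr
    have e6 : r ^ (-6 - ((0 : ℕ) : ℤ)) = r ^ (-4 : ℤ) * r ^ (-2 : ℤ) := by
      rw [← zpow_add₀ hr0.ne']; norm_num
    rw [e6, ← mul_assoc] at hr
    exact le_of_mul_le_mul_right hr (by positivity)
  exact sub_eq_zero.mp (abs_nonpos_iff.mp hle)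

lemma ExpansionAtZero.unique {φ : ℝ → ℝ} {β β' : ℝ} (h : ExpansionAtZero φ β)
    (h' : ExpansionAtZero φ β') : β = β' := by
  have h0 := (h 0).sub (h' 0)
  simp only [iteratedDeriv_zero] at h0
  obtain ⟨C, hC⟩ := h0.bound
  have hlim : Tendsto (fun r : ℝ => C * r ^ 2) (𝓝[>] 0) (𝓝 0) := by
    have : Continuous fun r : ℝ => C * r ^ 2 := by fun_prop
    simpa using (this.tendsto 0).mono_left (nhdsWithin_le_nhds (s := Ioi 0))
  have hle : |β' - β| ≤ 0 := by
    refine ge_of_tendsto hlim ?_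
    filter_upwards [hC, self_mem_nhdsWithin] with r hr hr0
    have hr0 : 0 < r := hr0
    have e : φ r - β * r - (φ r - β' * r) = (β' - β) * r := by ring
    rw [e, norm_mul, norm_of_nonneg hr0.le,
      norm_of_nonneg (by positivity : 0 ≤ r ^ (3 - ((0 : ℕ) : ℤ))), Real.norm_eq_abs] at hr
    have e3 : r ^ (3 - ((0 : ℕ) : ℤ)) = r ^ 2 * r := by
      rw [Nat.cast_zero, sub_zero]; norm_cast
    rw [e3, ← mul_assoc] at hr
    exact le_of_mul_le_mul_right hr hr0
  exact (sub_eq_zero.mp (abs_nonpos_iff.mp hle)).symm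

/-- On `(0, 1]` the bounds `|sin φ| ≤ r |w|` and `|charge φ| ≤ 2 r |w|` dominate the density by a
continuous function. At infinity the charge term, which has the size of `(nπ)² r⁻²`, fixes the
comparison function `r⁻²`; the other terms are bounded crudely by the same power. -/
lemma hasFiniteEnergy_profile {n : ℕ} {β α D X : ℝ}
    (h : ∀ x, X ≤ x → |shot β x - n * π + α * exp (-2 * x)| ≤ D * exp (-6 * x) ∧
      |shotVelocity β x - 2 * α * exp (-2 * x)| ≤ D * exp (-6 * x))
    (hlim : Tendsto (shot β) atTop (𝓝 (n * π))) : HasFiniteEnergy (profile β) := by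
  set E : ℝ → ℝ := fun r => 1 / 2 * (profileSlope β r ^ 2 + 2 * sin (profile β r) ^ 2 / r ^ 2
    + charge (profile β r) ^ 2 / r ^ 4) * r ^ 2
  have hE : EqOn E (energyDensity (profile β)) (Ioi 0) := fun r hr => by
    simp only [E, energyDensity, charge]; rw [deriv_profile β hr]
  refine IntegrableOn.congr_fun ?_ hE measurableSet_Ioi
  have hφc := continuous_profile β
  have hEc : ContinuousOn E (Ioi 0) := by
    have h1 := continuous_profileSlope β
    have h2 : Continuous fun r => charge (profile β r) := contDiff_charge.continuous.comp hφc
    have h3 : Continuous fun r => sin (profile β r) := by fun_prop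
    have hid : ContinuousOn (fun r : ℝ => r) (Ioi 0) := continuousOn_id
    exact ((((h1.pow 2).continuousOn).add ((continuousOn_const.mul (h3.pow 2).continuousOn).div
      (hid.pow 2) fun r hr => pow_ne_zero 2 (ne_of_gt hr))).add
      ((h2.pow 2).continuousOn.div (hid.pow 4) fun r hr => pow_ne_zero 4 (ne_of_gt hr))
        |>.const_smul (1 / 2 : ℝ)).mul (hid.pow 2)
  have hE0 : ∀ r, 0 ≤ E r := fun r => by simp only [E]; positivity
  have hnπ := nat_mul_pi_nonneg n
  rw [← Ioc_union_Ioi_eq_Ioi zero_le_one]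
  refine IntegrableOn.union ?_ ?_
  · set F : ℝ → ℝ := fun r => profileSlope β r ^ 2 + 6 * reducedProfile β r ^ 2
    have hF : Continuous F := by
      have h1 := continuous_profileSlope β
      have h2 := continuous_reducedProfile β
      fun_prop
    refine Integrable.mono' (hF.integrableOn_Ioc (a := 0) (b := 1))
      ((hEc.mono Ioc_subset_Ioi_self).aestronglyMeasurable measurableSet_Ioc) ?_
    refine (ae_restrict_iff' measurableSet_Ioc).mpr (Eventually.of_forall fun r hr => ?_)
    have hr0 := hr.1
    rw [norm_of_nonneg (hE0 r)]
    have e1 : sin (profile β r) ^ 2 ≤ (r * reducedProfile β r) ^ 2 := sin_sq_le_sq' _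
    have e2 : charge (profile β r) ^ 2 ≤ (2 * (r * reducedProfile β r)) ^ 2 := by
      refine sq_le_sq.mpr ?_
      have hc : |charge (profile β r)| ≤ 2 * |profile β r| := by
        have a1 : |sin (profile β r) * cos (profile β r)| ≤ |profile β r| := by
          rw [abs_mul]
          exact (mul_le_of_le_one_right (abs_nonneg _) (abs_cos_le_one _)).trans abs_sin_le_abs
        refine (abs_sub _ _).trans ?_
        linarith
      rw [abs_mul 2, abs_two]
      exact hc
    have e3 : E r = 1 / 2 * (profileSlope β r ^ 2 * r ^ 2) + sin (profile β r) ^ 2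
        + 1 / 2 * (charge (profile β r) ^ 2 / r ^ 2) := by
      simp only [E]; field_simp
    have e4 : charge (profile β r) ^ 2 / r ^ 2 ≤ 4 * reducedProfile β r ^ 2 := by
      rw [div_le_iff₀ (by positivity)]; linarith
    have hr2 : r ^ 2 ≤ 1 := pow_le_one₀ hr.1.le hr.2
    rw [e3]
    simp only [F]
    nlinarith [mul_nonneg (sq_nonneg (profileSlope β r)) (sub_nonneg.mpr hr2),
      mul_nonneg (sq_nonneg (reducedProfile β r)) (sub_nonneg.mpr hr2),
      sq_nonneg (profileSlope β r)]
  · refine IntegrableOn.mono_set (t := Ici 1) ?_ Ioi_subset_Ici_self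
    have hloc : LocallyIntegrableOn E (Ici 1) := ContinuousOn.locallyIntegrableOn
      (hEc.mono fun r hr => lt_of_lt_of_le one_pos (mem_Ici.mp hr)) measurableSet_Ici
    set K := |D| + 2 * |α|
    refine hloc.integrableOn_of_isBigO_atTop (g := fun r : ℝ => r ^ (-2 : ℝ)) ?_
      ⟨Ioi 1, Ioi_mem_atTop 1, integrableOn_Ioi_rpow_of_lt (by norm_num) one_pos⟩
    refine Asymptotics.IsBigO.of_bound (1 / 2 * (3 * K ^ 2 + (n * π + 1) ^ 2)) ?_
    have hnn : ∀ᶠ r in atTop, |charge (profile β r)| < n * π + 1 := by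
      have := ((contDiff_charge.continuous.tendsto _).comp (tendsto_profile hlim)).abs
      rw [charge_nat_mul_pi, abs_of_nonneg hnπ] at this
      exact this.eventually (gt_mem_nhds (by linarith))
    filter_upwards [eventually_ge_atTop 1, tendsto_log_atTop.eventually_ge_atTop X, hnn]
      with r hr hX hch
    have hr0 : 0 < r := by linarith
    set t := exp (-2 * log r)
    have ht0 : 0 < t := exp_pos _
    have ht1 : t ≤ 1 := exp_le_one_iff.mpr (by linarith [log_nonneg hr])
    have ht3 : exp (-6 * log r) ≤ t := exp_le_exp.mpr (by linarith [log_nonneg hr])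
    have htr : r ^ (-2 : ℝ) = t := by rw [rpow_def_of_pos hr0, mul_comm]
    have hrt : (r ^ 2)⁻¹ = t := by rw [← htr, rpow_neg hr0.le]; norm_cast
    have hD : D * exp (-6 * log r) ≤ |D| * t := by
      gcongr
      exact le_abs_self D
    obtain ⟨h1, h2⟩ := h (log r) hX
    rw [← profile_eq_shot β hr0] at h1
    rw [← mul_profileSlope_eq β hr0] at h2
    have hu : |profile β r - n * π| ≤ K * t := by
      have e := abs_sub (profile β r - n * π + α * t) (α * t)
      rw [add_sub_cancel_right, abs_mul α, abs_of_pos ht0] at e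
      simp only [K]
      linarith [mul_nonneg (abs_nonneg α) ht0.le]
    have hv : |r * profileSlope β r| ≤ K * t := by
      have e := abs_add_le (r * profileSlope β r - 2 * α * t) (2 * α * t)
      rw [sub_add_cancel, abs_mul (2 * α), abs_mul 2, abs_two, abs_of_pos ht0] at e
      simp only [K]
      linarith
    have htt : t ^ 2 ≤ t := by nlinarith
    have hK2 : (K * t) ^ 2 ≤ K ^ 2 * t := by
      rw [mul_pow]; gcongr
    have b1 : (r * profileSlope β r) ^ 2 ≤ K ^ 2 * t := by
      refine le_trans ?_ hK2
      rw [← sq_abs]; gcongr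
    have b2 : sin (profile β r) ^ 2 ≤ K ^ 2 * t := by
      refine le_trans ?_ hK2
      rw [show profile β r = n * π + (profile β r - n * π) by ring, sin_nat_mul_pi_add_sq]
      refine (sin_sq_le_sq' _).trans ?_
      rw [← sq_abs]; gcongr
    have b3 : charge (profile β r) ^ 2 * t ≤ (n * π + 1) ^ 2 * t := by
      rw [← sq_abs]; gcongr
    have e3 : E r = 1 / 2 * ((r * profileSlope β r) ^ 2 + 2 * sin (profile β r) ^ 2
        + charge (profile β r) ^ 2 * t) := by
      rw [← hrt]; simp only [E]; field_simp
    rw [norm_of_nonneg (hE0 r), htr, norm_of_nonneg ht0.le, e3]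
    linarith

theorem exists_shot_tendsto_nat (n : ℕ) :
    ∃ β : ℝ, (1 ≤ n → 0 < β) ∧ Tendsto (shot β) atTop (𝓝 (n * π)) := by
  rcases Nat.eq_zero_or_pos n with rfl | hn
  · refine ⟨0, by simp, ?_⟩
    rw [show shot 0 = fun _ => 0 from funext shot_zero]
    simp
  · obtain ⟨β, hβ, h⟩ := exists_shot_tendsto hn
    exact ⟨β, fun _ => hβ, h⟩

end AdkinsNappi

theorem theorem2p1 (n : ℕ) :
    ∃ Q : ℝ → ℝ,
      AdkinsNappi.IsStationaryMap n Q ∧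
      AdkinsNappi.HasFiniteEnergy Q ∧
      ContDiffOn ℝ ∞ Q (Ioi 0) ∧
      (∀ φ : ℝ → ℝ, AdkinsNappi.IsStationaryMap n φ → EqOn φ Q (Ici 0)) ∧
      (1 ≤ n →
        (DifferentiableOn ℝ Q (Ici 0) ∧ ∀ r : ℝ, 0 ≤ r → 0 < derivWithin Q (Ici 0) r) ∧
        (∃! α : ℝ, 0 < α ∧ AdkinsNappi.ExpansionAtInfinity n Q α) ∧
        (∃! β : ℝ, 0 < β ∧ AdkinsNappi.ExpansionAtZero Q β)) := by
  obtain ⟨β, hβ, hlim⟩ := AdkinsNappi.exists_shot_tendsto_nat n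
  have htraj := AdkinsNappi.trajectory_shot β
  obtain ⟨α, D, X, hexp⟩ := htraj.exists_expansion hlim
  refine ⟨AdkinsNappi.profile β, AdkinsNappi.isStationaryMap_profile hlim,
    AdkinsNappi.hasFiniteEnergy_profile hexp hlim,
    AdkinsNappi.contDiffOn_profile β, fun φ hφ r hr => ?_, fun hn => ⟨?_, ?_, ?_⟩⟩
  · rcases (mem_Ici.mp hr).eq_or_lt with h0 | h0
    · rw [← h0, hφ.map_zero, AdkinsNappi.profile_zero]
    -- Uniqueness is proved among all trajectories, so an arbitrary stationary map need not be
    -- identified with a shot beforehand.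
    · have := congrFun (hφ.trajectory.eq_of_tendsto htraj
        (hφ.tendsto_atTop.comp tendsto_exp_atTop) hlim) (log r)
      simp only [exp_log h0] at this
      rw [this, AdkinsNappi.profile_eq_shot β h0]
  · have hd : ∀ r, 0 ≤ r → ∃ v, 0 < v ∧ HasDerivAt (AdkinsNappi.profile β) v r := fun r hr => by
      rcases hr.eq_or_lt with rfl | h0
      · exact ⟨β, hβ hn, AdkinsNappi.hasDerivAt_profile_zero β⟩
      · refine ⟨_, ?_, AdkinsNappi.hasDerivAt_profile β h0⟩
        have := htraj.velocity_pos hn hlim (log r)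
        rw [← AdkinsNappi.mul_profileSlope_eq β h0] at this
        exact pos_of_mul_pos_right this h0.le
    refine ⟨fun r hr => ?_, fun r hr => ?_⟩
    · obtain ⟨v, -, hv⟩ := hd r hr
      exact hv.differentiableAt.differentiableWithinAt
    · obtain ⟨v, hv0, hv⟩ := hd r hr
      rwa [hv.hasDerivWithinAt.derivWithin (uniqueDiffOn_Ici 0 r hr)]
  · exact ⟨α, ⟨htraj.expansion_coeff_pos hn hlim fun x hx => (hexp x hx).1,
      AdkinsNappi.expansionAtInfinity_profile hexp⟩,
      fun α' h' => h'.2.unique (AdkinsNappi.expansionAtInfinity_profile hexp)⟩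
  · exact ⟨β, ⟨hβ hn, AdkinsNappi.expansionAtZero_profile β⟩,
      fun β' h' => h'.2.unique (AdkinsNappi.expansionAtZero_profile β)⟩
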